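/- A double complex is a family of complex vector spaces $A^{r,s}$, $(r,s)\in\mathbb Z^2$, with linear maps $\partial\colon A^{r,s}\to A^{r+1,s}$ and $\bar\partial\colon A^{r,s}\to A^{r,s+1}$ such that $\partial^2=0$, $\bar\partial^2=0$ and $\partial\bar\partial+\bar\partial\partial=0$; it is bounded if $A^{r,s}=0$ for $|r|+|s|$ large. Put $d=\partial+\bar\partial$. *Squares and zigzags.* The square at $(p,q)$ has a copy of $\mathbb C$ in each of the bidegrees $(p,q),(p+1,q),(p,q+1),(p+1,q+1)$, all arrows being $1$ except $\bar\partial\colon A^{p+1,q}\to A^{p+1,q+1}$, which is $-1$. A zigzag has a copy of $\mathbb C$ in each of the bidegrees listed below, any two horizontally or vertically adjacent ones being joined by the identity: - the odd zigzag $Z^{p,q}_k$ ($p,q,k\in\mathbb Z$): if $p+q\le k$, the $(r,s)$ with $r+s=k$, $r\ge p$, $s\ge q$ and those with $r+s=k+1$, $r>p$, $s>q$; if $p+q>k$, the $(r,s)$ with $r+s=k$, $r\le p$, $s\le q$ and those with $r+s=k-1$, $r<p$, $s<q$; - the horizontal even zigzag $Z^{p,q}_{1,l}$ ($l\ge1$):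 $(p+j,q-j)$ and $(p+j+1,q-j)$, $0\le j<l$; - the vertical even zigzag $Z^{p,q}_{2,l}$ ($l\ge1$): $(p-j,q+j)$ and $(p-j,q+j+1)$, $0\le j<l$. Every bounded double complex is isomorphic to a direct sum of squares and zigzags. We say that it has finitely many zigzags if only finitely many summands of such a decomposition are zigzags (squares may occur infinitely often), and $b^k_{p,q}$ denotes the number of summands $Z^{p,q}_k$. *Bigolin numbers.* For $p,q\in\mathbb Z$ let $$\mathcal B^k_{p,q}=\bigoplus_{r+s=k,\ r\le p,\ s\le q}A^{r,s}\ \ (k\le p+q),\qquad \mathcal B^k_{p,q}=\bigoplus_{r+s=k+1,\ r>p,\ s>q}A^{r,s}\ \ (k>p+q),$$ with differential $\mathcal B^k_{p,q}\to\mathcal B^{k+1}_{p,q}$ equal to $\pi\circ d$ if $k<p+q$, where $\pi$ is the projection onto the components with $r\le p$ and $s\le q$, to $\partial\bar\partial$ if $k=p+q$, and to $d$ if $k>p+q$. Let $h^k_{p,q}$ be the dimension of its cohomology in degree $k\in\mathbb Z$, and $$\tilde h^k_{p,q}=h^k_{p-1,q-1}-h^k_{p-1,q}-h^k_{p,q-1}+h^k_{p,q}.$$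 **Theorem.** Let $\mathcal A$ be a bounded double complex with finitely many zigzags. All $h^k_{p,q}$ are finite, and for all $p,q,k\in\mathbb Z$ only finitely many terms of the following sum are nonzero and $$\tilde h^k_{p,q}-\tilde h^{k-1}_{p,q}+\tilde h^{k-2}_{p,q}-\cdots=b^{k+1}_{p,q}.$$ In particular, the Bigolin numbers determine the multiplicities of all odd zigzags. **Corollary.** Let $\mathcal A_1,\mathcal A_2$ be bounded double complexes with finitely many zigzags. If their Frölicher spectral sequences (of the filtration of the total complex by the first degree) satisfy $E_r^{p,q}(\mathcal A_1)\cong E_r^{p,q}(\mathcal A_2)$ for all $p,q$ and all $r\ge1$, then they have the same multiplicities of horizontal even zigzags; the same condition on the conjugate Frölicher spectral sequences (filtration by the second degree) gives the same multiplicities of vertical even zigzags. Moreover, $\mathcal A_1$ and $\mathcal A_2$ are isomorphic up to squares, that is $\mathcal A_1\oplus Q_1\cong\mathcal A_2\oplus Q_2$ for some direct sums of squares $Q_1,Q_2$, if and only if all terms $E_r^{p,q}$, $r\ge 1$, of both of their Frölicher spectral sequences are isomorphic and they have the same Bigolin numbers. -/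

import Mathlib

open scoped DirectSum

universe u v w

noncomputable section

/-- A double complex of `K`-vector spaces: a `ℤ × ℤ`-graded vector space with two differentials,
`del` of bidegree `(1, 0)` and `delbar` of bidegree `(0, 1)`, that square to zero and
anticommute. -/
structure DoubleComplex (K : Type v) [Field K] where
  X : ℤ → ℤ → Type u
  [addCommGroup : ∀ p q, AddCommGroup (X p q)]
  [module : ∀ p q, Module K (X p q)]
  del : ∀ p q, X p q →ₗ[K] X (p + 1) q
  delbar : ∀ p q, X p q →ₗ[K] X p (q + 1)
  del_del : ∀ p q x, del (p + 1) q (del p q x) = 0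
  delbar_delbar : ∀ p q x, delbar p (q + 1) (delbar p q x) = 0
  del_delbar_add : ∀ p q x,
    del p (q + 1) (delbar p q x) + delbar (p + 1) q (del p q x) = 0

namespace DoubleComplex

variable {K : Type v} [Field K]

attribute [instance] DoubleComplex.addCommGroup DoubleComplex.module

/-- `A` vanishes in all bidegrees `(p, q)` with `|p| + |q|` large. -/
def IsBounded (A : DoubleComplex.{u} K) : Prop :=
  ∃ N : ℤ, ∀ p q : ℤ, N < |p| + |q| → Subsingleton (A.X p q)

/-- An isomorphism of double complexes. -/
structure Iso (A : DoubleComplex.{u} K) (B : DoubleComplex.{w} K) where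
  equiv : ∀ p q, A.X p q ≃ₗ[K] B.X p q
  comm_del : ∀ p q x, equiv (p + 1) q (A.del p q x) = B.del p q (equiv p q x)
  comm_delbar : ∀ p q x, equiv p (q + 1) (A.delbar p q x) = B.delbar p q (equiv p q x)

/-- The direct sum of two double complexes. -/
def prod (A : DoubleComplex.{u} K) (B : DoubleComplex.{w} K) : DoubleComplex.{max u w} K where
  X p q := A.X p q × B.X p q
  del p q := (A.del p q).prodMap (B.del p q)
  delbar p q := (A.delbar p q).prodMap (B.delbar p q)
  del_del p q x := by simp [A.del_del, B.del_del]
  delbar_delbar p q x := by simp [A.delbar_delbar, B.delbar_delbar]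
  del_delbar_add p q x := by simp [A.del_delbar_add, B.del_delbar_add]

/-- The direct sum of a family of double complexes. -/
def directSum {ι : Type u} (C : ι → DoubleComplex.{w} K) : DoubleComplex.{max u w} K where
  X p q := ⨁ i, (C i).X p q
  del p q := DirectSum.lmap fun i => (C i).del p q
  delbar p q := DirectSum.lmap fun i => (C i).delbar p q
  del_del p q x := by
    refine DFinsupp.ext fun i => ?_
    exact (C i).del_del p q (x i)
  delbar_delbar p q x := by
    refine DFinsupp.ext fun i => ?_
    exact (C i).delbar_delbar p q (x i)
  del_delbar_add p q x := by
    refine DFinsupp.ext fun i => ?_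
    exact (C i).del_delbar_add p q (x i)

end DoubleComplex

/-! ### Squares and zigzags -/

/-- The isomorphism types of squares and (finite) zigzags.
* `square p q`: the square with lower left corner `(p, q)`.
* `odd p q k`: the odd zigzag `Z^{p,q}_k` of total degree `k`, of length `2 |p + q - k| + 1`: a dot
  if `p + q = k`, looking down if `p + q < k`, looking up if `p + q > k`.
* `evenH p q l`: the horizontal even zigzag of length `2 l` with leftmost component `(p, q)`.
* `evenV p q l`: the vertical even zigzag of length `2 l` with lowest component `(p, q)`. -/
inductive Shape : Type
  | square (p q : ℤ)
  | odd (p q k : ℤ)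
  | evenH (p q : ℤ) (l : ℕ+)
  | evenV (p q : ℤ) (l : ℕ+)

namespace Shape

/-- All shapes other than squares. -/
def IsZigzag : Shape → Prop
  | square _ _ => False
  | _ => True

/-- The bidegrees in which the shape has a one-dimensional component.

For an odd zigzag of total degree `k` looking down, with top left component `(a, b)` and bottom
right component `(a', b')`, both of total degree `k`, one has `p = a` and `q = b'`; if it looks up,
then `p = a'` and `q = b`. -/
def support : Shape → Set (ℤ × ℤ)
  | square p q => {i | (i.1 = p ∨ i.1 = p + 1) ∧ (i.2 = q ∨ i.2 = q + 1)}
  | odd p q k => {i |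
      (p + q ≤ k ∧
        ((i.1 + i.2 = k ∧ p ≤ i.1 ∧ q ≤ i.2) ∨ (i.1 + i.2 = k + 1 ∧ p < i.1 ∧ q < i.2))) ∨
      (k < p + q ∧
        ((i.1 + i.2 = k ∧ i.1 ≤ p ∧ i.2 ≤ q) ∨ (i.1 + i.2 = k - 1 ∧ i.1 < p ∧ i.2 < q)))}
  | evenH p q l => {i | ∃ j : ℕ, j < (l : ℕ) ∧ (i = (p + j, q - j) ∨ i = (p + j + 1, q - j))}
  | evenV p q l => {i | ∃ j : ℕ, j < (l : ℕ) ∧ (i = (p - j, q + j) ∨ i = (p - j, q + j + 1))}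

/-- The scalar by which the vertical arrow out of a component in column `r` acts: all arrows of a
shape are `1`, except the right vertical arrow of a square, which is `-1`. -/
def sign (K : Type v) [Field K] : Shape → ℤ → K
  | square p _, r => if r = p then 1 else -1
  | _, _ => 1

/-- The total degrees of the components of a zigzag differ by at most one. -/
theorem degree_lt {S : Shape} (hS : S.IsZigzag) {r s r' s' : ℤ} (h : (r, s) ∈ S.support)
    (h' : (r', s') ∈ S.support) : r' + s' < r + s + 2 := by
  cases S with
  | square p q => exact hS.elim
  | odd p q k => simp only [support, Set.mem_ofPred_eq] at h h'; omega
  | evenH p q l =>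
    obtain ⟨j, -, h | h⟩ := h <;> obtain ⟨j', -, h' | h'⟩ := h' <;>
      simp only [Prod.mk.injEq] at h h' <;> omega
  | evenV p q l =>
    obtain ⟨j, -, h | h⟩ := h <;> obtain ⟨j', -, h' | h'⟩ := h' <;>
      simp only [Prod.mk.injEq] at h h' <;> omega

/-- The component of a shape in bidegree `(r, s)`: the field `K` if `(r, s)` belongs to the
support, and zero otherwise. -/
def component (K : Type v) [Field K] (S : Shape) (r s : ℤ) : Submodule K K where
  carrier := {x | (r, s) ∉ S.support → x = 0}
  add_mem' hx hy h := by rw [hx h, hy h, add_zero]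
  zero_mem' _ := rfl
  smul_mem' c x hx h := by rw [hx h, smul_zero]

open scoped Classical in
/-- Multiplication by `c` from one component of a shape to another one. -/
def arrow (K : Type v) [Field K] (S : Shape) (c : K) (r s r' s' : ℤ) :
    S.component K r s →ₗ[K] S.component K r' s' where
  toFun x := ⟨if (r', s') ∈ S.support then c * x.1 else 0, fun h => if_neg h⟩
  map_add' x y := by
    ext; simp only [Submodule.coe_add]; split_ifs <;> ring
  map_smul' a x := by
    ext; simp only [Submodule.coe_smul, smul_eq_mul, RingHom.id_apply]; split_ifs <;> ring

theorem component_eq_zero {K : Type v} [Field K] {S : Shape} {r s : ℤ}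
    (h : (r, s) ∉ S.support) (x : S.component K r s) : (x : K) = 0 :=
  x.2 h

/-- The irreducible double complex of a given shape. Every two horizontally or vertically adjacent
components are joined by an arrow. -/
def model (K : Type v) [Field K] (S : Shape) : DoubleComplex.{v} K where
  X r s := S.component K r s
  del r s := S.arrow K 1 r s (r + 1) s
  delbar r s := S.arrow K (S.sign K r) r s r (s + 1)
  del_del r s x := by
    ext
    simp only [arrow, LinearMap.coe_mk, AddHom.coe_mk, ZeroMemClass.coe_zero]
    split_ifs with h1 h2 <;> try simp
    by_contra hx
    have h0 : (r, s) ∈ S.support := by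
      by_contra h; exact hx (by simpa using component_eq_zero h x)
    cases S with
    | square p q => simp only [support, Set.mem_ofPred_eq] at h0 h1 h2; omega
    | _ =>
      have := degree_lt (by trivial) h0 h1
      omega
  delbar_delbar r s x := by
    ext
    simp only [arrow, LinearMap.coe_mk, AddHom.coe_mk, ZeroMemClass.coe_zero]
    split_ifs with h1 h2 <;> try simp
    by_contra hx
    have h0 : (r, s) ∈ S.support := by
      by_contra h; exact hx (by simpa using Or.inr (component_eq_zero h x))
    cases S with
    | square p q => simp only [support, Set.mem_ofPred_eq] at h0 h1 h2; omega
    | _ =>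
      have := degree_lt (by trivial) h0 h1
      omega
  del_delbar_add r s x := by
    ext
    simp only [arrow, LinearMap.coe_mk, AddHom.coe_mk, ZeroMemClass.coe_zero, Submodule.coe_add]
    by_cases h0 : (r, s) ∈ S.support
    swap
    · simp [component_eq_zero h0 x]
    by_cases h1 : (r + 1, s + 1) ∈ S.support
    swap
    · simp [h1]
    cases S with
    | square p q =>
      have hr : r = p := by simp only [support, Set.mem_ofPred_eq] at h0 h1; omega
      have hs : s = q := by simp only [support, Set.mem_ofPred_eq] at h0 h1; omega
      subst hr hs
      simp [support, sign]
    | _ =>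
      have := degree_lt (by trivial) h0 h1
      omega

end Shape

namespace DoubleComplex

variable {K : Type v} [Field K]

/-- A decomposition of a double complex as a direct sum of squares and zigzags. -/
structure Decomposition (A : DoubleComplex.{u} K) where
  ι : Type u
  shape : ι → Shape
  iso : Iso A (directSum fun i => (shape i).model K)

namespace Decomposition

variable {A : DoubleComplex.{u} K}

/-- The multiplicity of a shape in a decomposition (meaningful if it is finite). -/
def mult (D : Decomposition A) (S : Shape) : ℕ := {i | D.shape i = S}.ncard

end Decomposition

/-- Only finitely many summands in the decomposition of `A` are zigzags. -/
def HasFinitelyManyZigzags (A : DoubleComplex.{u} K) : Prop :=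
  ∀ D : Decomposition A, {i | (D.shape i).IsZigzag}.Finite

/-- `A` and `B` become isomorphic after adding direct sums of squares to both. -/
def IsoUpToSquares (A B : DoubleComplex.{u} K) : Prop :=
  ∃ (I J : Type u) (f : I → ℤ × ℤ) (g : J → ℤ × ℤ),
    Nonempty (Iso
      (A.prod (directSum fun i => (Shape.square (f i).1 (f i).2).model K))
      (B.prod (directSum fun j => (Shape.square (g j).1 (g j).2).model K)))

/-! ### The total space -/

variable (A : DoubleComplex.{u} K)

/-- The direct sum of all components of `A`. -/
abbrev Total : Type u := ⨁ i : ℤ × ℤ, A.X i.1 i.2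

/-- `∂` on the total space. -/
def delTot : A.Total →ₗ[K] A.Total :=
  DirectSum.toModule K (ℤ × ℤ) A.Total fun i =>
    DirectSum.lof K (ℤ × ℤ) (fun i => A.X i.1 i.2) (i.1 + 1, i.2) ∘ₗ A.del i.1 i.2

/-- `∂̄` on the total space. -/
def delbarTot : A.Total →ₗ[K] A.Total :=
  DirectSum.toModule K (ℤ × ℤ) A.Total fun i =>
    DirectSum.lof K (ℤ × ℤ) (fun i => A.X i.1 i.2) (i.1, i.2 + 1) ∘ₗ A.delbar i.1 i.2

/-- The total differential `d = ∂ + ∂̄`. -/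
def dTot : A.Total →ₗ[K] A.Total := A.delTot + A.delbarTot

/-- The subspace `⨁_{(r, s) ∈ S} A^{r,s}` of the total space. -/
def supportedOn (S : Set (ℤ × ℤ)) : Submodule K A.Total where
  carrier := {x | ∀ i, i ∉ S → x i = 0}
  add_mem' hx hy i hi := by simp [hx i hi, hy i hi]
  zero_mem' i _ := rfl
  smul_mem' c x hx i hi := by
    have h : (c • x) i = c • x i := rfl
    rw [h, hx i hi, smul_zero]

open scoped Classical in
/-- The projection of the total space onto `⨁_{(r, s) ∈ S} A^{r,s}`. -/
def projOn (S : Set (ℤ × ℤ)) : A.Total →ₗ[K] A.Total :=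
  DirectSum.lmap fun i => if i ∈ S then LinearMap.id else 0

/-! ### The Bigolin complex -/

/-- The bidegrees occurring in the term of degree `k` of the Bigolin complex of `(p, q)`. -/
def bigolinSupport (p q k : ℤ) : Set (ℤ × ℤ) :=
  if k ≤ p + q then {i | i.1 + i.2 = k ∧ i.1 ≤ p ∧ i.2 ≤ q}
  else {i | i.1 + i.2 = k + 1 ∧ p < i.1 ∧ q < i.2}

/-- The term of degree `k` of the Bigolin complex of `(p, q)`. -/
def bigolinTerm (p q k : ℤ) : Submodule K A.Total := A.supportedOn (bigolinSupport p q k)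

/-- The map inducing the differential from degree `k` to degree `k + 1` of the Bigolin complex of
`(p, q)`: it is `π ∘ d` with `π` the projection to the bidegrees `≤ (p, q)` if `k < p + q`, it is
`∂∂̄` if `k = p + q`, and `d` if `k > p + q`. -/
def bigolinD (p q k : ℤ) : A.Total →ₗ[K] A.Total :=
  if k < p + q then A.projOn {i | i.1 ≤ p ∧ i.2 ≤ q} ∘ₗ A.dTot
  else if k = p + q then A.delTot ∘ₗ A.delbarTot
  else A.dTot

/-- The cocycles of degree `k` of the Bigolin complex. -/
def bigolinCocycles (p q k : ℤ) : Submodule K A.Total :=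
  A.bigolinTerm p q k ⊓ LinearMap.ker (A.bigolinD p q k)

/-- The coboundaries of degree `k` of the Bigolin complex. -/
def bigolinCoboundaries (p q k : ℤ) : Submodule K A.Total :=
  (A.bigolinTerm p q (k - 1)).map (A.bigolinD p q (k - 1))

/-- The Bigolin cohomology `H^k_{p,q}`. -/
abbrev BigolinCohomology (p q k : ℤ) : Type u :=
  A.bigolinCocycles p q k ⧸ (A.bigolinCoboundaries p q k).submoduleOf (A.bigolinCocycles p q k)

/-- The Bigolin number `h^k_{p,q}` (meaningful if the cohomology is finite-dimensional). -/
def bigolinNumber (p q k : ℤ) : ℕ := Module.finrank K (A.BigolinCohomology p q k)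

/-- `h̃^k_{p,q} = h^k_{p-1,q-1} - h^k_{p-1,q} - h^k_{p,q-1} + h^k_{p,q}`. -/
def bigolinTilde (p q k : ℤ) : ℤ :=
  (A.bigolinNumber (p - 1) (q - 1) k : ℤ) - A.bigolinNumber (p - 1) q k
    - A.bigolinNumber p (q - 1) k + A.bigolinNumber p q k

/-! ### The Frölicher spectral sequences -/

/-- The step `l` of the filtration of `Tot^k` given by a weight `wt` on bidegrees:
`⨁_{r + s = k, wt (r, s) ≥ l} A^{r,s}`. -/
def filtration (wt : ℤ × ℤ → ℤ) (l k : ℤ) : Submodule K A.Total :=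
  A.supportedOn {i | i.1 + i.2 = k ∧ l ≤ wt i}

/-- `Z_r^l = {x ∈ F_l Tot^k | d x ∈ F_{l + r} Tot^{k+1}}`. -/
def filteredCycles (wt : ℤ × ℤ → ℤ) (r l k : ℤ) : Submodule K A.Total :=
  A.filtration wt l k ⊓ (A.filtration wt (l + r) (k + 1)).comap A.dTot

/-- The page `E_r` of the spectral sequence of the filtered complex `Tot`, in filtration degree
`l` and total degree `k`: the quotient of `Z_r^l` by `Z_{r-1}^{l+1} + d Z_{r-1}^{l-r+1}`. -/
abbrev filteredPage (wt : ℤ × ℤ → ℤ) (r l k : ℤ) : Type u :=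
  A.filteredCycles wt r l k ⧸
    (A.filteredCycles wt (r - 1) (l + 1) k ⊔
      (A.filteredCycles wt (r - 1) (l - r + 1) (k - 1)).map A.dTot).submoduleOf
        (A.filteredCycles wt r l k)

/-- `E_r^{p,q}` of the Frölicher spectral sequence (filtration by the first degree, so that `E_1`
is the `∂̄`-cohomology). -/
abbrev FrolicherPage (r : ℕ) (p q : ℤ) : Type u := A.filteredPage Prod.fst r p (p + q)

/-- `E_r^{p,q}` of the conjugate Frölicher spectral sequence (filtration by the second degree, so
that `E_1` is the `∂`-cohomology). -/
abbrev ConjFrolicherPage (r : ℕ) (p q : ℤ) : Type u := A.filteredPage Prod.snd r q (p + q)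

variable {A}

/-- The Frölicher spectral sequences of `A` and `B` have isomorphic terms on all pages from `E_1`
on. -/
def SameFrolicher (A B : DoubleComplex.{u} K) : Prop :=
  ∀ (r : ℕ) (p q : ℤ), 1 ≤ r → Nonempty (A.FrolicherPage r p q ≃ₗ[K] B.FrolicherPage r p q)

/-- The conjugate Frölicher spectral sequences of `A` and `B` have isomorphic terms on all pages
from `E_1` on. -/
def SameConjFrolicher (A B : DoubleComplex.{u} K) : Prop :=
  ∀ (r : ℕ) (p q : ℤ), 1 ≤ r →
    Nonempty (A.ConjFrolicherPage r p q ≃ₗ[K] B.ConjFrolicherPage r p q)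

/-- `A` and `B` have the same Bigolin numbers. -/
def SameBigolinNumbers (A B : DoubleComplex.{u} K) : Prop :=
  ∀ p q k : ℤ, A.bigolinNumber p q k = B.bigolinNumber p q k

end DoubleComplex

end

-- Existence of the decomposition. Write T for ∂∂̄. In each bidegree choose a complement of the
-- kernel of T; it generates a sum of squares, on which T is an isomorphism from the lower left to
-- the upper right corner. Generalized inverses `Q` of T single out a complement X of all these
-- squares by explicit equations, stable under ∂ and ∂̄, on which T = 0. In X the images of ∂ and ∂̄
-- are killed by both differentials. With a complement C of I = im ∂ + im ∂̄ the only arrows go from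
-- C in total degree k to I in total degree k + 1. For each k this is a representation of a quiver
-- of type A with alternating arrows. It is a sum of intervals, and the four possible parities of
-- the end points of an interval are the two kinds of odd zigzags and the horizontal and vertical
-- even ones.
--
-- The interval decomposition is built vertex by vertex. The induction carries a finite flag in the
-- current space such that every basis adapted to the flag comes from a decomposition of the part
-- already treated; a flag can be pushed forward or pulled back along the next arrow
-- (`HasDecompositionFlag.succ_of_odd`, `HasDecompositionFlag.succ_of_even`).
--
-- Numerical part. Bigolin cohomology and spectral sequence pages are subquotients compatible with
-- direct sums. Squares contribute nothing because they are contractible, by homotopies that respect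
-- the filtrations and, except for one square, the Bigolin complex. A zigzag is a path m, …, n in
-- which odd vertices have total degree k and even ones k + 1. The Bigolin complex of (p, q) only
-- sees the part of the path in a window, and a path has one-dimensional cohomology if its two ends
-- have the same parity and none otherwise. As a function of (p, q) the result depends on p alone or
-- on q alone for an even zigzag, so the second difference h̃ vanishes. For an odd zigzag it is the
-- indicator of a quadrant in one degree and of the opposite quadrant in the degree before, so h̃ is
-- 1 at the common corner. Hence h̃^k = b^{k+1} + b^k (`bigolinTilde_eq`), and the alternating sum
-- telescopes.
--
-- On zigzags the pages E_r and E_{r+1} differ exactly in the two ends of the even zigzags with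
-- parameter l = r. So dim E_r − dim E_{r+1} is a sum of two multiplicities, and induction along the
-- filtration separates them. If all multiplicities agree, adding the squares of each complex to the
-- other one gives isomorphic complexes; conversely all invariants are sums over zigzags and ignore
-- added squares.

universe w'

noncomputable section

/-! ### Representations of zigzag quivers -/

section ZigzagQuiver

variable {K : Type v} [Field K] {M : Type u} [AddCommGroup M] [Module K M]

/-- `B` is a basis of `U` such that each `F l` is spanned by a part of `B`. -/
structure IsAdaptedBasis (F : ℕ → Submodule K M) (U : Submodule K M) (B : Set M) : Prop where
  indep : LinearIndepOn K id B
  span_eq : Submodule.span K B = U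
  le_span : ∀ l, F l ≤ Submodule.span K (B ∩ F l)

/-- The basis is extended one step of the flag at a time. The hypothesis `h` says that `B₀` is
adapted to the flag within its own span; this is what keeps the members of `B₀` appearing at a later
step independent of everything chosen before. -/
theorem exists_basis_of_flag {F : ℕ → Submodule K M} (hF : Monotone F) {B₀ : Set M}
    (hB₀ : LinearIndepOn K id B₀)
    (h : ∀ l, Submodule.span K B₀ ⊓ F l ≤ Submodule.span K (B₀ ∩ F l)) (N : ℕ) :
    ∃ B : Set M, B₀ ∩ F N ⊆ B ∧ B ⊆ F N ∧ LinearIndepOn K id B ∧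
      ∀ l ≤ N, F l ≤ Submodule.span K (B ∩ F l) := by
  induction N with
  | zero =>
    obtain ⟨b, hb, hsb, htb, hib⟩ := exists_linearIndepOn_id_extension
      (hB₀.mono (Set.inter_subset_left (t := (F 0 : Set M)))) Set.inter_subset_right
    refine ⟨b, hsb, hb, hib, fun l hl => ?_⟩
    obtain rfl : l = 0 := by omega
    rwa [Set.inter_eq_left.2 hb]
  | succ N ih =>
    obtain ⟨B, h1, h2, h3, h4⟩ := ih
    have hspan : Submodule.span K B = F N :=
      le_antisymm (Submodule.span_le.2 h2) ((h4 N le_rfl).trans (Submodule.span_mono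
        Set.inter_subset_left))
    -- A common vector lies in `F N` and in the span of `B₀`, hence by `h` in the span of `B₀ ∩ F
    -- N`, which is independent of the members of `B₀` that are new at this step.
    have hdisj : Disjoint (Submodule.span K B)
        (Submodule.span K ((B₀ ∩ F (N + 1)) \ (B₀ ∩ F N))) := by
      rw [Submodule.disjoint_def]
      intro x hx hx'
      have hx1 : x ∈ Submodule.span K (B₀ ∩ F N) :=
        h N ⟨Submodule.span_mono (fun y hy => hy.1.1) hx', hspan ▸ hx⟩
      have hsub : B₀ ∩ F N ∪ (B₀ ∩ F (N + 1)) \ (B₀ ∩ F N) ⊆ B₀ := by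
        rintro y (hy | hy)
        · exact hy.1
        · exact hy.1.1
      exact Submodule.disjoint_def.1
        ((linearIndepOn_id_union_iff Set.disjoint_sdiff_right).1 (hB₀.mono hsub)).2.2 x hx1 hx'
    have hind := h3.id_union (hB₀.mono fun y hy => hy.1.1) hdisj
    obtain ⟨b, hb, hsb, htb, hib⟩ := exists_linearIndepOn_id_extension hind
      (t := (F (N + 1) : Set M)) (by
        rintro y (hy | hy)
        · exact hF (Nat.le_succ N) (h2 hy)
        · exact hy.1.2)
    refine ⟨b, fun y hy => ?_, hb, hib, fun l hl => ?_⟩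
    · by_cases hyN : y ∈ B₀ ∩ F N
      · exact hsb (Or.inl (h1 hyN))
      · exact hsb (Or.inr ⟨hy, hyN⟩)
    · rcases Nat.lt_or_ge l (N + 1) with hl' | hl'
      · exact (h4 l (by omega)).trans (Submodule.span_mono
          (Set.inter_subset_inter_left _ fun y hy => hsb (Or.inl hy)))
      · obtain rfl : l = N + 1 := by omega
        rwa [Set.inter_eq_left.2 hb]

/-- A thread `e` with support `[m, n]` in a representation of the zigzag quiver with vertices
`i ≤ t` and arrows `f : i → i + 1` and `g : i → i - 1` for odd `i`. -/
structure IsThread (f g : M →ₗ[K] M) (t m n : ℤ) (e : ℤ → M) : Prop where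
  le : m ≤ n
  le' : n ≤ t
  zero : ∀ i, ¬(m ≤ i ∧ i ≤ n) → e i = 0
  left : ∀ i, Odd i → m ≤ i → i ≤ n → g (e i) = e (i - 1)
  right : ∀ i, Odd i → m ≤ i → i ≤ n → i < t → f (e i) = e (i + 1)

/-- A decomposition into threads of the part of a representation of the zigzag quiver living in
the vertices `i ≤ t`, which induces the basis `B` at the vertex `t`. -/
def ThreadDecomposition (U : ℤ → Submodule K M) (f g : M →ₗ[K] M) (t : ℤ) (B : Set M) : Prop :=
  ∃ (J : Type u) (m n : J → ℤ) (e : J → ℤ → M),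
    (∀ j, IsThread f g t (m j) (n j) (e j)) ∧
    (∀ i ≤ t, LinearIndepOn K (fun j => e j i) {j | m j ≤ i ∧ i ≤ n j} ∧
      Submodule.span K ((fun j => e j i) '' {j | m j ≤ i ∧ i ≤ n j}) = U i) ∧
    (fun j => e j t) '' {j | n j = t} = B

open scoped Classical in
-- The map `σ` prescribes how the threads alive at `t` continue: a thread through `b` goes on to `σ
-- b`, or ends if `σ b = 0`, and each member of `B'` that is not reached starts a new thread. This
-- treats both directions of the next arrow: `σ` is `f` if the arrow leaves `t`, and a partial
-- inverse of `g` if it enters `t`.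
theorem ThreadDecomposition.extend {U : ℤ → Submodule K M} {f g : M →ₗ[K] M} {t : ℤ} {B B' : Set M}
    (h : ThreadDecomposition U f g t B) (σ : M → M) (hB' : LinearIndepOn K id B')
    (hspan : Submodule.span K B' = U (t + 1)) (hσ : ∀ b ∈ B, σ b = 0 ∨ σ b ∈ B')
    (hinj : ∀ b ∈ B, ∀ c ∈ B, σ b ≠ 0 → σ b = σ c → b = c)
    (hodd : Odd t → ∀ b ∈ B, f b = σ b)
    (heven : Odd (t + 1) → (∀ b ∈ B, σ b ≠ 0 → g (σ b) = b) ∧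
      ∀ b ∈ B', b ∉ σ '' B → g b = 0) :
    ThreadDecomposition U f g (t + 1) B' := by
  obtain ⟨J, m, n, e, hth, hbas, hB⟩ := h
  have hmemB : ∀ j, n j = t → e j t ∈ B := fun j hj => hB ▸ ⟨j, hj, rfl⟩
  have hnt : ∀ j, n j ≤ t := fun j => (hth j).le'
  have hmn : ∀ j, m j ≤ n j := fun j => (hth j).le
  have hzero : (0 : M) ∉ B' := by
    intro h0
    exact hB'.ne_zero h0 rfl
  let J' := J ⊕ {b : M // b ∈ B' ∧ b ∉ σ '' B}
  let m' : J' → ℤ := Sum.elim m fun _ => t + 1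
  let n' : J' → ℤ := Sum.elim (fun j => if n j = t ∧ σ (e j t) ≠ 0 then t + 1 else n j)
    fun _ => t + 1
  let e' : J' → ℤ → M := Sum.elim
    (fun j i => if i = t + 1 then (if n j = t then σ (e j t) else 0) else e j i)
    fun b i => if i = t + 1 then b.1 else 0
  have hlive : ∀ j, n' (Sum.inl j) = t + 1 ↔ n j = t ∧ σ (e j t) ≠ 0 := by
    intro j
    simp only [n', Sum.elim_inl]
    split_ifs with hj
    · simp [hj]
    · simp only [hj, iff_false]
      have := hnt j
      omega
  have himg : (fun j => e' j (t + 1)) '' {j | n' j = t + 1} = B' := by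
    ext b
    constructor
    · rintro ⟨j | b', hj, rfl⟩
      · have hj := (hlive j).1 hj
        simp only [e', Sum.elim_inl, if_true, hj.1]
        exact (hσ _ (hmemB j hj.1)).resolve_left hj.2
      · simpa [e'] using b'.2.1
    · intro hb
      by_cases hbσ : b ∈ σ '' B
      · obtain ⟨c, hc, rfl⟩ := hbσ
        obtain ⟨j, hj, rfl⟩ := hB.symm ▸ hc
        have hj : n j = t := hj
        refine ⟨Sum.inl j, (hlive j).2 ⟨hj, ?_⟩, by simp [e', hj]⟩
        intro h0
        exact hzero (h0 ▸ hb)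
      · exact ⟨Sum.inr ⟨b, hb, hbσ⟩, by simp [n'], by simp [e']⟩
  have hinjt : Set.InjOn (fun j => e j t) {j | n j = t} := by
    intro j hj j' hj' hjj
    have hj : n j = t := hj
    have hj' : n j' = t := hj'
    exact (hbas t le_rfl).1.injOn ⟨hj ▸ hmn j, hj.ge⟩ ⟨hj' ▸ hmn j', hj'.ge⟩ hjj
  have hinj' : Set.InjOn (fun j => e' j (t + 1)) {j | n' j = t + 1} := by
    rintro (j | b) hj (j' | b') hj' hjj
    · have hj := (hlive j).1 hj
      have hj' := (hlive j').1 hj'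
      simp only [e', Sum.elim_inl, if_true, hj.1, hj'.1] at hjj
      rw [hinjt hj.1 hj'.1 (hinj _ (hmemB j hj.1) _ (hmemB j' hj'.1) hj.2 hjj)]
    · have hj := (hlive j).1 hj
      simp only [e', Sum.elim_inl, Sum.elim_inr, if_true, hj.1] at hjj
      exact absurd ⟨_, hmemB j hj.1, hjj⟩ b'.2.2
    · have hj' := (hlive j').1 hj'
      simp only [e', Sum.elim_inl, Sum.elim_inr, if_true, hj'.1] at hjj
      exact absurd ⟨_, hmemB j' hj'.1, hjj.symm⟩ b.2.2
    · simp only [e', Sum.elim_inr, if_true] at hjj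
      rw [Subtype.ext hjj]
  have hn't : ∀ j, n' j ≤ t + 1 := by
    rintro (j | b)
    · have := hnt j
      simp only [n', Sum.elim_inl]
      split_ifs <;> omega
    · simp [n']
  have hm't : ∀ j, n' j = t + 1 → m' j ≤ t + 1 := by
    rintro (j | b) _
    · have := hnt j
      have := hmn j
      simp only [m', Sum.elim_inl]
      omega
    · simp [m']
  refine ⟨J', m', n', e', ?_, ?_, himg⟩
  · rintro (j | b)
    · have ht := hth j
      refine ⟨?_, hn't _, ?_, ?_, ?_⟩
      · simp only [m', n', Sum.elim_inl]
        have := hnt j; have := hmn j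
        split_ifs <;> omega
      · intro i hi
        simp only [m', n', e', Sum.elim_inl] at hi ⊢
        have := hnt j; have := hmn j
        by_cases h1 : i = t + 1
        · rw [if_pos h1]
          by_cases h2 : n j = t
          · rw [if_pos h2]
            by_contra h3
            rw [if_pos ⟨h2, h3⟩] at hi
            omega
          · rw [if_neg h2]
        · rw [if_neg h1]
          refine ht.zero i fun h => hi ⟨h.1, ?_⟩
          split_ifs <;> omega
      · intro i hi him hin
        by_cases hit : i = t + 1
        · subst hit
          have hj := (hlive j).1 (le_antisymm (hn't _) hin)
          simp only [e', Sum.elim_inl, if_true, hj.1, add_sub_cancel_right]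
          rw [if_neg (by omega)]
          exact (heven hi).1 _ (hmemB j hj.1) hj.2
        · have hin' : i ≤ n j := by
            simp only [n', Sum.elim_inl] at hin
            split_ifs at hin <;> omega
          have := hnt j
          simp only [e', Sum.elim_inl]
          rw [if_neg hit, if_neg (by omega)]
          exact ht.left i hi him hin'
      · intro i hi him hin hit
        have hin' : i ≤ n j := by
          simp only [n', Sum.elim_inl] at hin
          split_ifs at hin <;> omega
        have := hnt j
        simp only [e', Sum.elim_inl]
        rw [if_neg (by omega)]
        by_cases hit' : i = t
        · subst hit'
          have hj : n j = i := by omega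
          rw [if_pos rfl, if_pos hj]
          exact hodd hi _ (hmemB j hj)
        · rw [if_neg (by omega)]
          exact ht.right i hi him hin' (by omega)
    · refine ⟨by simp [m', n'], hn't _, ?_, ?_, ?_⟩
      · intro i hi
        simp only [m', n', e', Sum.elim_inr] at hi ⊢
        rw [if_neg (by omega)]
      · intro i hi him hin
        simp only [m', n', e', Sum.elim_inr] at him hin ⊢
        obtain rfl : i = t + 1 := by omega
        rw [if_pos rfl, if_neg (by omega)]
        exact (heven hi).2 _ b.2.1 b.2.2
      · intro i hi him hin hit
        simp only [m', Sum.elim_inr] at him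
        omega
  · intro i hi
    by_cases hit : i = t + 1
    · subst hit
      have hset : {j | m' j ≤ t + 1 ∧ t + 1 ≤ n' j} = {j | n' j = t + 1} := by
        ext j
        exact ⟨fun h => le_antisymm (hn't j) h.2, fun h => ⟨hm't j h, h.ge⟩⟩
      rw [hset, linearIndepOn_iff_image hinj', himg]
      exact ⟨hB', hspan⟩
    · have hset : {j | m' j ≤ i ∧ i ≤ n' j} = Sum.inl '' {j | m j ≤ i ∧ i ≤ n j} := by
        ext j
        rcases j with j | b
        · have := hnt j
          have key : (m' (Sum.inl j) ≤ i ∧ i ≤ n' (Sum.inl j)) ↔ (m j ≤ i ∧ i ≤ n j) := by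
            simp only [m', n', Sum.elim_inl]
            split_ifs <;> omega
          exact key.trans ⟨fun h => ⟨j, h, rfl⟩, fun ⟨_, h, hj⟩ => Sum.inl.inj hj ▸ h⟩
        · refine ⟨fun h => ?_, fun ⟨_, _, h⟩ => by simp at h⟩
          have h : t + 1 ≤ i := h.1
          omega
      have hcomp : (fun j => e' j i) ∘ Sum.inl = fun j => e j i := by
        funext j
        simp [e', hit]
      have := hbas i (by omega)
      rw [hset, ← Set.image_comp, hcomp]
      exact ⟨LinearIndepOn.image_of_comp _ _ (hcomp ▸ this.1), this.2⟩

/-- There is a finite flag of `U t` such that every basis adapted to it is induced by a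
decomposition into threads. -/
def HasDecompositionFlag (U : ℤ → Submodule K M) (f g : M →ₗ[K] M) (t : ℤ) : Prop :=
  ∃ (N : ℕ) (F : ℕ → Submodule K M), Monotone F ∧ F N = U t ∧ (∀ l, F l ≤ U t) ∧
    ∀ B, IsAdaptedBasis F (U t) B → ThreadDecomposition U f g t B

theorem IsAdaptedBasis.of_forall_le {F : ℕ → Submodule K M} {U : Submodule K M} {B : Set M} {N : ℕ}
    (hN : F N = U) (hU : ∀ l, F l ≤ U) (hB : LinearIndepOn K id B) (hBU : B ⊆ U)
    (h : ∀ l ≤ N, F l ≤ Submodule.span K (B ∩ F l)) (hF : Monotone F) : IsAdaptedBasis F U B := by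
  have hs : U ≤ Submodule.span K B :=
    (hN ▸ h N le_rfl).trans (Submodule.span_mono Set.inter_subset_left)
  refine ⟨hB, le_antisymm (Submodule.span_le.2 hBU) hs, fun l => ?_⟩
  rcases le_total l N with hl | hl
  · exact h l hl
  · have : F l = U := le_antisymm (hU l) (hN ▸ hF hl)
    rw [this, Set.inter_eq_left.2 hBU]
    exact hs

/-- Lift `b` from the least step of the flag whose image contains it. One lift then serves for all
steps at once; the default 0 is never used as a lift. -/
theorem exists_lift_of_flag (f : M →ₗ[K] M) (F : ℕ → Submodule K M) (N : ℕ) (b : M) :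
    ∃ x, (b ∈ (F N).map f → f x = b) ∧ ∀ l ≤ N, Monotone F → b ∈ (F l).map f → x ∈ F l := by
  classical
  by_cases h : ∃ l, b ∈ (F l).map f
  · obtain ⟨x, hx, hxb⟩ := Nat.find_spec h
    exact ⟨x, fun _ => hxb, fun l _ hF hl => hF (Nat.find_min' h hl) hx⟩
  · exact ⟨0, fun h' => (h ⟨N, h'⟩).elim, fun l _ _ hl => (h ⟨l, hl⟩).elim⟩

/-- The flag is pushed forward along `f`, with all of `U (t + 1)` added on top since `f` need not be
surjective. From a basis `B'` adapted to it, minimal lifts of the part in the image, together with a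
basis of the kernel adapted to the traces of the flag, form a basis of `U t` adapted to the old
flag. -/
theorem HasDecompositionFlag.succ_of_odd {U : ℤ → Submodule K M} {f g : M →ₗ[K] M} {t : ℤ}
    (h : HasDecompositionFlag U f g t) (ht : Odd t) (hf : (U t).map f ≤ U (t + 1)) :
    HasDecompositionFlag U f g (t + 1) := by
  obtain ⟨N, F, hF, hN, hU, hdec⟩ := h
  let F' : ℕ → Submodule K M := fun l => if l ≤ N then (F l).map f else U (t + 1)
  have hF'U : ∀ l, F' l ≤ U (t + 1) := by
    intro l
    simp only [F']
    split_ifs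
    · exact (Submodule.map_mono (hU l)).trans hf
    · exact le_rfl
  refine ⟨N + 1, F', ?_, by simp [F'], hF'U, fun B' hB' => ?_⟩
  · intro l l' hl
    by_cases h' : l' ≤ N
    · simp only [F', if_pos h', if_pos (hl.trans h')]
      exact Submodule.map_mono (hF hl)
    · simp only [F', if_neg h']
      exact hF'U l
  choose x hx hxF using fun b => exists_lift_of_flag f F N b
  obtain ⟨BK, -, hBK, hBKi, hBKF⟩ := exists_basis_of_flag (F := fun l => F l ⊓ LinearMap.ker f)
    (fun l l' hl => inf_le_inf_right _ (hF hl)) (B₀ := ∅) (linearIndepOn_empty K id) (by simp) N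
  let B₁ : Set M := x '' (B' ∩ (F N).map f)
  have hfB₁ : ∀ b ∈ B₁, f b ∈ B' := by
    rintro _ ⟨b, hb, rfl⟩
    rw [hx b hb.2]
    exact hb.1
  have hinj : Set.InjOn f B₁ := by
    rintro _ ⟨b, hb, rfl⟩ _ ⟨c, hc, rfl⟩ hbc
    rw [hx b hb.2, hx c hc.2] at hbc
    rw [hbc]
  have hfi : LinearIndepOn K (f ∘ id) B₁ := by
    refine (linearIndepOn_iff_image (f := f) hinj).2 (hB'.indep.mono ?_)
    rintro _ ⟨b, hb, rfl⟩
    exact hfB₁ b hb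
  have hdisj : Disjoint (Submodule.span K BK) (Submodule.span K B₁) := by
    have h1 : Submodule.span K BK ≤ LinearMap.ker f := Submodule.span_le.2 fun y hy => (hBK hy).2
    have h2 := Submodule.range_ker_disjoint (f := f) (v := fun x : B₁ => (x : M)) hfi
    rw [Subtype.range_coe] at h2
    exact (h2.mono_right h1).symm
  have hind : LinearIndepOn K id (BK ∪ B₁) := hBKi.id_union (LinearIndepOn.of_comp f hfi) hdisj
  have hBU : BK ∪ B₁ ⊆ U t := by
    rintro b (hb | ⟨b, hb, rfl⟩)
    · exact hU N (hBK hb).1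
    · exact hU N (hxF b N le_rfl hF hb.2)
  -- For `u ∈ F l`, expand `f u` in `B' ∩ F' l`, lift the expansion inside `F l`, and correct the
  -- difference, which is in `F l ⊓ ker f`, by `BK`.
  have had : IsAdaptedBasis F (U t) (BK ∪ B₁) := by
    refine .of_forall_le hN hU hind hBU (fun l hl u hu => ?_) hF
    have hfu : f u ∈ Submodule.span K (B' ∩ F' l) := hB'.le_span l (by
      simp only [F', if_pos hl]
      exact Submodule.mem_map_of_mem hu)
    have hle : Submodule.span K (B' ∩ F' l) ≤
        (Submodule.span K ((BK ∪ B₁) ∩ F l)).map f := by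
      refine Submodule.span_le.2 fun b hb => ?_
      have hb2 : b ∈ (F l).map f := by simpa [F', hl] using hb.2
      have hb3 : b ∈ (F N).map f := Submodule.map_mono (hF hl) hb2
      exact ⟨x b, Submodule.subset_span ⟨Or.inr ⟨b, ⟨hb.1, hb3⟩, rfl⟩, hxF b l hl hF hb2⟩,
        hx b hb3⟩
    obtain ⟨y, hy, hyu⟩ := hle hfu
    have hyF : y ∈ F l := Submodule.span_le.2 Set.inter_subset_right hy
    have : u - y ∈ Submodule.span K (BK ∩ (F l ⊓ LinearMap.ker f : Submodule K M)) :=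
      hBKF l hl (Submodule.mem_inf.2 ⟨sub_mem hu hyF, by simp [hyu]⟩)
    have h3 : u - y ∈ Submodule.span K ((BK ∪ B₁) ∩ F l) :=
      Submodule.span_mono (Set.inter_subset_inter Set.subset_union_left fun z hz => hz.1) this
    simpa using add_mem h3 hy
  refine (hdec _ had).extend f hB'.indep hB'.span_eq ?_ ?_ (fun _ _ _ => rfl) ?_
  · rintro b (hb | hb)
    · exact Or.inl (hBK hb).2
    · exact Or.inr (hfB₁ b hb)
  · rintro b (hb | hb) c (hc | hc) h0 hbc
    · exact (h0 (hBK hb).2).elim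
    · exact (h0 (hBK hb).2).elim
    · exact (h0 (hbc.trans (hBK hc).2)).elim
    · exact hinj hb hc hbc
  · intro h'
    exact absurd ht (by simpa [parity_simps] using h')

open scoped Classical in
-- Dual to the previous case: the arrow comes back to `t`, so the flag is pulled back along `g`. The
-- nonzero images under `g` of an adapted basis are independent and adapted to the old flag, so they
-- extend to an adapted basis of `U t`; the threads through the added vectors end at `t`.
theorem HasDecompositionFlag.succ_of_even {U : ℤ → Submodule K M} {f g : M →ₗ[K] M} {t : ℤ}
    (h : HasDecompositionFlag U f g t) (ht : ¬Odd t) (hg : (U (t + 1)).map g ≤ U t) :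
    HasDecompositionFlag U f g (t + 1) := by
  obtain ⟨N, F, hF, hN, hU, hdec⟩ := h
  -- The index is shifted by one to make room for the kernel of `g` as the lowest step. An adapted
  -- basis then contains a basis of the kernel, which gives injectivity of `g` on the span of the
  -- remaining members.
  let F' : ℕ → Submodule K M := fun l => U (t + 1) ⊓ (if l = 0 then ⊥ else F (l - 1)).comap g
  refine ⟨N + 1, F', ?_, ?_, fun l => inf_le_left, fun B' hB' => ?_⟩
  · intro l l' hl
    refine inf_le_inf_left _ (Submodule.comap_mono ?_)
    split_ifs with h1 h2
    · exact le_rfl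
    · exact bot_le
    · omega
    · exact hF (by omega)
  · simpa [F', hN, ← Submodule.map_le_iff_le_comap] using hg
  let B₁ : Set M := {b ∈ B' | g b ≠ 0}
  have hB'U : B' ⊆ U (t + 1) := fun b hb => hB'.span_eq ▸ Submodule.subset_span hb
  have hB₁ : B₁ ⊆ B' := fun b hb => hb.1
  have hker : ∀ u ∈ Submodule.span K B₁, g u = 0 → u = 0 := by
    intro u hu h0
    have hu1 : u ∈ U (t + 1) := hB'.span_eq ▸ Submodule.span_mono hB₁ hu
    have hu2 : u ∈ Submodule.span K {b ∈ B' | g b = 0} := by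
      refine Submodule.span_mono ?_ (hB'.le_span 0 ⟨hu1, by simp [h0]⟩)
      rintro b ⟨hb, -, hb'⟩
      exact ⟨hb, by simpa using hb'⟩
    refine Submodule.disjoint_def.1 ((linearIndepOn_id_union_iff (s := B₁)
      (t := {b ∈ B' | g b = 0}) ?_).1 (hB'.indep.mono ?_)).2.2 u hu hu2
    · exact Set.disjoint_left.2 fun b hb hb' => hb.2 hb'.2
    · rintro b (hb | hb) <;> exact hb.1
  have hinjs : Set.InjOn g (Submodule.span K B₁) := by
    intro u hu u' hu' huu
    exact sub_eq_zero.1 (hker _ (sub_mem hu hu') (by simp [huu]))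
  have hinj : Set.InjOn g B₁ := hinjs.mono Submodule.subset_span
  have hgi : LinearIndepOn K id (g '' B₁) := by
    have := (hB'.indep.mono hB₁).map_injOn g (by simpa using hinjs)
    exact (linearIndepOn_iff_image hinj).1 this
  have hgF : ∀ l, Submodule.span K (g '' B₁) ⊓ F l ≤ Submodule.span K (g '' B₁ ∩ F l) := by
    rintro l y ⟨hy, hyl⟩
    rw [SetLike.mem_coe, Submodule.span_image] at hy
    obtain ⟨u, hu, rfl⟩ := hy
    have hu1 : u ∈ U (t + 1) := hB'.span_eq ▸ Submodule.span_mono hB₁ hu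
    have hu2 := hB'.le_span (l + 1) (show u ∈ F' (l + 1) from ⟨hu1, by simpa using hyl⟩)
    have := Submodule.mem_map_of_mem (f := g) hu2
    rw [← Submodule.span_image] at this
    refine (Submodule.span_le.2 ?_) this
    rintro _ ⟨b, ⟨hb, -, hb'⟩, rfl⟩
    by_cases h0 : g b = 0
    · rw [h0]
      exact zero_mem _
    · exact Submodule.subset_span ⟨⟨b, ⟨hb, h0⟩, rfl⟩, by simpa using hb'⟩
  obtain ⟨B, hB1, hB2, hB3, hB4⟩ := exists_basis_of_flag hF hgi hgF N
  have hgB : ∀ b ∈ B₁, g b ∈ B := fun b hb => hB1 ⟨⟨b, hb, rfl⟩, by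
    rw [hN]
    exact hg (Submodule.mem_map_of_mem (hB'U hb.1))⟩
  have had : IsAdaptedBasis F (U t) B := .of_forall_le hN hU hB3 (hN ▸ hB2) hB4 hF
  -- The inverse of `g` on the images of `B₁`; the value 0 marks the threads that end.
  let σ : M → M := fun b => if h : ∃ b' ∈ B₁, g b' = b then h.choose else 0
  have hσ : ∀ b, σ b ≠ 0 → σ b ∈ B₁ ∧ g (σ b) = b := by
    intro b h0
    by_cases h : ∃ b' ∈ B₁, g b' = b
    · simp only [σ, dif_pos h]
      exact h.choose_spec
    · exact (h0 (by simp only [σ, dif_neg h])).elim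
  refine (hdec _ had).extend σ hB'.indep hB'.span_eq ?_ ?_ (fun h => (ht h).elim) fun _ => ⟨?_, ?_⟩
  · intro b _
    by_cases h0 : σ b = 0
    · exact Or.inl h0
    · exact Or.inr (hσ b h0).1.1
  · intro b _ c _ h0 hbc
    rw [← (hσ b h0).2, hbc, (hσ c (hbc ▸ h0)).2]
  · intro b _ h0
    exact (hσ b h0).2
  · intro b hb hbσ
    by_contra h0
    have hb1 : b ∈ B₁ := ⟨hb, h0⟩
    refine hbσ ⟨g b, hgB b hb1, ?_⟩
    have h : ∃ b' ∈ B₁, g b' = g b := ⟨b, hb1, rfl⟩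
    simp only [σ, dif_pos h]
    exact hinj h.choose_spec.1 hb1 h.choose_spec.2

/-- Every representation of the zigzag quiver with bounded support is a direct sum of intervals. -/
theorem exists_threadDecomposition {U : ℤ → Submodule K M} {f g : M →ₗ[K] M}
    (hf : ∀ t, Odd t → (U t).map f ≤ U (t + 1)) (hg : ∀ t, Odd t → (U t).map g ≤ U (t - 1))
    {a b : ℤ} (ha : ∀ i ≤ a, U i = ⊥) (hb : ∀ i, b ≤ i → U i = ⊥) :
    ∃ (J : Type u) (m n : J → ℤ) (e : J → ℤ → M), (∀ j, m j ≤ n j) ∧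
      (∀ j i, ¬(m j ≤ i ∧ i ≤ n j) → e j i = 0) ∧
      (∀ j i, Odd i → m j ≤ i → i ≤ n j → g (e j i) = e j (i - 1) ∧ f (e j i) = e j (i + 1)) ∧
      ∀ i, LinearIndepOn K (fun j => e j i) {j | m j ≤ i ∧ i ≤ n j} ∧
        Submodule.span K ((fun j => e j i) '' {j | m j ≤ i ∧ i ≤ n j}) = U i := by
  have key : ∀ t, a ≤ t → HasDecompositionFlag U f g t := by
    intro t hat
    induction t, hat using Int.leInduction with
    | base =>
      refine ⟨0, fun _ => ⊥, monotone_const, (ha a le_rfl).symm, fun _ => bot_le, fun B hB => ?_⟩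
      have hB0 : B = ∅ := by
        refine Set.eq_empty_iff_forall_notMem.2 fun x hx => ?_
        have : x ∈ (⊥ : Submodule K M) := ha a le_rfl ▸ hB.span_eq ▸ Submodule.subset_span hx
        exact hB.indep.ne_zero hx this
      refine ⟨PEmpty, PEmpty.elim, PEmpty.elim, PEmpty.elim, fun j => j.elim, fun i hi => ?_, ?_⟩
      · rw [Set.eq_empty_of_isEmpty {j : PEmpty | _}, ha i hi]
        simp
      · rw [hB0, Set.eq_empty_of_isEmpty {j : PEmpty | _}]
        simp
    | succ t hat ih =>
      by_cases ht : Odd t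
      · exact ih.succ_of_odd ht (hf t ht)
      · refine ih.succ_of_even ht ?_
        simpa using hg (t + 1) (by simpa [parity_simps] using ht)
  -- At a vertex where `U` vanishes the empty basis is adapted to any flag, and every thread has
  -- already ended. So the condition on `f`, required only strictly before the last vertex, holds
  -- along each whole thread.
  obtain ⟨N, F, -, -, hU, hdec⟩ := key (max a b) (le_max_left _ _)
  have hb' : U (max a b) = ⊥ := hb _ (le_max_right _ _)
  obtain ⟨J, m, n, e, hth, hbas, hB⟩ := hdec ∅ ⟨linearIndepOn_empty K id, by simp [hb'],
    fun l => (hU l).trans (by simp [hb'])⟩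
  have hn : ∀ j, n j < max a b := by
    intro j
    refine lt_of_le_of_ne (hth j).le' fun h => ?_
    have : e j (max a b) ∈ (∅ : Set M) := hB ▸ ⟨j, h, rfl⟩
    exact this
  refine ⟨J, m, n, e, fun j => (hth j).le, fun j => (hth j).zero, fun j i hi h1 h2 =>
    ⟨(hth j).left i hi h1 h2, (hth j).right i hi h1 h2 (h2.trans_lt (hn j))⟩, fun i => ?_⟩
  rcases le_total i (max a b) with hi | hi
  · exact hbas i hi
  · have : {j | m j ≤ i ∧ i ≤ n j} = ∅ := by
      refine Set.eq_empty_iff_forall_notMem.2 fun j hj => ?_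
      have := hj.2
      have := hn j
      omega
    rw [this, hb i ((le_max_right _ _).trans hi)]
    simp

end ZigzagQuiver
end

noncomputable section

/-! ### Bigraded subspaces with two anticommuting differentials -/

section Bigraded

variable {K : Type v} [Field K] {M : Type u} [AddCommGroup M] [Module K M]

/-- A family of subspaces on which `D` and `E` are anticommuting differentials of bidegrees
`(1, 0)` and `(0, 1)`. -/
structure IsBigraded (D E : M →ₗ[K] M) (H : ℤ → ℤ → Submodule K M) : Prop where
  D_mem : ∀ {r s x}, x ∈ H r s → D x ∈ H (r + 1) s
  E_mem : ∀ {r s x}, x ∈ H r s → E x ∈ H r (s + 1)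
  DD : ∀ x, D (D x) = 0
  EE : ∀ x, E (E x) = 0
  ED : ∀ x, E (D x) = -D (E x)

/-- The subspaces `H r s` have compatible bases consisting of squares and zigzags. -/
def IsThreaded (D E : M →ₗ[K] M) (H : ℤ → ℤ → Submodule K M) : Prop :=
  ∃ (J : Type u) (S : J → Shape) (e : J → ℤ → ℤ → M),
    (∀ j r s, (r, s) ∉ (S j).support → e j r s = 0) ∧
    (∀ j r s, (r, s) ∈ (S j).support →
      D (e j r s) = e j (r + 1) s ∧ E (e j r s) = (S j).sign K r • e j r (s + 1)) ∧
    ∀ r s, LinearIndepOn K (fun j => e j r s) {j | (r, s) ∈ (S j).support} ∧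
      Submodule.span K ((fun j => e j r s) '' {j | (r, s) ∈ (S j).support}) = H r s

variable {D E : M →ₗ[K] M}

theorem IsThreaded.iSup {Λ : Type} {Y : Λ → ℤ → ℤ → Submodule K M}
    (h : ∀ l, IsThreaded D E (Y l)) (hind : ∀ r s, iSupIndep fun l => Y l r s) :
    IsThreaded D E fun r s => ⨆ l, Y l r s := by
  choose J S e h0 hde hbas using h
  refine ⟨Σ l, J l, fun j => S j.1 j.2, fun j => e j.1 j.2, fun j => h0 j.1 j.2,
    fun j => hde j.1 j.2, fun r s => ⟨?_, ?_⟩⟩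
  · have hspan : ∀ l, Submodule.span K (Set.range fun j : {j // (r, s) ∈ (S l j).support} =>
        e l j r s) = Y l r s := by
      intro l
      rw [← (hbas l r s).2, Set.image_eq_range]
      rfl
    have := linearIndependent_iUnion_finite (R := K)
      (f := fun l (j : {j // (r, s) ∈ (S l j).support}) => e l j r s)
      (fun l => (hbas l r s).1) (fun l t _ hlt => by
        simp only [hspan]
        exact (hind r s).disjoint_biSup hlt)
    exact this.comp (fun j : {j : Σ l, J l | (r, s) ∈ (S j.1 j.2).support} =>
      (⟨j.1.1, ⟨j.1.2, j.2⟩⟩ : Σ l, {j // (r, s) ∈ (S l j).support})) (by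
        rintro ⟨⟨l, j⟩, hj⟩ ⟨⟨l', j'⟩, hj'⟩ hjj
        simp only [Sigma.mk.injEq] at hjj
        obtain ⟨rfl, hjj⟩ := hjj
        simp only [heq_eq_eq, Subtype.mk.injEq] at hjj
        subst hjj
        rfl)
  · have : (fun j : Σ l, J l => e j.1 j.2 r s) '' {j | (r, s) ∈ (S j.1 j.2).support} =
        ⋃ l, (fun j => e l j r s) '' {j | (r, s) ∈ (S l j).support} := by
      ext x
      simp only [Set.mem_image, Set.mem_iUnion, Sigma.exists]
      rfl
    rw [this, Submodule.span_iUnion]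
    exact iSup_congr fun l => (hbas l r s).2

/-- The subspaces generated by a subspace `C` in bidegree `(p, q)`. -/
def squarePart (D E : M →ₗ[K] M) (C : Submodule K M) (p q r s : ℤ) : Submodule K M :=
  if r = p ∧ s = q then C
  else if r = p + 1 ∧ s = q then C.map D
  else if r = p ∧ s = q + 1 then C.map E
  else if r = p + 1 ∧ s = q + 1 then C.map (D ∘ₗ E)
  else ⊥

theorem mem_squarePart {C : Submodule K M} {p q r s : ℤ} {x : M}
    (hx : x ∈ squarePart D E C p q r s) :
    (r = p ∧ s = q ∧ x ∈ C) ∨ (r = p + 1 ∧ s = q ∧ ∃ c ∈ C, D c = x) ∨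
    (r = p ∧ s = q + 1 ∧ ∃ c ∈ C, E c = x) ∨
    (r = p + 1 ∧ s = q + 1 ∧ ∃ c ∈ C, D (E c) = x) ∨ x = 0 := by
  unfold squarePart at hx
  split_ifs at hx with h1 h2 h3 h4
  · exact Or.inl ⟨h1.1, h1.2, hx⟩
  · exact Or.inr (Or.inl ⟨h2.1, h2.2, hx⟩)
  · exact Or.inr (Or.inr (Or.inl ⟨h3.1, h3.2, hx⟩))
  · exact Or.inr (Or.inr (Or.inr (Or.inl ⟨h4.1, h4.2, hx⟩)))
  · exact Or.inr (Or.inr (Or.inr (Or.inr hx)))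

/-- Injectivity of `D ∘ E` on `C` forces that of `D` and of `E`, so a basis of `C` and its images
are bases of the four corners. The sign of the right vertical arrow is anticommutativity. -/
theorem isThreaded_squarePart {H : ℤ → ℤ → Submodule K M} (hH : IsBigraded D E H)
    {C : Submodule K M} (p q : ℤ) (hC : ∀ c ∈ C, D (E c) = 0 → c = 0) :
    IsThreaded D E (squarePart D E C p q) := by
  obtain ⟨B, -, hBs, hBi⟩ : ∃ B : Set M, B ⊆ C ∧ Submodule.span K B = C ∧ LinearIndepOn K id B := by
    obtain ⟨B, hB, -, hBs, hBi⟩ := exists_linearIndepOn_id_extension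
      (linearIndepOn_empty K (id : M → M)) (Set.empty_subset (C : Set M))
    exact ⟨B, hB, le_antisymm (Submodule.span_le.2 hB) hBs, hBi⟩
  let e : B → ℤ → ℤ → M := fun b r s =>
    if r = p ∧ s = q then b
    else if r = p + 1 ∧ s = q then D b
    else if r = p ∧ s = q + 1 then E b
    else if r = p + 1 ∧ s = q + 1 then D (E b)
    else 0
  have hsupp : ∀ r s, (r, s) ∈ (Shape.square p q).support ↔
      (r = p ∧ s = q) ∨ (r = p + 1 ∧ s = q) ∨ (r = p ∧ s = q + 1) ∨ (r = p + 1 ∧ s = q + 1) := by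
    intro r s
    simp only [Shape.support, Set.mem_ofPred_eq]
    omega
  have hmap : ∀ φ : M →ₗ[K] M, (∀ c ∈ C, φ c = 0 → c = 0) →
      LinearIndepOn K (fun b : B => φ b) Set.univ ∧
        Submodule.span K ((fun b : B => φ b) '' Set.univ) = C.map φ := by
    intro φ hφ
    constructor
    · rw [linearIndepOn_univ_iff]
      refine LinearIndependent.map_injOn (v := fun b : B => (b : M)) hBi φ ?_
      rw [Subtype.range_coe, hBs]
      intro x hx y hy hxy
      exact sub_eq_zero.1 (hφ _ (sub_mem hx hy) (by simp [hxy]))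
    · rw [Set.image_univ, ← hBs, Submodule.map_span, Set.image_eq_range]
  refine ⟨B, fun _ => .square p q, e, ?_, ?_, ?_⟩
  · intro b r s h
    rw [hsupp] at h
    simp only [e]
    rw [if_neg (by tauto), if_neg (by tauto), if_neg (by tauto), if_neg (by tauto)]
  · intro b r s h
    have h2 : ∀ a : ℤ, a + 1 + 1 ≠ a := fun a => by omega
    rw [hsupp] at h
    obtain ⟨rfl, rfl⟩ | ⟨rfl, rfl⟩ | ⟨rfl, rfl⟩ | ⟨rfl, rfl⟩ := h <;>
      simp [e, Shape.sign, hH.DD, hH.EE, hH.ED, h2]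
  · intro r s
    by_cases h : (r, s) ∈ (Shape.square p q).support
    · have hset : {j : B | (r, s) ∈ (Shape.square p q).support} = Set.univ := by
        ext
        exact ⟨fun _ => trivial, fun _ => h⟩
      rw [hset]
      rw [hsupp] at h
      obtain ⟨rfl, rfl⟩ | ⟨rfl, rfl⟩ | ⟨rfl, rfl⟩ | ⟨rfl, rfl⟩ := h
      · have := hmap LinearMap.id fun c _ h => h
        simpa [e, squarePart] using this
      · have := hmap D fun c hc h => hC c hc (by
          rw [← neg_eq_zero, ← hH.ED, h, map_zero])
        simpa [e, squarePart] using this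
      · have := hmap E fun c hc h => hC c hc (by rw [h, map_zero])
        simpa [e, squarePart] using this
      · have := hmap (D ∘ₗ E) fun c hc h => hC c hc h
        simpa [e, squarePart] using this
    · have hset : {j : B | (r, s) ∈ (Shape.square p q).support} = ∅ := by
        ext
        exact ⟨fun h' => h h', fun h' => h'.elim⟩
      rw [hset]
      rw [hsupp] at h
      simp only [squarePart]
      rw [if_neg (by tauto), if_neg (by tauto), if_neg (by tauto), if_neg (by tauto)]
      simp

/-- Extend a section of `τ` over its range to a map `ρ` on all of `M`; then `ρ ∘ τ ∘ ρ` satisfies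
the second identity too. The range of such an inverse is a complement of the kernel of `τ`,
described by equations instead of choices. -/
theorem exists_generalizedInverse {V : Type w} [AddCommGroup V] [Module K V] (τ : V →ₗ[K] M) :
    ∃ ρ : M →ₗ[K] V, (∀ x, τ (ρ (τ x)) = τ x) ∧ ∀ y, ρ (τ (ρ y)) = ρ y := by
  obtain ⟨σ, hσ⟩ := τ.rangeRestrict.exists_rightInverse_of_surjective
    (LinearMap.range_eq_top.2 τ.surjective_rangeRestrict)
  obtain ⟨ρ, hρ⟩ := LinearMap.exists_extend σ
  have key : ∀ x, τ (ρ (τ x)) = τ x := by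
    intro x
    have h1 : ρ (τ x) = σ (τ.rangeRestrict x) := LinearMap.congr_fun hρ (τ.rangeRestrict x)
    have h2 := LinearMap.congr_fun hσ (τ.rangeRestrict x)
    rw [h1]
    exact congrArg Subtype.val h2
  exact ⟨ρ ∘ₗ τ ∘ₗ ρ, fun x => by simp [key], fun y => by simp [key]⟩

/-- Apply to the relation a map `φ` that annihilates every term except the `i`-th and detects that
one. -/
theorem iSupIndep_aux {ι : Type*} {s : Finset ι} {v : ι → M} (hs : ∑ i ∈ s, v i = 0)
    (φ : M →ₗ[K] M) (i : ι) (h : ∀ j ∈ s, j ≠ i → φ (v j) = 0)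
    (h0 : φ (v i) = 0 → v i = 0) (hi : i ∈ s) : v i = 0 := by
  apply h0
  rw [← Finset.sum_eq_single_of_mem (f := fun j => φ (v j)) i hi h, ← map_sum, hs, map_zero]

/-- Every square can be split off. -/
theorem IsBigraded.isThreaded_of_complement {H : ℤ → ℤ → Submodule K M} (hH : IsBigraded D E H)
    (h : ∀ X : ℤ → ℤ → Submodule K M, IsBigraded D E X → (∀ r s, X r s ≤ H r s) →
      (∀ r s, ∀ x ∈ X r s, D (E x) = 0) → IsThreaded D E X) : IsThreaded D E H := by
  have hQ : ∀ r s, ∃ Q : M →ₗ[K] M, (∀ y, Q y ∈ H r s) ∧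
      (∀ x ∈ H r s, D (E (Q (D (E x)))) = D (E x)) ∧ ∀ y, Q (D (E (Q y))) = Q y := by
    intro r s
    obtain ⟨ρ, h1, h2⟩ := exists_generalizedInverse ((D ∘ₗ E) ∘ₗ (H r s).subtype)
    refine ⟨(H r s).subtype ∘ₗ ρ, fun y => (ρ y).2, fun x hx => h1 ⟨x, hx⟩, fun y => ?_⟩
    exact congrArg Subtype.val (h2 y)
  choose Q hQmem hTQT hQTQ using hQ
  have hED := hH.ED
  have hDD := hH.DD
  have hEE := hH.EE
  have hDE : ∀ x, D (E x) = -E (D x) := fun x => by rw [hED, neg_neg]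
  have hTD : ∀ x, D (E (D x)) = 0 := fun x => by rw [hED, map_neg, hDD, neg_zero]
  have hET : ∀ x, E (D (E x)) = 0 := fun x => by rw [hED, hEE, map_zero, neg_zero]
  -- The four kernels exclude the four positions in a square. `D ∘ E` detects lower left corners. `Q
  -- r (s - 1) ∘ D` detects upper left corners `E c`, because `D (E c) ≠ 0` for a nonzero corner
  -- `c`. `Q (r - 1) s ∘ E` detects lower right corners `D c`, because `E (D c) = -D (E c)`. `Q (r -
  -- 1) (s - 1)` detects upper right corners.
  let X : ℤ → ℤ → Submodule K M := fun r s =>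
    H r s ⊓ LinearMap.ker (D ∘ₗ E) ⊓ LinearMap.ker (Q r (s - 1) ∘ₗ D) ⊓
      LinearMap.ker (Q (r - 1) s ∘ₗ E) ⊓ LinearMap.ker (Q (r - 1) (s - 1))
  have hX : ∀ r s x, x ∈ X r s ↔ x ∈ H r s ∧ D (E x) = 0 ∧ Q r (s - 1) (D x) = 0 ∧
      Q (r - 1) s (E x) = 0 ∧ Q (r - 1) (s - 1) x = 0 := by
    intro r s x
    simp only [X, Submodule.mem_inf, LinearMap.mem_ker, LinearMap.comp_apply, and_assoc]
  have hXb : IsBigraded D E X := by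
    refine ⟨?_, ?_, hDD, hEE, hED⟩
    · intro r s x hx
      rw [hX] at hx ⊢
      obtain ⟨h1, h2, h3, h4, h5⟩ := hx
      exact ⟨hH.D_mem h1, hTD x, by simp [hDD], by simp [hED, h2], by simpa using h3⟩
    · intro r s x hx
      rw [hX] at hx ⊢
      obtain ⟨h1, h2, h3, h4, h5⟩ := hx
      exact ⟨hH.E_mem h1, by simp [hEE], by simp [h2], by simp [hEE], by simpa using h4⟩
  have hXt := h X hXb (fun r s x hx => ((hX r s x).1 hx).1) fun r s x hx => ((hX r s x).1 hx).2.1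
  have hQC : ∀ p q, ∀ c ∈ LinearMap.range (Q p q), Q p q (D (E c)) = c := by
    rintro p q _ ⟨y, rfl⟩
    exact hQTQ p q y
  let Y : Option (ℤ × ℤ) → ℤ → ℤ → Submodule K M := fun l =>
    l.elim X fun i => squarePart D E (LinearMap.range (Q i.1 i.2)) i.1 i.2
  have hYt : ∀ l, IsThreaded D E (Y l) := by
    rintro (_ | ⟨p, q⟩)
    · exact hXt
    · refine isThreaded_squarePart hH p q fun c hc h0 => ?_
      rw [← hQC p q c hc, h0, map_zero]
  have hind : ∀ r s, iSupIndep fun l => Y l r s := by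
    intro r s
    rw [iSupIndep_iff_finsetSum_eq_zero_imp_eq_zero]
    intro F v hv hsum
    have hcase : ∀ l ∈ F, (l = none ∧ v l ∈ X r s) ∨
        (l = some (r, s) ∧ v l ∈ LinearMap.range (Q r s)) ∨
        (l = some (r - 1, s) ∧ ∃ c ∈ LinearMap.range (Q (r - 1) s), D c = v l) ∨
        (l = some (r, s - 1) ∧ ∃ c ∈ LinearMap.range (Q r (s - 1)), E c = v l) ∨
        (l = some (r - 1, s - 1) ∧ ∃ c ∈ LinearMap.range (Q (r - 1) (s - 1)), D (E c) = v l) ∨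
        v l = 0 := by
      rintro (_ | ⟨p, q⟩) hl
      · exact Or.inl ⟨rfl, hv _ hl⟩
      · right
        rcases mem_squarePart (hv _ hl) with ⟨rfl, rfl, h⟩ | ⟨rfl, rfl, h⟩ | ⟨rfl, rfl, h⟩ |
          ⟨rfl, rfl, h⟩ | h
        · exact Or.inl ⟨rfl, h⟩
        · exact Or.inr (Or.inl ⟨by simp, by simpa using h⟩)
        · exact Or.inr (Or.inr (Or.inl ⟨by simp, by simpa using h⟩))
        · exact Or.inr (Or.inr (Or.inr (Or.inl ⟨by simp, by simpa using h⟩)))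
        · exact Or.inr (Or.inr (Or.inr (Or.inr h)))
    -- The terms of the relation are removed in the order lower left, lower right, upper left, upper
    -- right, `X`. At each stage the detecting map kills all terms that remain.
    have z1 : some (r, s) ∈ F → v (some (r, s)) = 0 := by
      refine fun hF => iSupIndep_aux hsum (Q r s ∘ₗ D ∘ₗ E) _ (fun l hl hne => ?_) (fun h0 => ?_) hF
      · rcases hcase l hl with ⟨rfl, h⟩ | ⟨rfl, h⟩ | ⟨rfl, c, hc, h⟩ | ⟨rfl, c, hc, h⟩ |
          ⟨rfl, c, hc, h⟩ | h
        · simp [((hX _ _ _).1 h).2.1]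
        · exact (hne rfl).elim
        · simp [← h, hTD]
        · simp [← h, hEE]
        · simp [← h, hET]
        · simp [h]
      · rcases hcase _ hF with ⟨h', h⟩ | ⟨-, h⟩ | ⟨h', -⟩ | ⟨h', -⟩ | ⟨h', -⟩ | h
        · exact absurd h' (by simp)
        · rw [← hQC r s _ h]
          exact h0
        · exact absurd h' (by simp; omega)
        · exact absurd h' (by simp; omega)
        · exact absurd h' (by simp; omega)
        · exact h
    have z2 : some (r - 1, s) ∈ F → v (some (r - 1, s)) = 0 := by
      refine fun hF => iSupIndep_aux hsum (Q (r - 1) s ∘ₗ E) _ (fun l hl hne => ?_)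
        (fun h0 => ?_) hF
      · rcases hcase l hl with ⟨rfl, h⟩ | ⟨rfl, h⟩ | ⟨rfl, c, hc, h⟩ | ⟨rfl, c, hc, h⟩ |
          ⟨rfl, c, hc, h⟩ | h
        · simp [((hX _ _ _).1 h).2.2.2.1]
        · simp [z1 hl]
        · exact (hne rfl).elim
        · simp [← h, hEE]
        · simp [← h, hET]
        · simp [h]
      · rcases hcase _ hF with ⟨h', h⟩ | ⟨h', h⟩ | ⟨-, c, hc, h⟩ | ⟨h', -⟩ | ⟨h', -⟩ | h
        · exact absurd h' (by simp)
        · exact absurd h' (by simp)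
        · rw [← h] at h0 ⊢
          have : c = 0 := by
            rw [← hQC _ _ c hc, hDE, map_neg, neg_eq_zero]
            exact h0
          rw [this, map_zero]
        · exact absurd h' (by simp)
        · exact absurd h' (by simp; omega)
        · exact h
    have z3 : some (r, s - 1) ∈ F → v (some (r, s - 1)) = 0 := by
      refine fun hF => iSupIndep_aux hsum (Q r (s - 1) ∘ₗ D) _ (fun l hl hne => ?_)
        (fun h0 => ?_) hF
      · rcases hcase l hl with ⟨rfl, h⟩ | ⟨rfl, h⟩ | ⟨rfl, c, hc, h⟩ | ⟨rfl, c, hc, h⟩ |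
          ⟨rfl, c, hc, h⟩ | h
        · simp [((hX _ _ _).1 h).2.2.1]
        · simp [z1 hl]
        · simp [z2 hl]
        · exact (hne rfl).elim
        · simp [← h, hDD]
        · simp [h]
      · rcases hcase _ hF with ⟨h', h⟩ | ⟨h', h⟩ | ⟨h', -⟩ | ⟨-, c, hc, h⟩ | ⟨h', -⟩ | h
        · exact absurd h' (by simp)
        · exact absurd h' (by simp)
        · exact absurd h' (by simp)
        · rw [← h] at h0 ⊢
          have : c = 0 := by
            rw [← hQC _ _ c hc]
            exact h0
          rw [this, map_zero]
        · exact absurd h' (by simp; omega)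
        · exact h
    have z4 : some (r - 1, s - 1) ∈ F → v (some (r - 1, s - 1)) = 0 := by
      refine fun hF => iSupIndep_aux hsum (Q (r - 1) (s - 1)) _ (fun l hl hne => ?_)
        (fun h0 => ?_) hF
      · rcases hcase l hl with ⟨rfl, h⟩ | ⟨rfl, h⟩ | ⟨rfl, h⟩ | ⟨rfl, h⟩ | ⟨rfl, h⟩ | h
        · simp [((hX _ _ _).1 h).2.2.2.2]
        · simp [z1 hl]
        · simp [z2 hl]
        · simp [z3 hl]
        · exact (hne rfl).elim
        · simp [h]
      · rcases hcase _ hF with ⟨h', h⟩ | ⟨h', h⟩ | ⟨h', -⟩ | ⟨h', -⟩ | ⟨-, c, hc, h⟩ | h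
        · exact absurd h' (by simp)
        · exact absurd h' (by simp)
        · exact absurd h' (by simp)
        · exact absurd h' (by simp)
        · rw [← h] at h0 ⊢
          have : c = 0 := by
            rw [← hQC _ _ c hc]
            exact h0
          rw [this, map_zero, map_zero]
        · exact h
    have z5 : none ∈ F → v none = 0 := by
      refine fun hF => iSupIndep_aux hsum (LinearMap.id : M →ₗ[K] M) _ (fun l hl hne => ?_) (fun h0 => h0) hF
      rcases hcase l hl with ⟨rfl, h⟩ | ⟨rfl, h⟩ | ⟨rfl, h⟩ | ⟨rfl, h⟩ | ⟨rfl, h⟩ | h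
      · exact (hne rfl).elim
      · exact z1 hl
      · exact z2 hl
      · exact z3 hl
      · exact z4 hl
      · exact h
    intro l hl
    rcases hcase l hl with ⟨rfl, h⟩ | ⟨rfl, h⟩ | ⟨rfl, h⟩ | ⟨rfl, h⟩ | ⟨rfl, h⟩ | h
    exacts [z5 hl, z1 hl, z2 hl, z3 hl, z4 hl, h]
  have hsup : (fun r s => ⨆ l, Y l r s) = H := by
    funext r s
    have hmem : ∀ l x, x ∈ Y l r s → x ∈ ⨆ l, Y l r s := fun l x hx =>
      Submodule.mem_iSup_of_mem l hx
    apply le_antisymm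
    · refine iSup_le ?_
      rintro (_ | ⟨p, q⟩) x hx
      · exact ((hX r s x).1 hx).1
      · have hr : ∀ c ∈ LinearMap.range (Q p q), c ∈ H p q := by
          rintro _ ⟨y, rfl⟩
          exact hQmem p q y
        rcases mem_squarePart hx with ⟨rfl, rfl, h⟩ | ⟨rfl, rfl, c, hc, rfl⟩ |
          ⟨rfl, rfl, c, hc, rfl⟩ | ⟨rfl, rfl, c, hc, rfl⟩ | rfl
        · exact hr x h
        · exact hH.D_mem (hr c hc)
        · exact hH.E_mem (hr c hc)
        · exact hH.D_mem (hH.E_mem (hr c hc))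
        · exact zero_mem _
    · intro x hx
      have hD : ∀ y, D (Q (r - 1) s y) ∈ H r s := fun y => by
        simpa using hH.D_mem (hQmem (r - 1) s y)
      have hE : ∀ y, E (Q r (s - 1) y) ∈ H r s := fun y => by
        simpa using hH.E_mem (hQmem r (s - 1) y)
      have hT : ∀ y, D (E (Q (r - 1) (s - 1) y)) ∈ H r s := fun y => by
        simpa using hH.D_mem (hH.E_mem (hQmem (r - 1) (s - 1) y))
      -- Subtract the four square components in the same order; no correction disturbs the equations
      -- already obtained. The plus sign in `x₂` comes from `E (D y) = -D (E y)`.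
      set x₁ := x - Q r s (D (E x)) with hx₁
      have t1 : D (E x₁) = 0 := by simp [hx₁, hTQT r s x hx]
      set x₂ := x₁ + D (Q (r - 1) s (E x₁)) with hx₂
      have t2 : D (E x₂) = 0 := by simp [hx₂, t1, hTD]
      have u2 : Q (r - 1) s (E x₂) = 0 := by simp [hx₂, hED, hQTQ]
      set x₃ := x₂ - E (Q r (s - 1) (D x₂)) with hx₃
      have t3 : D (E x₃) = 0 := by simp [hx₃, t2, hEE]
      have u3 : Q (r - 1) s (E x₃) = 0 := by simp [hx₃, hEE, u2]
      have w3 : Q r (s - 1) (D x₃) = 0 := by simp [hx₃, hQTQ]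
      set x₄ := x₃ - D (E (Q (r - 1) (s - 1) x₃)) with hx₄
      have hx4 : x₄ ∈ X r s := by
        rw [hX]
        refine ⟨?_, by simp [hx₄, hET, t3], by simp [hx₄, hDD, w3], by simp [hx₄, hET, u3],
          by simp [hx₄, hQTQ]⟩
        exact sub_mem (sub_mem (add_mem (sub_mem hx (hQmem r s _)) (hD _)) (hE _)) (hT _)
      have hxe : x = Q r s (D (E x)) - D (Q (r - 1) s (E x₁)) + E (Q r (s - 1) (D x₂)) +
          D (E (Q (r - 1) (s - 1) x₃)) + x₄ := by
        rw [hx₄, hx₃, hx₂, hx₁]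
        abel
      rw [hxe]
      refine add_mem (add_mem (add_mem (sub_mem ?_ ?_) ?_) ?_) (hmem none _ hx4)
      · exact hmem (some (r, s)) _ (by simp [Y, squarePart])
      · refine hmem (some (r - 1, s)) _ ?_
        simp only [Y, Option.elim, squarePart, sub_add_cancel]
        rw [if_neg (by omega), if_pos (by simp)]
        exact ⟨_, ⟨_, rfl⟩, rfl⟩
      · refine hmem (some (r, s - 1)) _ ?_
        simp only [Y, Option.elim, squarePart, sub_add_cancel]
        rw [if_neg (by omega), if_neg (by omega), if_pos (by simp)]
        exact ⟨_, ⟨_, rfl⟩, rfl⟩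
      · refine hmem (some (r - 1, s - 1)) _ ?_
        simp only [Y, Option.elim, squarePart, sub_add_cancel]
        rw [if_neg (by omega), if_neg (by omega), if_neg (by omega), if_pos (by simp)]
        exact ⟨_, ⟨_, rfl⟩, rfl⟩
  rw [← hsup]
  exact IsThreaded.iSup hYt hind

end Bigraded
end

/-! ### Zigzags as paths, and complexes with ∂∂̄ = 0 -/

noncomputable section

namespace Shape

/-- The bidegrees of the vertices `m, …, n` of the infinite zigzag in degrees `k` and `k + 1`. -/
def pathSupport (k m n : ℤ) : Set (ℤ × ℤ) :=
  {i | (i.1 + i.2 = k ∧ m ≤ 2 * i.1 + 1 ∧ 2 * i.1 + 1 ≤ n) ∨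
    (i.1 + i.2 = k + 1 ∧ m ≤ 2 * i.1 ∧ 2 * i.1 ≤ n)}

/-- The shape of the path `m, …, n` in the infinite zigzag in degrees `k` and `k + 1`. -/
def ofPath (k m n : ℤ) : Shape :=
  -- Vertex `2 r + 1` is the bidegree `(r, k - r)` and vertex `2 r` is `(r, k + 1 - r)`. Ends of
  -- equal parity give an odd zigzag, whose total degree is the degree of the ends. An odd left and
  -- an even right end give a horizontal zigzag, the opposite a vertical one.
  if m % 2 = 1 then
    if n % 2 = 1 then .odd (m / 2) (k - n / 2) k
    else .evenH (m / 2) (k - m / 2) (n / 2 - m / 2 - 1).toNat.succPNat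
  else
    if n % 2 = 1 then .evenV (n / 2) (k - n / 2) (n / 2 - m / 2).toNat.succPNat
    else .odd (n / 2) (k + 1 - m / 2) (k + 1)

theorem isZigzag_ofPath (k m n : ℤ) : (ofPath k m n).IsZigzag := by
  unfold ofPath
  split_ifs <;> trivial

theorem support_ofPath {k m n : ℤ} (h : m ≤ n) : (ofPath k m n).support = pathSupport k m n := by
  ext ⟨r, s⟩
  unfold ofPath pathSupport
  split_ifs with h1 h2 h2
  · simp only [support, Set.mem_ofPred_eq]
    omega
  · simp only [support, Set.mem_ofPred_eq, Prod.mk.injEq, Nat.succPNat_coe, Nat.succ_eq_add_one]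
    constructor
    · rintro ⟨j, hj, h⟩
      omega
    · rintro (h | h)
      · exact ⟨(r - m / 2).toNat, by omega⟩
      · exact ⟨(r - m / 2 - 1).toNat, by omega⟩
  · simp only [support, Set.mem_ofPred_eq, Prod.mk.injEq, Nat.succPNat_coe, Nat.succ_eq_add_one]
    constructor
    · rintro ⟨j, hj, h⟩
      omega
    · rintro (h | h) <;> exact ⟨(n / 2 - r).toNat, by omega⟩
  · simp only [support, Set.mem_ofPred_eq]
    omega

theorem sign_eq_one (K : Type v) [Field K] {S : Shape} (hS : S.IsZigzag) (r : ℤ) :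
    S.sign K r = 1 := by
  cases S with
  | square => exact hS.elim
  | _ => rfl

end Shape

section Bigraded

variable {K : Type v} [Field K] {M : Type u} [AddCommGroup M] [Module K M] {D E : M →ₗ[K] M}

/-- Interleave the two rows, with `V r` at vertex `2 r + 1` and `W r` at vertex `2 r`. Then `D` goes
one vertex to the right and `E` one vertex to the left, and the interval decomposition applies. -/
theorem IsThreaded.of_quiver {k : ℤ} {V W : ℤ → Submodule K M}
    (hVD : ∀ r, ∀ x ∈ V r, D x ∈ W (r + 1)) (hVE : ∀ r, ∀ x ∈ V r, E x ∈ W r)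
    (hWD : ∀ r, ∀ x ∈ W r, D x = 0) (hWE : ∀ r, ∀ x ∈ W r, E x = 0)
    {a b : ℤ} (ha : ∀ r ≤ a, V r = ⊥ ∧ W r = ⊥) (hb : ∀ r, b ≤ r → V r = ⊥ ∧ W r = ⊥) :
    IsThreaded D E fun r s => if r + s = k then V r else if r + s = k + 1 then W r else ⊥ := by
  let U : ℤ → Submodule K M := fun i => if i % 2 = 1 then V (i / 2) else W (i / 2)
  obtain ⟨J, m, n, ε, hmn, hε, hde, hbas⟩ := exists_threadDecomposition (U := U) (f := D) (g := E)
    (fun t ht => by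
      rw [Int.odd_iff] at ht
      simp only [U, Submodule.map_le_iff_le_comap]
      rw [if_pos ht, if_neg (by omega), show (t + 1) / 2 = t / 2 + 1 by omega]
      exact hVD _)
    (fun t ht => by
      rw [Int.odd_iff] at ht
      simp only [U, Submodule.map_le_iff_le_comap]
      rw [if_pos ht, if_neg (by omega), show (t - 1) / 2 = t / 2 by omega]
      exact hVE _) (a := 2 * a) (b := 2 * b)
    (fun i hi => by
      have := ha (i / 2) (by omega)
      simp only [U]
      split_ifs
      exacts [this.1, this.2])
    (fun i hi => by
      have := hb (i / 2) (by omega)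
      simp only [U]
      split_ifs
      exacts [this.1, this.2])
  have hU : ∀ j i, ε j i ∈ U i := by
    intro j i
    by_cases h : m j ≤ i ∧ i ≤ n j
    · rw [← (hbas i).2]
      exact Submodule.subset_span ⟨j, h, rfl⟩
    · rw [hε j i h]
      exact zero_mem _
  have hUV : ∀ r, U (2 * r + 1) = V r := fun r => by
    simp only [U]
    rw [if_pos (by omega)]
    congr 1
    omega
  have hUW : ∀ r, U (2 * r) = W r := fun r => by
    simp only [U]
    rw [if_neg (by omega)]
    congr 1
    omega
  let e : J → ℤ → ℤ → M := fun j r s =>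
    if r + s = k then ε j (2 * r + 1) else if r + s = k + 1 then ε j (2 * r) else 0
  have hsupp : ∀ j, (Shape.ofPath k (m j) (n j)).support = Shape.pathSupport k (m j) (n j) :=
    fun j => Shape.support_ofPath (hmn j)
  refine ⟨J, fun j => Shape.ofPath k (m j) (n j), e, ?_, ?_, ?_⟩
  · intro j r s h
    simp only [hsupp, Shape.pathSupport, Set.mem_ofPred_eq] at h
    simp only [e]
    split_ifs
    · exact hε _ _ (by omega)
    · exact hε _ _ (by omega)
    · rfl
  · intro j r s h
    simp only [hsupp, Shape.pathSupport, Set.mem_ofPred_eq] at h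
    rw [Shape.sign_eq_one K (Shape.isZigzag_ofPath _ _ _), one_smul]
    simp only [e]
    rcases h with ⟨h, h1, h2⟩ | ⟨h, h1, h2⟩
    · have := hde j (2 * r + 1) (by simp [parity_simps]) h1 h2
      rw [if_pos h, if_neg (by omega), if_pos (by omega), if_neg (by omega), if_pos (by omega)]
      rw [this.1, this.2]
      constructor <;> congr 1 <;> omega
    · rw [if_neg (by omega), if_pos h, if_neg (by omega), if_neg (by omega), if_neg (by omega),
        if_neg (by omega)]
      have := hU j (2 * r)
      rw [hUW] at this
      exact ⟨hWD _ _ this, hWE _ _ this⟩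
  · intro r s
    simp only [e]
    by_cases h : r + s = k
    · have hset : {j | (r, s) ∈ (Shape.ofPath k (m j) (n j)).support} =
          {j | m j ≤ 2 * r + 1 ∧ 2 * r + 1 ≤ n j} := by
        ext j
        simp only [hsupp, Shape.pathSupport, Set.mem_ofPred_eq]
        omega
      simp only [if_pos h]
      rw [hset, ← hUV]
      exact hbas _
    · by_cases h' : r + s = k + 1
      · have hset : {j | (r, s) ∈ (Shape.ofPath k (m j) (n j)).support} =
            {j | m j ≤ 2 * r ∧ 2 * r ≤ n j} := by
          ext j
          simp only [hsupp, Shape.pathSupport, Set.mem_ofPred_eq]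
          omega
        simp only [if_neg h, if_pos h']
        rw [hset, ← hUW]
        exact hbas _
      · have hset : {j | (r, s) ∈ (Shape.ofPath k (m j) (n j)).support} = ∅ := by
          refine Set.eq_empty_iff_forall_notMem.2 fun j hj => ?_
          simp only [hsupp, Shape.pathSupport, Set.mem_ofPred_eq] at hj
          omega
        simp only [if_neg h, if_neg h']
        rw [hset]
        simp

/-- Since ∂∂̄ = 0, the sum `I` of the two images is killed by both differentials. After choosing
complements `C` of `I`, all arrows go from `C` in total degree k to `I` in total degree k + 1. So
`X` is the direct sum over k of two-row pieces `Y k`, each of them a representation of the zigzag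
quiver. -/
theorem IsBigraded.isThreaded_of_del_delbar_eq_zero {X : ℤ → ℤ → Submodule K M}
    (hX : IsBigraded D E X) (hT : ∀ r s, ∀ x ∈ X r s, D (E x) = 0) {N : ℤ}
    (hN : ∀ r s, N ≤ |r| → X r s = ⊥) : IsThreaded D E X := by
  let I : ℤ → ℤ → Submodule K M := fun r s => (X (r - 1) s).map D ⊔ (X r (s - 1)).map E
  have hIX : ∀ r s, I r s ≤ X r s := by
    intro r s
    refine sup_le ?_ ?_
    · rintro _ ⟨x, hx, rfl⟩
      simpa using hX.D_mem hx
    · rintro _ ⟨x, hx, rfl⟩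
      simpa using hX.E_mem hx
  have hC : ∀ r s, ∃ C, Disjoint (I r s) C ∧ I r s ⊔ C = X r s := fun r s =>
    IsModularLattice.exists_disjoint_and_sup_eq (hIX r s)
  choose C hdisj hsup using hC
  have hCX : ∀ r s, C r s ≤ X r s := fun r s => hsup r s ▸ le_sup_right
  have hID : ∀ r s, ∀ x ∈ I r s, D x = 0 := by
    intro r s x hx
    obtain ⟨_, ⟨y, hy, rfl⟩, _, ⟨z, hz, rfl⟩, rfl⟩ := Submodule.mem_sup.1 hx
    rw [map_add, hX.DD, hT _ _ z hz, add_zero]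
  have hIE : ∀ r s, ∀ x ∈ I r s, E x = 0 := by
    intro r s x hx
    obtain ⟨_, ⟨y, hy, rfl⟩, _, ⟨z, hz, rfl⟩, rfl⟩ := Submodule.mem_sup.1 hx
    rw [map_add, hX.EE, hX.ED, hT _ _ y hy, neg_zero, add_zero]
  let Y : ℤ → ℤ → ℤ → Submodule K M := fun k r s =>
    if r + s = k then C r (k - r) else if r + s = k + 1 then I r (k + 1 - r) else ⊥
  have hbd : ∀ k r, N ≤ |r| → C r (k - r) = ⊥ ∧ I r (k + 1 - r) = ⊥ := fun k r hr =>
    ⟨le_bot_iff.1 ((hCX _ _).trans (hN _ _ hr).le), le_bot_iff.1 ((hIX _ _).trans (hN _ _ hr).le)⟩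
  have hY : ∀ k, IsThreaded D E (Y k) := by
    intro k
    refine IsThreaded.of_quiver (V := fun r => C r (k - r)) (W := fun r => I r (k + 1 - r))
      (a := -|N|) (b := |N|) ?_ ?_ (fun r => hID _ _) (fun r => hIE _ _) ?_ ?_
    · intro r x hx
      refine Submodule.mem_sup_left ⟨x, ?_, rfl⟩
      have := hCX _ _ hx
      rwa [show r + 1 - 1 = r by ring, show k + 1 - (r + 1) = k - r by ring]
    · intro r x hx
      refine Submodule.mem_sup_right ⟨x, ?_, rfl⟩
      have := hCX _ _ hx
      rwa [show k + 1 - r - 1 = k - r by ring]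
    · intro r hr
      refine hbd k r ?_
      have := neg_le_abs r
      have := le_abs_self N
      omega
    · intro r hr
      exact hbd k r ((le_abs_self N).trans (hr.trans (le_abs_self r)))
  have hY1 : ∀ r s, Y (r + s) r s = C r s := fun r s => by simp [Y]
  have hY2 : ∀ r s, Y (r + s - 1) r s = I r s := fun r s => by
    simp only [Y]
    rw [if_neg (by omega), if_pos (by omega), show r + s - 1 + 1 - r = s by ring]
  have hY3 : ∀ k r s, k ≠ r + s → k ≠ r + s - 1 → Y k r s = ⊥ := fun k r s h h' => by
    simp only [Y]
    rw [if_neg (by omega), if_neg (by omega)]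
  have hYsup : (fun r s => ⨆ k, Y k r s) = X := by
    funext r s
    rw [← hsup r s]
    apply le_antisymm
    · refine iSup_le fun k => ?_
      by_cases h : k = r + s
      · rw [h, hY1]
        exact le_sup_right
      by_cases h' : k = r + s - 1
      · rw [h', hY2]
        exact le_sup_left
      rw [hY3 k r s h h']
      exact bot_le
    · rw [← hY1, ← hY2]
      exact sup_le (le_iSup (fun k => Y k r s) _) (le_iSup (fun k => Y k r s) _)
  rw [← hYsup]
  refine IsThreaded.iSup hY fun r s k => ?_
  change Disjoint (Y k r s) (⨆ l, ⨆ (_ : l ≠ k), Y l r s)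
  by_cases h : k = r + s
  · rw [h, hY1]
    refine (hdisj r s).symm.mono_right (iSup₂_le fun l hl => ?_)
    by_cases h' : l = r + s - 1
    · rw [h', hY2]
    · rw [hY3 l r s hl h']
      exact bot_le
  by_cases h' : k = r + s - 1
  · rw [h', hY2]
    refine (hdisj r s).mono_right (iSup₂_le fun l hl => ?_)
    by_cases h' : l = r + s
    · rw [h', hY1]
    · rw [hY3 l r s h' hl]
      exact bot_le
  rw [hY3 k r s h h']
  exact disjoint_bot_left

end Bigraded

namespace DoubleComplex

variable {K : Type v} [Field K] (A : DoubleComplex.{u} K)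

/-- The projection of the total space to a component. -/
abbrev coord (i : ℤ × ℤ) : A.Total →ₗ[K] A.X i.1 i.2 :=
  DirectSum.component K (ℤ × ℤ) (fun i => A.X i.1 i.2) i

theorem delTot_apply (x : A.Total) (r s : ℤ) :
    A.delTot x (r + 1, s) = A.del r s (x (r, s)) := by
  have h : A.coord (r + 1, s) ∘ₗ A.delTot = A.del r s ∘ₗ A.coord (r, s) := by
    refine DirectSum.linearMap_ext K fun i => LinearMap.ext fun x => ?_
    obtain ⟨p, q⟩ := i
    simp only [LinearMap.comp_apply, delTot, DirectSum.toModule_lof]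
    by_cases h : (p, q) = (r, s)
    · obtain ⟨rfl, rfl⟩ := Prod.mk.inj h
      rw [coord, coord, DirectSum.component.lof_self, DirectSum.component.lof_self]
    · have h' : (p + 1, q) ≠ (r + 1, s) := by simpa using h
      rw [coord, coord, DirectSum.component.of, DirectSum.component.of, dif_neg h',
        dif_neg h, map_zero]
  exact LinearMap.congr_fun h x

theorem delbarTot_apply (x : A.Total) (r s : ℤ) :
    A.delbarTot x (r, s + 1) = A.delbar r s (x (r, s)) := by
  have h : A.coord (r, s + 1) ∘ₗ A.delbarTot = A.delbar r s ∘ₗ A.coord (r, s) := by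
    refine DirectSum.linearMap_ext K fun i => LinearMap.ext fun x => ?_
    obtain ⟨p, q⟩ := i
    simp only [LinearMap.comp_apply, delbarTot, DirectSum.toModule_lof]
    by_cases h : (p, q) = (r, s)
    · obtain ⟨rfl, rfl⟩ := Prod.mk.inj h
      rw [coord, coord, DirectSum.component.lof_self, DirectSum.component.lof_self]
    · have h' : (p, q + 1) ≠ (r, s + 1) := by simpa using h
      rw [coord, coord, DirectSum.component.of, DirectSum.component.of, dif_neg h',
        dif_neg h, map_zero]
  exact LinearMap.congr_fun h x

variable {A} in
theorem Total.ext {x y : A.Total} (h : ∀ r s, x (r, s) = y (r, s)) : x = y :=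
  DFinsupp.ext fun i => h i.1 i.2

theorem delTot_delTot (x : A.Total) : A.delTot (A.delTot x) = 0 := by
  refine Total.ext fun r s => ?_
  obtain ⟨r, rfl⟩ : ∃ r', r = r' + 1 + 1 := ⟨r - 2, by ring⟩
  rw [delTot_apply, delTot_apply, A.del_del, DirectSum.zero_apply]

theorem delbarTot_delbarTot (x : A.Total) : A.delbarTot (A.delbarTot x) = 0 := by
  refine Total.ext fun r s => ?_
  obtain ⟨s, rfl⟩ : ∃ r', s = r' + 1 + 1 := ⟨s - 2, by ring⟩
  rw [delbarTot_apply, delbarTot_apply, A.delbar_delbar, DirectSum.zero_apply]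

theorem delbarTot_delTot (x : A.Total) : A.delbarTot (A.delTot x) = -A.delTot (A.delbarTot x) := by
  refine Total.ext fun r s => ?_
  obtain ⟨r, rfl⟩ : ∃ r', r = r' + 1 := ⟨r - 1, by ring⟩
  obtain ⟨s, rfl⟩ : ∃ r', s = r' + 1 := ⟨s - 1, by ring⟩
  rw [delbarTot_apply, delTot_apply]
  change _ = -(A.delTot (A.delbarTot x) (r + 1, s + 1))
  rw [delTot_apply, delbarTot_apply, eq_neg_iff_add_eq_zero]
  exact (add_comm _ _).trans (A.del_delbar_add _ _ _)

/-- The components of `A` as subspaces of the total space. -/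
abbrev homogeneous (r s : ℤ) : Submodule K A.Total := A.supportedOn {(r, s)}

theorem mem_homogeneous {x : A.Total} {r s : ℤ} :
    x ∈ A.homogeneous r s ↔ ∀ r' s', (r', s') ≠ (r, s) → x (r', s') = 0 :=
  ⟨fun h r' s' h' => h (r', s') h', fun h i hi => h i.1 i.2 hi⟩

theorem isBigraded : IsBigraded A.delTot A.delbarTot A.homogeneous := by
  refine ⟨?_, ?_, A.delTot_delTot, A.delbarTot_delbarTot, A.delbarTot_delTot⟩
  · intro r s x hx
    rw [mem_homogeneous] at hx ⊢
    intro r' s' h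
    obtain ⟨r', rfl⟩ : ∃ r, r' = r + 1 := ⟨r' - 1, by ring⟩
    rw [delTot_apply, hx r' s' (by simpa using h), map_zero]
  · intro r s x hx
    rw [mem_homogeneous] at hx ⊢
    intro r' s' h
    obtain ⟨s', rfl⟩ : ∃ r, s' = r + 1 := ⟨s' - 1, by ring⟩
    rw [delbarTot_apply, hx r' s' (by simpa using h), map_zero]

theorem isThreaded (hA : A.IsBounded) : IsThreaded A.delTot A.delbarTot A.homogeneous := by
  obtain ⟨N, hN⟩ := hA
  refine A.isBigraded.isThreaded_of_complement fun X hX hXH hT =>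
    hX.isThreaded_of_del_delbar_eq_zero hT (N := N + 1) fun r s hr => ?_
  rw [eq_bot_iff]
  refine (hXH r s).trans fun x hx => ?_
  have := hN r s (by linarith [abs_nonneg s])
  refine Total.ext fun r' s' => ?_
  by_cases h : (r', s') = (r, s)
  · obtain ⟨rfl, rfl⟩ := Prod.mk.inj h
    exact Subsingleton.elim _ _
  · exact A.mem_homogeneous.1 hx _ _ h

end DoubleComplex
end

/-! ### From compatible bases to a decomposition -/

noncomputable section

namespace DoubleComplex

variable {K : Type v} [Field K]

/-- The inverse of an isomorphism. -/
def Iso.symm {A : DoubleComplex.{u} K} {B : DoubleComplex.{w} K} (φ : Iso A B) : Iso B A where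
  equiv p q := (φ.equiv p q).symm
  comm_del p q x := by
    rw [LinearEquiv.symm_apply_eq, φ.comm_del, LinearEquiv.apply_symm_apply]
  comm_delbar p q x := by
    rw [LinearEquiv.symm_apply_eq, φ.comm_delbar, LinearEquiv.apply_symm_apply]

/-- The composition of two isomorphisms. -/
def Iso.trans {A : DoubleComplex.{u} K} {B : DoubleComplex.{w} K} {C : DoubleComplex.{w'} K}
    (φ : Iso A B) (ψ : Iso B C) : Iso A C where
  equiv p q := (φ.equiv p q).trans (ψ.equiv p q)
  comm_del p q x := by
    simp only [LinearEquiv.trans_apply, φ.comm_del, ψ.comm_del]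
  comm_delbar p q x := by
    simp only [LinearEquiv.trans_apply, φ.comm_delbar, ψ.comm_delbar]

/-- The vectors of the threads define a map from the direct sum of the models to `A`. It commutes
with the differentials by the relations along each thread, and it is bijective since the vectors
form a basis in each bidegree. -/
theorem nonempty_decomposition_of_isThreaded {A : DoubleComplex.{u} K}
    (hA : IsThreaded A.delTot A.delbarTot A.homogeneous) : Nonempty A.Decomposition := by
  classical
  obtain ⟨J, S, e, h0, hde, hbas⟩ := hA
  let v : ∀ r s, J → A.X r s := fun r s j => e j r s (r, s)
  have hv0 : ∀ r s j, (r, s) ∉ (S j).support → v r s j = 0 := by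
    intro r s j h
    simp only [v, h0 j r s h]
    rfl
  let ev : ∀ r s, A.Total →ₗ[K] A.X r s := fun r s =>
    DirectSum.component K (ℤ × ℤ) (fun i => A.X i.1 i.2) (r, s)
  have hev : ∀ r s x, ev r s x = x (r, s) := fun _ _ _ => rfl
  have hvi : ∀ r s, LinearIndepOn K (v r s) {j | (r, s) ∈ (S j).support} := by
    intro r s
    refine (hbas r s).1.map_injOn (ev r s) ?_
    rw [(hbas r s).2]
    intro x hx y hy hxy
    refine Total.ext fun r' s' => ?_
    by_cases h : (r', s') = (r, s)
    · obtain ⟨rfl, rfl⟩ := Prod.mk.inj h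
      exact hxy
    · rw [A.mem_homogeneous.1 hx _ _ h, A.mem_homogeneous.1 hy _ _ h]
  have hvs : ∀ r s, Submodule.span K (v r s '' {j | (r, s) ∈ (S j).support}) = ⊤ := by
    intro r s
    have := congrArg (Submodule.map (ev r s)) (hbas r s).2
    rw [Submodule.map_span, ← Set.image_comp] at this
    refine this.trans (eq_top_iff.2 fun x _ => ?_)
    refine ⟨DirectSum.lof K _ _ (r, s) x, A.mem_homogeneous.2 fun r' s' h => ?_, ?_⟩
    · exact DirectSum.of_eq_of_ne _ _ _ h
    · exact DirectSum.component.lof_self K _ _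
  let Φ : ∀ r s, (⨁ j, (S j).component K r s) →ₗ[K] A.X r s := fun r s =>
    DirectSum.toModule K J _ fun j =>
      (LinearMap.toSpanSingleton K _ (v r s j)) ∘ₗ ((S j).component K r s).subtype
  have hΦ : ∀ r s j (x : (S j).component K r s),
      Φ r s (DirectSum.lof K J (fun j => (S j).component K r s) j x) = (x : K) • v r s j := by
    intro r s j x
    simp only [Φ, DirectSum.toModule_lof]
    rfl
  have hbij : ∀ r s, Function.Bijective (Φ r s) := by
    intro r s
    constructor
    · rw [injective_iff_map_eq_zero]
      intro x hx
      have hsum : ∑ j ∈ DFinsupp.support x, ((x j : K)) • v r s j = 0 := by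
        rw [← hx]
        conv_rhs => rw [← DirectSum.sum_support_of x, map_sum]
        exact Finset.sum_congr rfl fun j _ => (hΦ r s j (x j)).symm
      have hsupp : ∀ j ∈ DFinsupp.support x, (r, s) ∈ (S j).support := by
        intro j hj
        by_contra h
        exact DFinsupp.mem_support_iff.1 hj (Subtype.ext (Shape.component_eq_zero h _))
      have := linearIndepOn_iff'.1 (hvi r s) _ _ hsupp hsum
      refine DFinsupp.ext fun j => ?_
      by_contra h
      exact h (Subtype.ext (this j (DFinsupp.mem_support_iff.2 h)))
    · rw [← LinearMap.range_eq_top, eq_top_iff, ← hvs r s, Submodule.span_le]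
      rintro _ ⟨j, hj, rfl⟩
      exact ⟨DirectSum.lof K J (fun j => (S j).component K r s) j ⟨1, fun h => (h hj).elim⟩, by
        rw [hΦ, one_smul]⟩
  refine ⟨⟨J, S, Iso.symm ⟨fun r s => LinearEquiv.ofBijective (Φ r s) (hbij r s), ?_, ?_⟩⟩⟩
  · intro r s x
    change Φ (r + 1) s (DirectSum.lmap (fun j => (S j).arrow K 1 r s (r + 1) s) x) =
      A.del r s (Φ r s x)
    suffices h : Φ (r + 1) s ∘ₗ DirectSum.lmap (fun j => (S j).arrow K 1 r s (r + 1) s) =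
      A.del r s ∘ₗ Φ r s from LinearMap.congr_fun h x
    refine DirectSum.linearMap_ext K fun j => LinearMap.ext fun y => ?_
    simp only [LinearMap.comp_apply, DirectSum.lmap_lof, hΦ, map_smul]
    by_cases h : (r, s) ∈ (S j).support
    · have h1 : A.del r s (v r s j) = v (r + 1) s j := by
        simp only [v]
        rw [← delTot_apply, (hde j r s h).1]
      rw [h1]
      by_cases h2 : (r + 1, s) ∈ (S j).support
      · simp [Shape.arrow, h2]
      · rw [hv0 _ _ _ h2, smul_zero, smul_zero]
    · rw [hv0 _ _ _ h, map_zero, smul_zero]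
      simp [Shape.arrow, Shape.component_eq_zero h]
  · intro r s x
    change Φ r (s + 1) (DirectSum.lmap (fun j => (S j).arrow K ((S j).sign K r) r s r (s + 1)) x) =
      A.delbar r s (Φ r s x)
    suffices h : Φ r (s + 1) ∘ₗ DirectSum.lmap (fun j => (S j).arrow K ((S j).sign K r) r s r (s + 1))
      = A.delbar r s ∘ₗ Φ r s from LinearMap.congr_fun h x
    refine DirectSum.linearMap_ext K fun j => LinearMap.ext fun y => ?_
    simp only [LinearMap.comp_apply, DirectSum.lmap_lof, hΦ, map_smul]
    by_cases h : (r, s) ∈ (S j).support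
    · have h1 : A.delbar r s (v r s j) = (S j).sign K r • v r (s + 1) j := by
        simp only [v]
        rw [← delbarTot_apply, (hde j r s h).2]
        rfl
      rw [h1]
      by_cases h2 : (r, s + 1) ∈ (S j).support
      · simp [Shape.arrow, h2, smul_smul, mul_comm]
      · rw [hv0 _ _ _ h2, smul_zero, smul_zero, smul_zero]
    · rw [hv0 _ _ _ h, map_zero, smul_zero]
      simp [Shape.arrow, Shape.component_eq_zero h]

theorem IsBounded.nonempty_decomposition {A : DoubleComplex.{u} K} (hA : A.IsBounded) :
    Nonempty A.Decomposition :=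
  nonempty_decomposition_of_isThreaded (A.isThreaded hA)

end DoubleComplex
end

/-! ### Subquotients, morphisms and direct sums -/

noncomputable section

section Subquotient

variable {K : Type v} [Field K] {M : Type u} [AddCommGroup M] [Module K M]

/-- A subquotient that is compatible with a direct sum decomposition. -/
theorem subquotient_equiv_pi {ι : Type w'} {N : ι → Type w} [∀ i, AddCommGroup (N i)]
    [∀ i, Module K (N i)] (inc : ∀ i, N i →ₗ[K] M) (pr : ∀ i, M →ₗ[K] N i)
    (hself : ∀ i y, pr i (inc i y) = y) (hne : ∀ i j y, i ≠ j → pr j (inc i y) = 0)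
    (hsum : ∀ x, ∃ F : Finset ι, x = ∑ i ∈ F, inc i (pr i x))
    {Z B : Submodule K M} {Z' B' : ∀ i, Submodule K (N i)}
    (hZi : ∀ i, ∀ y ∈ Z' i, inc i y ∈ Z) (hZp : ∀ i, ∀ x ∈ Z, pr i x ∈ Z' i)
    (hBi : ∀ i, ∀ y ∈ B' i, inc i y ∈ B) (hBp : ∀ i, ∀ x ∈ B, pr i x ∈ B' i)
    (s : Finset ι) (hs : ∀ i, i ∉ s → Z' i ≤ B' i) :
    Nonempty ((Z ⧸ B.submoduleOf Z) ≃ₗ[K] ∀ i : s, Z' i ⧸ (B' i).submoduleOf (Z' i)) := by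
  classical
  let ψ : Z →ₗ[K] ∀ i : s, Z' i ⧸ (B' i).submoduleOf (Z' i) := LinearMap.pi fun i =>
    ((B' i).submoduleOf (Z' i)).mkQ ∘ₗ (pr i).restrict (hZp i)
  have hψ : ∀ x i, ψ x i = Submodule.Quotient.mk ⟨pr i x, hZp i x x.2⟩ := fun x i => rfl
  have hker : LinearMap.ker ψ = B.submoduleOf Z := by
    ext x
    rw [LinearMap.mem_ker]
    change _ ↔ (x : M) ∈ B
    constructor
    · intro h
      have hall : ∀ i, pr i x ∈ B' i := by
        intro i
        by_cases hi : i ∈ s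
        · have := congrFun h ⟨i, hi⟩
          rw [hψ, Pi.zero_apply, Submodule.Quotient.mk_eq_zero] at this
          exact this
        -- Summands outside `s` have zero subquotient; this is why infinitely many squares do no
        -- harm.
        · exact hs i hi (hZp i x x.2)
      obtain ⟨F, hF⟩ := hsum x
      rw [hF]
      exact Submodule.sum_mem _ fun i _ => hBi i _ (hall i)
    · intro h
      funext i
      rw [hψ, Pi.zero_apply, Submodule.Quotient.mk_eq_zero]
      exact hBp i x h
  have hsurj : Function.Surjective ψ := by
    intro y
    choose z hz using fun i : s => Submodule.Quotient.mk_surjective _ (y i)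
    refine ⟨⟨∑ i : s, inc i (z i), Submodule.sum_mem _ fun i _ => hZi i _ (z i).2⟩, ?_⟩
    funext i
    rw [hψ, ← hz i]
    congr 1
    refine Subtype.ext ?_
    change pr i (∑ i : s, inc i (z i)) = z i
    rw [map_sum, Finset.sum_eq_single i (fun j _ hji => hne j i _ fun h => hji (Subtype.ext h))
      (fun h => (h (Finset.mem_univ i)).elim), hself]
  exact ⟨(Submodule.quotEquivOfEq _ _ hker.symm).trans (ψ.quotKerEquivOfSurjective hsurj)⟩

theorem subquotient_eq_zero {Z B : Submodule K M} (h : Z ≤ B) :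
    FiniteDimensional K (Z ⧸ B.submoduleOf Z) ∧ Module.finrank K (Z ⧸ B.submoduleOf Z) = 0 := by
  have : Subsingleton (Z ⧸ B.submoduleOf Z) := by
    rw [Submodule.Quotient.subsingleton_iff, eq_top_iff]
    exact fun x _ => h x.2
  exact ⟨inferInstance, Module.finrank_zero_of_subsingleton⟩

theorem subquotient_eq_one {Z B : Submodule K M} {z : M} (hz : z ∈ Z) (hzB : z ∉ B)
    (h : ∀ x ∈ Z, ∃ c : K, x - c • z ∈ B) :
    FiniteDimensional K (Z ⧸ B.submoduleOf Z) ∧ Module.finrank K (Z ⧸ B.submoduleOf Z) = 1 := by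
  have : Module.finrank K (Z ⧸ B.submoduleOf Z) = 1 := by
    refine finrank_eq_one (Submodule.Quotient.mk ⟨z, hz⟩) ?_ ?_
    · rw [Ne, Submodule.Quotient.mk_eq_zero]
      exact hzB
    · intro y
      obtain ⟨x, rfl⟩ := Submodule.Quotient.mk_surjective _ y
      obtain ⟨c, hc⟩ := h x x.2
      refine ⟨c, ?_⟩
      rw [← Submodule.Quotient.mk_smul, eq_comm, Submodule.Quotient.eq]
      exact hc
  exact ⟨FiniteDimensional.of_finrank_pos (by omega), this⟩

end Subquotient

namespace DoubleComplex

variable {K : Type v} [Field K]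

/-- A morphism of double complexes. -/
structure Hom (A : DoubleComplex.{u} K) (B : DoubleComplex.{w} K) where
  map : ∀ p q, A.X p q →ₗ[K] B.X p q
  comm_del : ∀ p q x, map (p + 1) q (A.del p q x) = B.del p q (map p q x)
  comm_delbar : ∀ p q x, map p (q + 1) (A.delbar p q x) = B.delbar p q (map p q x)

namespace Hom

variable {A : DoubleComplex.{u} K} {B : DoubleComplex.{w} K} (φ : Hom A B)

/-- The map of total spaces induced by a morphism. -/
def tot : A.Total →ₗ[K] B.Total :=
  DirectSum.lmap fun i => φ.map i.1 i.2

theorem tot_apply (x : A.Total) (i : ℤ × ℤ) : φ.tot x i = φ.map i.1 i.2 (x i) := rfl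

theorem tot_delTot (x : A.Total) : φ.tot (A.delTot x) = B.delTot (φ.tot x) := by
  refine Total.ext fun r s => ?_
  obtain ⟨r, rfl⟩ : ∃ r', r = r' + 1 := ⟨r - 1, by ring⟩
  rw [tot_apply, delTot_apply, delTot_apply, tot_apply, φ.comm_del]

theorem tot_delbarTot (x : A.Total) : φ.tot (A.delbarTot x) = B.delbarTot (φ.tot x) := by
  refine Total.ext fun r s => ?_
  obtain ⟨s, rfl⟩ : ∃ s', s = s' + 1 := ⟨s - 1, by ring⟩
  rw [tot_apply, delbarTot_apply, delbarTot_apply, tot_apply, φ.comm_delbar]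

theorem tot_dTot (x : A.Total) : φ.tot (A.dTot x) = B.dTot (φ.tot x) := by
  simp only [dTot, LinearMap.add_apply, map_add, tot_delTot, tot_delbarTot]

theorem tot_mem_supportedOn {S : Set (ℤ × ℤ)} {x : A.Total} (hx : x ∈ A.supportedOn S) :
    φ.tot x ∈ B.supportedOn S := by
  intro i hi
  rw [tot_apply, hx i hi, map_zero]

end Hom

open scoped Classical in
theorem projOn_apply (A : DoubleComplex.{u} K) (S : Set (ℤ × ℤ)) (x : A.Total) (i : ℤ × ℤ) :
    A.projOn S x i = if i ∈ S then x i else 0 := by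
  change (if i ∈ S then LinearMap.id else 0 : A.X i.1 i.2 →ₗ[K] A.X i.1 i.2) (x i) = _
  split_ifs <;> rfl

namespace Hom

variable {A : DoubleComplex.{u} K} {B : DoubleComplex.{w} K} (φ : Hom A B)

theorem tot_projOn (S : Set (ℤ × ℤ)) (x : A.Total) : φ.tot (A.projOn S x) = B.projOn S (φ.tot x) := by
  classical
  refine Total.ext fun r s => ?_
  rw [tot_apply, projOn_apply, projOn_apply, tot_apply]
  split_ifs
  · rfl
  · rw [map_zero]

theorem tot_bigolinD (p q k : ℤ) (x : A.Total) :
    φ.tot (A.bigolinD p q k x) = B.bigolinD p q k (φ.tot x) := by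
  unfold bigolinD
  split_ifs
  · simp only [LinearMap.comp_apply, tot_projOn, tot_dTot]
  · simp only [LinearMap.comp_apply, tot_delTot, tot_delbarTot]
  · exact φ.tot_dTot x

theorem tot_mem_bigolinCocycles {p q k : ℤ} {x : A.Total} (hx : x ∈ A.bigolinCocycles p q k) :
    φ.tot x ∈ B.bigolinCocycles p q k := by
  refine ⟨φ.tot_mem_supportedOn hx.1, ?_⟩
  have h : A.bigolinD p q k x = 0 := hx.2
  change B.bigolinD p q k _ = 0
  rw [← tot_bigolinD, h, map_zero]

theorem tot_mem_bigolinCoboundaries {p q k : ℤ} {x : A.Total}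
    (hx : x ∈ A.bigolinCoboundaries p q k) : φ.tot x ∈ B.bigolinCoboundaries p q k := by
  obtain ⟨y, hy, rfl⟩ := hx
  exact ⟨φ.tot y, φ.tot_mem_supportedOn hy, (φ.tot_bigolinD _ _ _ _).symm⟩

theorem tot_mem_filteredCycles {wt : ℤ × ℤ → ℤ} {r l k : ℤ} {x : A.Total}
    (hx : x ∈ A.filteredCycles wt r l k) : φ.tot x ∈ B.filteredCycles wt r l k := by
  refine ⟨φ.tot_mem_supportedOn hx.1, ?_⟩
  rw [SetLike.mem_coe, Submodule.mem_comap, ← tot_dTot]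
  exact φ.tot_mem_supportedOn hx.2

end Hom

variable (A : DoubleComplex.{u} K)

/-- The subspace by which the cycles of the page `E_r` are divided. -/
def filteredBoundaries (wt : ℤ × ℤ → ℤ) (r l k : ℤ) : Submodule K A.Total :=
  A.filteredCycles wt (r - 1) (l + 1) k ⊔
    (A.filteredCycles wt (r - 1) (l - r + 1) (k - 1)).map A.dTot

variable {A}

theorem Hom.tot_mem_filteredBoundaries {B : DoubleComplex.{w} K} (φ : Hom A B) {wt : ℤ × ℤ → ℤ}
    {r l k : ℤ} {x : A.Total} (hx : x ∈ A.filteredBoundaries wt r l k) :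
    φ.tot x ∈ B.filteredBoundaries wt r l k := by
  obtain ⟨y, hy, _, ⟨z, hz, rfl⟩, rfl⟩ := Submodule.mem_sup.1 hx
  rw [map_add, tot_dTot]
  exact add_mem (Submodule.mem_sup_left (φ.tot_mem_filteredCycles hy))
    (Submodule.mem_sup_right ⟨_, φ.tot_mem_filteredCycles hz, rfl⟩)

namespace Decomposition

variable (D : Decomposition A)

open scoped Classical in
/-- The inclusion of a summand. -/
def inc (i : D.ι) : Hom ((D.shape i).model K) A where
  map p q := (D.iso.equiv p q).symm.toLinearMap ∘ₗ
    DirectSum.lof K D.ι (fun i => ((D.shape i).model K).X p q) i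
  comm_del p q x := by
    have := D.iso.symm.comm_del p q (DirectSum.lof K D.ι (fun i => ((D.shape i).model K).X p q) i x)
    refine Eq.trans ?_ this
    exact congrArg (D.iso.equiv (p + 1) q).symm
      (DirectSum.lmap_lof (fun i => ((D.shape i).model K).del p q) i x).symm
  comm_delbar p q x := by
    have := D.iso.symm.comm_delbar p q
      (DirectSum.lof K D.ι (fun i => ((D.shape i).model K).X p q) i x)
    refine Eq.trans ?_ this
    exact congrArg (D.iso.equiv p (q + 1)).symm
      (DirectSum.lmap_lof (fun i => ((D.shape i).model K).delbar p q) i x).symm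

/-- The projection to a summand. -/
def pr (i : D.ι) : Hom A ((D.shape i).model K) where
  map p q := DirectSum.component K D.ι (fun i => ((D.shape i).model K).X p q) i ∘ₗ
    (D.iso.equiv p q).toLinearMap
  comm_del p q x :=
    congrArg (DirectSum.component K D.ι (fun i => ((D.shape i).model K).X (p + 1) q) i)
      (D.iso.comm_del p q x)
  comm_delbar p q x :=
    congrArg (DirectSum.component K D.ι (fun i => ((D.shape i).model K).X p (q + 1)) i)
      (D.iso.comm_delbar p q x)

/-- The image of an element under the isomorphism with the direct sum. -/
def toSum (p q : ℤ) (x : A.X p q) : ⨁ i, ((D.shape i).model K).X p q := D.iso.equiv p q x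

theorem pr_map_apply (i : D.ι) (p q : ℤ) (x : A.X p q) : (D.pr i).map p q x = D.toSum p q x i := rfl

open scoped Classical in
theorem toSum_inc (i : D.ι) (p q : ℤ) (x : ((D.shape i).model K).X p q) :
    D.toSum p q ((D.inc i).map p q x) =
      DirectSum.of (fun i => ((D.shape i).model K).X p q) i x :=
  (D.iso.equiv p q).apply_symm_apply _

theorem pr_inc_self (i : D.ι) (y : ((D.shape i).model K).Total) :
    (D.pr i).tot ((D.inc i).tot y) = y := by
  classical
  refine Total.ext fun r s => ?_
  rw [Hom.tot_apply, Hom.tot_apply, pr_map_apply, toSum_inc, DirectSum.of_eq_same]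

theorem pr_inc_of_ne {i j : D.ι} (h : i ≠ j) (y : ((D.shape i).model K).Total) :
    (D.pr j).tot ((D.inc i).tot y) = 0 := by
  classical
  refine Total.ext fun r s => ?_
  rw [Hom.tot_apply, Hom.tot_apply, pr_map_apply, toSum_inc, DirectSum.of_eq_of_ne _ _ _ h.symm]
  rfl

theorem exists_eq_sum (x : A.Total) :
    ∃ F : Finset D.ι, x = ∑ i ∈ F, (D.inc i).tot ((D.pr i).tot x) := by
  classical
  refine ⟨(DFinsupp.support x).biUnion fun i => DFinsupp.support (D.toSum i.1 i.2 (x i)), ?_⟩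
  refine Total.ext fun r s => ?_
  set F := (DFinsupp.support x).biUnion fun i => DFinsupp.support (D.toSum i.1 i.2 (x i))
  change A.coord (r, s) x = A.coord (r, s) (∑ i ∈ F, (D.inc i).tot ((D.pr i).tot x))
  rw [map_sum]
  change x (r, s) = ∑ i ∈ F, (D.inc i).map r s ((D.pr i).map r s (x (r, s)))
  apply (D.iso.equiv r s).injective
  rw [map_sum]
  change D.toSum r s _ = ∑ i ∈ F, D.toSum r s _
  simp only [toSum_inc, pr_map_apply]
  by_cases hx : x (r, s) = 0
  · have : D.toSum r s (x (r, s)) = 0 := by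
      rw [hx]
      exact map_zero (D.iso.equiv r s)
    rw [this]
    simp
  · conv_lhs => rw [← DirectSum.sum_support_of (D.toSum r s (x (r, s)))]
    refine Finset.sum_subset (fun i hi => ?_) fun i _ hi => ?_
    · exact Finset.mem_biUnion.2 ⟨(r, s), DFinsupp.mem_support_iff.2 hx, hi⟩
    · rw [DFinsupp.notMem_support_iff.1 hi, map_zero]

theorem bigolinCohomology_equiv (p q k : ℤ) (s : Finset D.ι)
    (hs : ∀ i, i ∉ s → ((D.shape i).model K).bigolinCocycles p q k ≤
      ((D.shape i).model K).bigolinCoboundaries p q k) :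
    Nonempty (A.BigolinCohomology p q k ≃ₗ[K]
      ∀ i : s, ((D.shape i).model K).BigolinCohomology p q k) :=
  subquotient_equiv_pi (fun i => (D.inc i).tot) (fun i => (D.pr i).tot) D.pr_inc_self
    (fun _ _ y h => D.pr_inc_of_ne h y) D.exists_eq_sum
    (fun i _ => (D.inc i).tot_mem_bigolinCocycles) (fun i _ => (D.pr i).tot_mem_bigolinCocycles)
    (fun i _ => (D.inc i).tot_mem_bigolinCoboundaries)
    (fun i _ => (D.pr i).tot_mem_bigolinCoboundaries) s hs

theorem filteredPage_equiv (wt : ℤ × ℤ → ℤ) (r l k : ℤ) (s : Finset D.ι)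
    (hs : ∀ i, i ∉ s → ((D.shape i).model K).filteredCycles wt r l k ≤
      ((D.shape i).model K).filteredBoundaries wt r l k) :
    Nonempty (A.filteredPage wt r l k ≃ₗ[K]
      ∀ i : s, ((D.shape i).model K).filteredPage wt r l k) :=
  subquotient_equiv_pi (fun i => (D.inc i).tot) (fun i => (D.pr i).tot) D.pr_inc_self
    (fun _ _ y h => D.pr_inc_of_ne h y) D.exists_eq_sum
    (fun i _ => (D.inc i).tot_mem_filteredCycles) (fun i _ => (D.pr i).tot_mem_filteredCycles)
    (fun i _ => (D.inc i).tot_mem_filteredBoundaries)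
    (fun i _ => (D.pr i).tot_mem_filteredBoundaries) s hs

end Decomposition

end DoubleComplex
end

/-! ### Squares contribute nothing -/

noncomputable section

namespace Shape

open DoubleComplex

variable {K : Type v} [Field K] {S : Shape}

/-- The scalar coordinates of an element of the total space of the model of a shape. -/
def val : (S.model K).Total →ₗ[K] (ℤ → ℤ → K) where
  toFun x r s := (x (r, s)).1
  map_add' _ _ := rfl
  map_smul' _ _ := rfl

theorem val_injective : Function.Injective (val : (S.model K).Total →ₗ[K] (ℤ → ℤ → K)) :=
  fun _ _ h => Total.ext fun r s => Subtype.ext (congrFun (congrFun h r) s)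

theorem val_ext {x y : (S.model K).Total} (h : ∀ r s, val x r s = val y r s) : x = y :=
  val_injective (funext fun r => funext fun s => h r s)

theorem val_eq_zero (x : (S.model K).Total) {r s : ℤ} (h : (r, s) ∉ S.support) : val x r s = 0 :=
  component_eq_zero h _

open scoped Classical in
theorem val_delTot (x : (S.model K).Total) (r s : ℤ) :
    val ((S.model K).delTot x) r s = if (r, s) ∈ S.support then val x (r - 1) s else 0 := by
  obtain ⟨r, rfl⟩ : ∃ r', r = r' + 1 := ⟨r - 1, by ring⟩
  refine (congrArg Subtype.val ((S.model K).delTot_apply x r s)).trans ?_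
  rw [add_sub_cancel_right]
  change (if (r + 1, s) ∈ S.support then 1 * val x r s else 0) = _
  rw [one_mul]

open scoped Classical in
theorem val_delbarTot (x : (S.model K).Total) (r s : ℤ) :
    val ((S.model K).delbarTot x) r s =
      if (r, s) ∈ S.support then S.sign K r * val x r (s - 1) else 0 := by
  obtain ⟨s, rfl⟩ : ∃ r', s = r' + 1 := ⟨s - 1, by ring⟩
  refine (congrArg Subtype.val ((S.model K).delbarTot_apply x r s)).trans ?_
  rw [add_sub_cancel_right]
  rfl

open scoped Classical in
theorem val_dTot (x : (S.model K).Total) (r s : ℤ) :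
    val ((S.model K).dTot x) r s =
      if (r, s) ∈ S.support then val x (r - 1) s + S.sign K r * val x r (s - 1) else 0 := by
  rw [dTot, LinearMap.add_apply, map_add, Pi.add_apply, Pi.add_apply, val_delTot, val_delbarTot]
  split_ifs
  · rfl
  · rw [add_zero]

open scoped Classical in
theorem val_projOn (T : Set (ℤ × ℤ)) (x : (S.model K).Total) (r s : ℤ) :
    val ((S.model K).projOn T x) r s = if (r, s) ∈ T then val x r s else 0 := by
  refine (congrArg Subtype.val ((S.model K).projOn_apply T x (r, s))).trans ?_
  split_ifs <;> rfl

theorem mem_supportedOn_iff {T : Set (ℤ × ℤ)} {x : (S.model K).Total} :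
    x ∈ (S.model K).supportedOn T ↔ ∀ r s, val x r s ≠ 0 → (r, s) ∈ T := by
  constructor
  · intro h r s h0
    by_contra hT
    exact h0 (congrArg Subtype.val (h (r, s) hT))
  · intro h i hi
    refine Subtype.ext ?_
    by_contra h0
    exact hi (h i.1 i.2 h0)

theorem exists_val_eq (hS : S.support.Finite) (f : ℤ → ℤ → K)
    (hf : ∀ r s, (r, s) ∉ S.support → f r s = 0) : ∃ x : (S.model K).Total, val x = f := by
  classical
  let y : ∀ i : (hS.toFinset : Set (ℤ × ℤ)), (S.model K).X i.1.1 i.1.2 :=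
    fun i => ⟨f i.1.1 i.1.2, fun h => hf _ _ h⟩
  refine ⟨DFinsupp.mk (β := fun i : ℤ × ℤ => (S.model K).X i.1 i.2) hS.toFinset y, ?_⟩
  funext r s
  have := DFinsupp.mk_apply (β := fun i : ℤ × ℤ => (S.model K).X i.1 i.2) (s := hS.toFinset)
    (x := y) (i := (r, s))
  refine (congrArg Subtype.val this).trans ?_
  split_ifs with h
  · rfl
  · exact (hf r s (by simpa using h)).symm

theorem mem_support_square {a b r s : ℤ} : (r, s) ∈ (square a b).support ↔
    (r = a ∨ r = a + 1) ∧ (s = b ∨ s = b + 1) := Iff.rfl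

theorem finite_support_square (a b : ℤ) : (square a b).support.Finite := by
  refine (Set.Finite.prod (Set.finite_Icc a (a + 1)) (Set.finite_Icc b (b + 1))).subset ?_
  rintro ⟨r, s⟩ h
  rw [mem_support_square] at h
  simp only [Set.mem_prod, Set.mem_Icc]
  omega

open scoped Classical in
-- The homotopy inverts the vertical arrows, whose scalars ±1 are their own inverses; the sign makes
-- it anticommute with the horizontal ones. It preserves the first degree, hence the filtration by
-- columns.
theorem exists_vertical_homotopy (a b : ℤ) :
    ∃ h : ((square a b).model K).Total → ((square a b).model K).Total,
      (∀ x, ((square a b).model K).dTot (h x) + h (((square a b).model K).dTot x) = x) ∧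
      ∀ x r s, val (h x) r s =
        if (r, s) ∈ (square a b).support then (square a b).sign K r * val x r (s + 1) else 0 := by
  choose h hh using fun x : ((square a b).model K).Total => exists_val_eq (K := K)
    (finite_support_square a b) (fun r s => if (r, s) ∈ (square a b).support then
      (square a b).sign K r * val x r (s + 1) else 0) (fun r s hrs => if_neg hrs)
  have hval : ∀ x r s, val (h x) r s =
      if (r, s) ∈ (square a b).support then (square a b).sign K r * val x r (s + 1) else 0 :=
    fun x r s => by rw [hh]
  refine ⟨h, fun x => val_ext fun r s => ?_, hval⟩
  rw [map_add, Pi.add_apply, Pi.add_apply]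
  simp only [val_dTot, hval, mem_support_square, sign]
  by_cases hrs : (r = a ∨ r = a + 1) ∧ (s = b ∨ s = b + 1)
  · have n1 : ∀ c : ℤ, c - 1 ≠ c + 1 := fun c => by omega
    have n2 : ∀ c : ℤ, c + 1 + 1 ≠ c := fun c => by omega
    obtain ⟨rfl | rfl, rfl | rfl⟩ := hrs
    · simp [n1, val_eq_zero x (r := r - 1) (s := s + 1) (by rw [mem_support_square]; omega)]
    · simp [n1, n2]
    · simp [n1]
    · simp [n2, val_eq_zero x (r := a) (s := b + 1 + 1) (by rw [mem_support_square]; omega)]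
  · simp only [if_neg hrs, add_zero]
    exact (val_eq_zero x hrs).symm

open scoped Classical in
-- The homotopy inverts the horizontal arrows and preserves the second degree.
theorem exists_horizontal_homotopy (a b : ℤ) :
    ∃ h : ((square a b).model K).Total → ((square a b).model K).Total,
      (∀ x, ((square a b).model K).dTot (h x) + h (((square a b).model K).dTot x) = x) ∧
      ∀ x r s, val (h x) r s =
        if (r, s) ∈ (square a b).support then val x (r + 1) s else 0 := by
  choose h hh using fun x : ((square a b).model K).Total => exists_val_eq (K := K)
    (finite_support_square a b) (fun r s => if (r, s) ∈ (square a b).support then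
      val x (r + 1) s else 0) (fun r s hrs => if_neg hrs)
  have hval : ∀ x r s, val (h x) r s =
      if (r, s) ∈ (square a b).support then val x (r + 1) s else 0 :=
    fun x r s => by rw [hh]
  refine ⟨h, fun x => val_ext fun r s => ?_, hval⟩
  rw [map_add, Pi.add_apply, Pi.add_apply]
  simp only [val_dTot, hval, mem_support_square, sign]
  by_cases hrs : (r = a ∨ r = a + 1) ∧ (s = b ∨ s = b + 1)
  · have n1 : ∀ c : ℤ, c - 1 ≠ c + 1 := fun c => by omega
    have n2 : ∀ c : ℤ, c + 1 + 1 ≠ c := fun c => by omega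
    obtain ⟨rfl | rfl, rfl | rfl⟩ := hrs
    · simp [n1, val_eq_zero x (r := r + 1) (s := s - 1) (by rw [mem_support_square]; omega)]
    · simp [n1]
    · simp [n1, n2]
    · simp [n2, val_eq_zero x (r := a + 1 + 1) (s := b) (by rw [mem_support_square]; omega)]
  · simp only [if_neg hrs, add_zero]
    exact (val_eq_zero x hrs).symm

end Shape

namespace DoubleComplex

variable {K : Type v} [Field K] {A : DoubleComplex.{u} K}

theorem dTot_dTot (x : A.Total) : A.dTot (A.dTot x) = 0 := by
  simp only [dTot, LinearMap.add_apply, map_add, delTot_delTot, delbarTot_delbarTot,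
    delbarTot_delTot]
  simp

theorem supportedOn_mono {S T : Set (ℤ × ℤ)} (h : S ⊆ T) : A.supportedOn S ≤ A.supportedOn T :=
  fun _ hx i hi => hx i fun h' => hi (h h')

theorem filtration_anti {wt : ℤ × ℤ → ℤ} {l l' k : ℤ} (h : l ≤ l') :
    A.filtration wt l' k ≤ A.filtration wt l k :=
  supportedOn_mono fun _ hi => ⟨hi.1, h.trans hi.2⟩

/-- Write x = h(dx) + d(hx). The first term lies in F_{l+r}, hence in F_{l+1}, and has differential
dx. In the second, hx lies in F_l, which is contained in F_{l-r+1}, and d(hx) = x − h(dx) is still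
in F_l. Both inclusions use r ≥ 1. -/
theorem filteredCycles_le_of_homotopy {h : A.Total → A.Total} {wt : ℤ × ℤ → ℤ}
    (hd : ∀ x, A.dTot (h x) + h (A.dTot x) = x)
    (hF : ∀ l k x, x ∈ A.filtration wt l k → h x ∈ A.filtration wt l (k - 1)) {r : ℤ} (hr : 1 ≤ r)
    (l k : ℤ) : A.filteredCycles wt r l k ≤ A.filteredBoundaries wt r l k := by
  rintro x ⟨hx, hdx⟩
  rw [SetLike.mem_coe, Submodule.mem_comap] at hdx
  have h1 : h (A.dTot x) ∈ A.filtration wt (l + r) k := by simpa using hF _ _ _ hdx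
  have h2 : A.dTot (h x) = x - h (A.dTot x) := eq_sub_of_add_eq (hd x)
  rw [← hd x, add_comm]
  refine add_mem (Submodule.mem_sup_left ⟨filtration_anti (by omega) h1, ?_⟩)
    (Submodule.mem_sup_right ⟨h x, ⟨filtration_anti (by omega) (hF _ _ _ hx), ?_⟩, rfl⟩)
  · rw [SetLike.mem_coe, Submodule.mem_comap, show l + 1 + (r - 1) = l + r by ring]
    have : h (A.dTot x) = x - A.dTot (h x) := eq_sub_of_add_eq' (hd x)
    rw [this, map_sub, dTot_dTot, sub_zero]
    exact hdx
  · rw [SetLike.mem_coe, Submodule.mem_comap, show l - r + 1 + (r - 1) = l by ring, sub_add_cancel,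
      h2]
    exact sub_mem hx (filtration_anti (by omega) h1)

end DoubleComplex

namespace Shape

open DoubleComplex

variable {K : Type v} [Field K]

theorem filteredCycles_fst_le_square (a b : ℤ) {r : ℤ} (hr : 1 ≤ r) (l k : ℤ) :
    ((square a b).model K).filteredCycles Prod.fst r l k ≤
      ((square a b).model K).filteredBoundaries Prod.fst r l k := by
  classical
  obtain ⟨h, hd, hv⟩ := exists_vertical_homotopy (K := K) a b
  refine filteredCycles_le_of_homotopy hd (fun l k x hx => ?_) hr l k
  rw [filtration, mem_supportedOn_iff] at hx ⊢
  intro r s h0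
  rw [hv] at h0
  have := hx r (s + 1) fun h' => h0 (by simp [h'])
  simp only [Set.mem_ofPred_eq] at this ⊢
  omega

theorem filteredCycles_snd_le_square (a b : ℤ) {r : ℤ} (hr : 1 ≤ r) (l k : ℤ) :
    ((square a b).model K).filteredCycles Prod.snd r l k ≤
      ((square a b).model K).filteredBoundaries Prod.snd r l k := by
  classical
  obtain ⟨h, hd, hv⟩ := exists_horizontal_homotopy (K := K) a b
  refine filteredCycles_le_of_homotopy hd (fun l k x hx => ?_) hr l k
  rw [filtration, mem_supportedOn_iff] at hx ⊢
  intro r s h0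
  rw [hv] at h0
  have := hx (r + 1) s fun h' => h0 (by simp [h'])
  simp only [Set.mem_ofPred_eq] at this ⊢
  omega

theorem mem_bigolinTerm_iff {S : Shape} {p q k : ℤ} {x : (S.model K).Total} :
    x ∈ (S.model K).bigolinTerm p q k ↔ ∀ r s, val x r s ≠ 0 →
      (k ≤ p + q ∧ r + s = k ∧ r ≤ p ∧ s ≤ q) ∨ (p + q < k ∧ r + s = k + 1 ∧ p < r ∧ q < s) := by
  rw [bigolinTerm, mem_supportedOn_iff]
  refine forall₃_congr fun r s _ => ?_
  unfold bigolinSupport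
  split_ifs with h
  · simp only [Set.mem_ofPred_eq]
    omega
  · simp only [Set.mem_ofPred_eq]
    omega

/-- A homotopy that crosses neither the line between columns p and p + 1 nor the one between rows q
and q + 1 contracts both halves of the Bigolin complex. At the junction degree reasons suffice. In
degree p + q the differential dx has no component in bidegrees ≤ (p, q). In degree p + q + 1 there
is no room for hx, so x = d(hx) = 0. -/
theorem bigolinCocycles_le_of_homotopy {S : Shape} {h : (S.model K).Total → (S.model K).Total}
    (hd : ∀ x, (S.model K).dTot (h x) + h ((S.model K).dTot x) = x) (h0 : h 0 = 0) {p q : ℤ}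
    (hv : ∀ x r s, val (h x) r s ≠ 0 → ∃ r' s', val x r' s' ≠ 0 ∧ r' + s' = r + s + 1 ∧
      (r' ≤ p ↔ r ≤ p) ∧ (s' ≤ q ↔ s ≤ q)) (k : ℤ) :
    (S.model K).bigolinCocycles p q k ≤ (S.model K).bigolinCoboundaries p q k := by
  classical
  rintro x ⟨hx, hdx⟩
  have hdx : (S.model K).bigolinD p q k x = 0 := hdx
  have hterm : k ≤ p + q ∨ p + q + 1 < k → h x ∈ (S.model K).bigolinTerm p q (k - 1) := by
    intro hk
    rw [SetLike.mem_coe, mem_bigolinTerm_iff] at hx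
    rw [mem_bigolinTerm_iff]
    intro r s hrs
    obtain ⟨r', s', h1, h2, h3, h4⟩ := hv x r s hrs
    have := hx r' s' h1
    omega
  rcases le_or_gt k (p + q) with hk | hk
  · refine ⟨h x, hterm (Or.inl hk), ?_⟩
    rw [bigolinD, if_pos (by omega)]
    have hπ : ∀ r s, r ≤ p → s ≤ q → val ((S.model K).dTot x) r s = 0 := by
      intro r s hr hs
      rcases eq_or_lt_of_le hk with rfl | hk
      · rw [val_dTot]
        rw [SetLike.mem_coe, mem_bigolinTerm_iff] at hx
        by_contra h'
        have h1 : val x (r - 1) s ≠ 0 ∨ val x r (s - 1) ≠ 0 := by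
          by_contra! h1
          simp [h1] at h'
        rcases h1 with h1 | h1
        · have := hx _ _ h1
          have h3 : r + s ≠ p + q := by omega
          omega
        · have := hx _ _ h1
          omega
      · rw [bigolinD, if_pos hk] at hdx
        have := congrFun (congrFun (congrArg val hdx) r) s
        rw [LinearMap.comp_apply, val_projOn, if_pos ⟨hr, hs⟩] at this
        exact this
    refine val_ext fun r s => ?_
    rw [LinearMap.comp_apply, val_projOn]
    rw [SetLike.mem_coe, mem_bigolinTerm_iff] at hx
    split_ifs with hrs
    · have h1 : val (h ((S.model K).dTot x)) r s = 0 := by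
        by_contra h'
        obtain ⟨r', s', h1, h2, h3, h4⟩ := hv _ r s h'
        exact h1 (hπ r' s' (h3.2 hrs.1) (h4.2 hrs.2))
      conv_rhs => rw [← hd x, map_add, Pi.add_apply, Pi.add_apply, h1, add_zero]
    · by_contra h'
      have := hx r s (Ne.symm h')
      simp only [Set.mem_ofPred_eq] at hrs
      omega
  · rw [bigolinD, if_neg (by omega), if_neg (by omega)] at hdx
    have hxe : (S.model K).dTot (h x) = x := by
      conv_rhs => rw [← hd x, hdx, h0, add_zero]
    rcases eq_or_lt_of_le (Int.add_one_le_of_lt hk) with rfl | hk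
    · have hx0 : h x = 0 := by
        refine val_ext fun r s => ?_
        by_contra h'
        obtain ⟨r', s', h1, h2, h3, h4⟩ := hv x r s h'
        rw [SetLike.mem_coe, mem_bigolinTerm_iff] at hx
        have := hx r' s' h1
        omega
      rw [hx0, map_zero] at hxe
      rw [← hxe]
      exact zero_mem _
    · refine ⟨h x, hterm (Or.inr hk), ?_⟩
      rw [bigolinD, if_neg (by omega), if_neg (by omega)]
      exact hxe

/-- If b ≠ q the vertical homotopy does not cross the line above row q, and if a ≠ p the horizontal
one does not cross the line after column p. In the square at (p, q) itself the Bigolin complex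
consists of the lower left and upper right corners, joined by the isomorphism ∂∂̄. -/
theorem bigolinCocycles_le_square (a b p q k : ℤ) :
    ((square a b).model K).bigolinCocycles p q k ≤
      ((square a b).model K).bigolinCoboundaries p q k := by
  classical
  by_cases hb : b = q
  swap
  · obtain ⟨h, hd, hv⟩ := exists_vertical_homotopy (K := K) a b
    refine bigolinCocycles_le_of_homotopy hd (val_ext fun r s => by simp [hv]) ?_ k
    intro x r s h0
    rw [hv] at h0
    have h1 : (r, s) ∈ (square a b).support := by
      by_contra h1
      simp [h1] at h0
    have h2 : val x r (s + 1) ≠ 0 := fun h' => h0 (by simp [h'])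
    have h3 : (r, s + 1) ∈ (square a b).support := by
      by_contra h3
      exact h2 (val_eq_zero x h3)
    rw [mem_support_square] at h1 h3
    exact ⟨r, s + 1, h2, by ring, Iff.rfl, by omega⟩
  by_cases ha : a = p
  swap
  · obtain ⟨h, hd, hv⟩ := exists_horizontal_homotopy (K := K) a b
    refine bigolinCocycles_le_of_homotopy hd (val_ext fun r s => by simp [hv]) ?_ k
    intro x r s h0
    rw [hv] at h0
    have h1 : (r, s) ∈ (square a b).support := by
      by_contra h1
      simp [h1] at h0
    have h2 : val x (r + 1) s ≠ 0 := fun h' => h0 (by simp [h'])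
    have h3 : (r + 1, s) ∈ (square a b).support := by
      by_contra h3
      exact h2 (val_eq_zero x h3)
    rw [mem_support_square] at h1 h3
    exact ⟨r + 1, s, h2, by ring, by omega, Iff.rfl⟩
  subst ha hb
  rintro x ⟨hx, hdx⟩
  have hdx : ((square a b).model K).bigolinD a b k x = 0 := hdx
  rw [SetLike.mem_coe, mem_bigolinTerm_iff] at hx
  have hsupp : ∀ r s, val x r s ≠ 0 →
      (r = a ∧ s = b ∧ k = a + b) ∨ (r = a + 1 ∧ s = b + 1 ∧ k = a + b + 1) := by
    intro r s h0
    have h1 := hx r s h0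
    have h2 : (r, s) ∈ (square a b).support := by
      by_contra h2
      exact h0 (val_eq_zero x h2)
    rw [mem_support_square] at h2
    omega
  by_cases hk : k = a + b
  · have hx0 : x = 0 := by
      refine val_ext fun r s => ?_
      by_contra h0
      obtain ⟨rfl, rfl, -⟩ | ⟨-, -, h⟩ := hsupp r s h0
      · rw [bigolinD, if_neg (by omega), if_pos hk] at hdx
        have := congrFun (congrFun (congrArg val hdx) (r + 1)) (s + 1)
        rw [LinearMap.comp_apply, val_delTot, val_delbarTot] at this
        simp [mem_support_square, sign] at this
        exact h0 this
      · omega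
    rw [hx0]
    exact zero_mem _
  by_cases hk : k = a + b + 1
  · obtain ⟨y, hy⟩ := exists_val_eq (K := K) (finite_support_square a b)
      (fun r s => if r = a ∧ s = b then val x (a + 1) (b + 1) else 0) (fun r s h => by
        rw [mem_support_square] at h
        exact if_neg (by omega))
    refine ⟨y, ?_, ?_⟩
    · rw [SetLike.mem_coe, mem_bigolinTerm_iff]
      intro r s h0
      rw [hy] at h0
      have : r = a ∧ s = b := by
        by_contra h
        exact h0 (if_neg h)
      omega
    · rw [bigolinD, if_neg (by omega), if_pos (by omega)]
      refine val_ext fun r s => ?_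
      rw [LinearMap.comp_apply, val_delTot, val_delbarTot, hy]
      by_cases h0 : r = a + 1 ∧ s = b + 1
      · obtain ⟨rfl, rfl⟩ := h0
        simp [mem_support_square, sign]
      · have : val x r s = 0 := by
          by_contra h
          have := hsupp r s h
          omega
        have h1 : ¬(r - 1 = a ∧ s - 1 = b) := by omega
        simp [this, h1]
  · have hx0 : x = 0 := by
      refine val_ext fun r s => ?_
      by_contra h0
      have := hsupp r s h0
      omega
    rw [hx0]
    exact zero_mem _

end Shape
end

/-! ### Spectral sequence pages of a path -/

noncomputable section

section Alternating

variable {K : Type v} [Field K]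

/-- The relation says that the values at consecutive odd places differ by a sign, so a cocycle on a
path is governed by any one of its values. -/
theorem alternating_eq_zero_iff {c : ℤ → K} {u v : ℤ} (hu : u % 2 = 1) (hv : v % 2 = 1)
    (huv : u ≤ v) (h : ∀ i, i % 2 = 0 → u < i → i < v → c (i - 1) + c (i + 1) = 0) :
    c u = 0 ↔ c v = 0 := by
  obtain ⟨t, rfl⟩ : ∃ t : ℕ, v = u + 2 * t := ⟨((v - u) / 2).toNat, by omega⟩
  clear huv
  induction t with
  | zero => simp
  | succ t ih =>
    rw [ih (by omega) fun i h1 h2 h3 => h i h1 h2 (by push_cast; omega)]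
    have := h (u + 2 * t + 1) (by omega) (by omega) (by push_cast; omega)
    rw [add_sub_cancel_right, show u + 2 * (t : ℤ) + 1 + 1 = u + 2 * ((t + 1 : ℕ) : ℤ) by
      push_cast; ring] at this
    constructor <;> intro h0 <;> rw [h0] at this <;> simpa using this

/-- The sequence supported on the odd integers in `[m, n]` whose values are alternately `1`
and `-1`. -/
def alternating (K : Type v) [Field K] (m n i : ℤ) : K :=
  if m ≤ i ∧ i ≤ n then if i % 4 = 1 then 1 else if i % 4 = 3 then -1 else 0 else 0

theorem alternating_ne_zero {m n i : ℤ} :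
    alternating K m n i ≠ 0 ↔ m ≤ i ∧ i ≤ n ∧ i % 2 = 1 := by
  unfold alternating
  split_ifs
  · simpa using by omega
  · simpa using by omega
  · simpa using by omega
  · simpa using by omega

theorem alternating_add {m n i : ℤ} (h1 : m ≤ i - 1) (h2 : i + 1 ≤ n) :
    alternating K m n (i - 1) + alternating K m n (i + 1) = 0 := by
  have h3 : m ≤ i - 1 ∧ i - 1 ≤ n := by omega
  have h4 : m ≤ i + 1 ∧ i + 1 ≤ n := by omega
  rw [alternating, alternating, if_pos h3, if_pos h4]
  have h5 : (i - 1) % 4 = 1 ↔ (i + 1) % 4 = 3 := by omega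
  have h6 : (i - 1) % 4 = 3 ↔ (i + 1) % 4 = 1 := by omega
  simp only [h5, h6]
  split_ifs with h7 h8
  · omega
  all_goals simp

theorem eq_of_single_ne_zero {i j : ℤ} {c : K} (h : (Pi.single i c : ℤ → K) j ≠ 0) : j = i := by
  by_contra hji
  exact h (Pi.single_eq_of_ne (M := fun _ : ℤ => K) hji c)

end Alternating

namespace DoubleComplex

variable {K : Type v} [Field K] {A : DoubleComplex.{u} K}

/-- Coordinates that identify the total space of `A` with the space of sequences supported on
`[m, n]`, such that the coordinate `i` is that of the bidegree `β i`, of total degree `k` for odd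
`i` and `k + 1` for even `i`, and the differential is the one of a zigzag. -/
structure IsPathChart (A : DoubleComplex.{u} K) (ξ : A.Total →ₗ[K] (ℤ → K)) (k m n : ℤ)
    (β : ℤ → ℤ × ℤ) : Prop where
  le_and_le : ∀ x i, ξ x i ≠ 0 → m ≤ i ∧ i ≤ n
  exists_eq : ∀ c : ℤ → K, (∀ i, c i ≠ 0 → m ≤ i ∧ i ≤ n) → ∃ x, ξ x = c
  dTot : ∀ x i, ξ (A.dTot x) i =
    if i % 2 = 0 ∧ m ≤ i ∧ i ≤ n then ξ x (i - 1) + ξ x (i + 1) else 0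
  mem_supportedOn : ∀ T x, x ∈ A.supportedOn T ↔ ∀ i, ξ x i ≠ 0 → β i ∈ T
  degree : ∀ i, (β i).1 + (β i).2 = if i % 2 = 1 then k else k + 1

namespace IsPathChart

variable {ξ : A.Total →ₗ[K] (ℤ → K)} {k m n : ℤ} {β : ℤ → ℤ × ℤ} (h : IsPathChart A ξ k m n β)
include h

theorem injective : Function.Injective ξ := by
  refine (injective_iff_map_eq_zero _).2 fun x hx => ?_
  have : x ∈ A.supportedOn ∅ := (h.mem_supportedOn ∅ x).2 fun i hi => (hi (congrFun hx i)).elim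
  exact Total.ext fun r s => this (r, s) (Set.notMem_empty _)

/-- Vertices `2 a` and `2 a + 1` have the same weight. Of the two arrows out of an odd vertex, the
left one preserves the filtration and the right one raises it by one. -/
theorem mem_filtration {wt : ℤ × ℤ → ℤ} {w : ℤ} (hwt : ∀ i, wt (β i) = w + i / 2) {a j : ℤ}
    {x : A.Total} : x ∈ A.filtration wt (w + a) j ↔
      ∀ i, ξ x i ≠ 0 → ((i % 2 = 1 ∧ j = k) ∨ (i % 2 = 0 ∧ j = k + 1)) ∧ a ≤ i / 2 := by
  rw [filtration, h.mem_supportedOn]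
  refine forall_congr' fun i => imp_congr_right fun _ => ?_
  rw [Set.mem_ofPred_eq, h.degree, hwt]
  split_ifs <;> omega

theorem mem_filteredCycles {wt : ℤ × ℤ → ℤ} {w : ℤ} (hwt : ∀ i, wt (β i) = w + i / 2)
    {r a j : ℤ} {x : A.Total} : x ∈ A.filteredCycles wt r (w + a) j ↔
      (∀ i, ξ x i ≠ 0 → ((i % 2 = 1 ∧ j = k) ∨ (i % 2 = 0 ∧ j = k + 1)) ∧ a ≤ i / 2) ∧
      ∀ i, i % 2 = 0 → m ≤ i → i ≤ n → i / 2 < a + r → ξ x (i - 1) + ξ x (i + 1) = 0 := by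
  rw [filteredCycles, Submodule.mem_inf, Submodule.mem_comap, h.mem_filtration hwt, add_assoc,
    h.mem_filtration hwt]
  refine and_congr_right fun hx => forall_congr' fun i => ?_
  rw [h.dTot]
  constructor
  · intro h1 h2 h3 h4 h5
    rw [if_pos ⟨h2, h3, h4⟩] at h1
    by_contra h0
    have := (h1 h0).2
    omega
  · intro h1 h2
    by_cases hi : i % 2 = 0 ∧ m ≤ i ∧ i ≤ n
    swap
    · exact (h2 (if_neg hi)).elim
    rw [if_pos hi] at h2
    obtain hs | hs : ξ x (i - 1) ≠ 0 ∨ ξ x (i + 1) ≠ 0 := by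
      by_contra! hs
      exact h2 (by rw [hs.1, hs.2, add_zero])
    all_goals
      have h3 := (hx _ hs).1
      refine ⟨by omega, ?_⟩
      by_contra h5
      exact h2 (h1 hi.1 hi.2.1 hi.2.2 (by omega))

/-- There are no boundaries in degree `k`, so the page only reads the coordinate at `2 * a + 1`. If
the path contains vertex `2 * a`, the equation there kills this coordinate. If it starts at `2 * a +
1`, the coordinate propagates to the right with alternating signs. It survives if the path ends in
degree `k`, or if its even end is so far that no equation is imposed there. -/
theorem filteredPage_first {wt : ℤ × ℤ → ℤ} {w : ℤ} (hwt : ∀ i, wt (β i) = w + i / 2) {r : ℤ}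
    (hr : 1 ≤ r) (a : ℤ) (hmn : m ≤ n) :
    FiniteDimensional K (A.filteredPage wt r (w + a) k) ∧
      Module.finrank K (A.filteredPage wt r (w + a) k) =
        if m = 2 * a + 1 ∧ (n % 2 = 1 ∨ 2 * (a + r) ≤ n) then 1 else 0 := by
  have hB : ∀ x, x ∈ A.filteredBoundaries wt r (w + a) k ↔
      x ∈ A.filteredCycles wt r (w + a) k ∧ ξ x (2 * a + 1) = 0 := by
    intro x
    have h0 : (A.filteredCycles wt (r - 1) (w + a - r + 1) (k - 1)).map A.dTot = ⊥ := by
      rw [eq_bot_iff]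
      rintro _ ⟨y, hy, rfl⟩
      have : y = 0 := h.injective (funext fun i => by
        rw [map_zero]
        by_contra hi
        rw [SetLike.mem_coe, show w + a - r + 1 = w + (a - r + 1) by ring,
          h.mem_filteredCycles hwt] at hy
        have := hy.1 i hi
        omega)
      rw [this, map_zero]
      exact zero_mem _
    rw [filteredBoundaries, h0, sup_bot_eq, add_assoc, h.mem_filteredCycles hwt,
      h.mem_filteredCycles hwt]
    constructor
    · rintro ⟨h1, h2⟩
      refine ⟨⟨fun i hi => ?_, fun i h3 h4 h5 h6 => h2 i h3 h4 h5 (by omega)⟩, ?_⟩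
      · have := h1 i hi
        omega
      · by_contra hi
        have := h1 _ hi
        omega
    · rintro ⟨⟨h1, h2⟩, h0⟩
      refine ⟨fun i hi => ?_, fun i h3 h4 h5 h6 => h2 i h3 h4 h5 (by omega)⟩
      have := h1 i hi
      have : i ≠ 2 * a + 1 := by
        rintro rfl
        exact hi h0
      omega
  split_ifs with hc
  · obtain ⟨rfl, hc⟩ := hc
    obtain ⟨z, hz⟩ := h.exists_eq (alternating K (2 * a + 1) n) fun i hi => by
      have := alternating_ne_zero.1 hi
      omega
    have hz1 : z ∈ A.filteredCycles wt r (w + a) k := by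
      rw [h.mem_filteredCycles hwt, hz]
      refine ⟨fun i hi => ?_, fun i h1 h2 h3 h4 => alternating_add (by omega) (by omega)⟩
      have := alternating_ne_zero.1 hi
      omega
    have hz0 : ξ z (2 * a + 1) ≠ 0 := by
      rw [hz, alternating_ne_zero]
      omega
    refine subquotient_eq_one (B := A.filteredBoundaries wt r (w + a) k) hz1
      (fun hz2 => hz0 ((hB z).1 hz2).2)
      fun x hx => ⟨ξ x (2 * a + 1) / ξ z (2 * a + 1), (hB _).2
        ⟨sub_mem hx (Submodule.smul_mem _ _ hz1), ?_⟩⟩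
    rw [map_sub, map_smul, Pi.sub_apply, Pi.smul_apply, smul_eq_mul, div_mul_cancel₀ _ hz0, sub_self]
  · refine subquotient_eq_zero (B := A.filteredBoundaries wt r (w + a) k)
      fun x hx => (hB x).2 ⟨hx, ?_⟩
    rw [h.mem_filteredCycles hwt] at hx
    by_contra h0
    have h1 := h.le_and_le _ _ h0
    by_cases h2 : m = 2 * a + 1
    -- Here `n` is even and the equation at `n` is imposed, so the zero value at `n + 1`, outside
    -- the path, propagates back to `2 * a + 1`.
    · refine h0 ((alternating_eq_zero_iff (v := n + 1) (by omega) (by omega) (by omega)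
        fun i h3 h4 h5 => hx.2 i h3 (by omega) (by omega) (by omega)).2 ?_)
      by_contra h3
      have := h.le_and_le _ _ h3
      omega
    · have h3 := hx.2 (2 * a) (by omega) (by omega) (by omega) (by omega)
      have h4 : ξ x (2 * a - 1) = 0 := by
        by_contra h4
        have := hx.1 _ h4
        omega
      rw [h4, zero_add] at h3
      exact h0 h3

/-- Every element of degree `k + 1` is a cycle and only the coordinate at `2 * a` counts; it dies as
soon as an admissible `y` has a boundary with nonzero value there. If the path continues to the
right, the vertex `2 * a + 1` gives such a `y`. If it ends at `2 * a`, `y` must alternate all the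
way to an odd left end lying in the allowed filtration step. -/
theorem filteredPage_second {wt : ℤ × ℤ → ℤ} {w : ℤ} (hwt : ∀ i, wt (β i) = w + i / 2) {r : ℤ}
    (hr : 1 ≤ r) (a : ℤ) (hmn : m ≤ n) :
    FiniteDimensional K (A.filteredPage wt r (w + a) (k + 1)) ∧
      Module.finrank K (A.filteredPage wt r (w + a) (k + 1)) =
        if n = 2 * a ∧ (m % 2 = 0 ∨ m ≤ 2 * (a - r) + 1) then 1 else 0 := by
  have hy : ∀ y, y ∈ A.filteredCycles wt (r - 1) (w + a - r + 1) (k + 1 - 1) ↔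
      (∀ i, ξ y i ≠ 0 → i % 2 = 1 ∧ a - r + 1 ≤ i / 2) ∧
      ∀ i, i % 2 = 0 → m ≤ i → i ≤ n → i / 2 < a → ξ y (i - 1) + ξ y (i + 1) = 0 := by
    intro y
    rw [show w + a - r + 1 = w + (a - r + 1) by ring, h.mem_filteredCycles hwt,
      show a - r + 1 + (r - 1) = a by ring]
    refine and_congr_left fun _ => forall_congr' fun i => imp_congr_right fun _ => ?_
    omega
  have hZ : ∀ (r a : ℤ) x, x ∈ A.filteredCycles wt r (w + a) (k + 1) ↔
      ∀ i, ξ x i ≠ 0 → i % 2 = 0 ∧ a ≤ i / 2 := by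
    intro r a x
    rw [h.mem_filteredCycles hwt]
    constructor
    · intro h1 i hi
      have := h1.1 i hi
      omega
    · intro h1
      refine ⟨fun i hi => by have := h1 i hi; omega, fun i h2 _ _ _ => ?_⟩
      have h3 : ∀ j, j % 2 = 1 → ξ x j = 0 := fun j hj => by
        by_contra h4
        have := h1 j h4
        omega
      rw [h3 _ (by omega), h3 _ (by omega), add_zero]
  have hzero : ∀ x ∈ A.filteredCycles wt r (w + a) (k + 1), ξ x (2 * a) = 0 →
      x ∈ A.filteredBoundaries wt r (w + a) (k + 1) := by
    intro x hx h0
    refine Submodule.mem_sup_left ?_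
    rw [add_assoc, hZ]
    rw [hZ] at hx
    intro i hi
    have := hx i hi
    have : i ≠ 2 * a := by
      rintro rfl
      exact hi h0
    omega
  have hsub : ∀ z ∈ A.filteredCycles wt r (w + a) (k + 1), ξ z (2 * a) ≠ 0 →
      ∀ x ∈ A.filteredCycles wt r (w + a) (k + 1),
        x - (ξ x (2 * a) / ξ z (2 * a)) • z ∈ A.filteredBoundaries wt r (w + a) (k + 1) := by
    intro z hz hz0 x hx
    refine hzero _ (sub_mem hx (Submodule.smul_mem _ _ hz)) ?_
    rw [map_sub, map_smul, Pi.sub_apply, Pi.smul_apply, smul_eq_mul, div_mul_cancel₀ _ hz0, sub_self]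
  have hkill : ∀ y ∈ A.filteredCycles wt (r - 1) (w + a - r + 1) (k + 1 - 1),
      ξ (A.dTot y) (2 * a) ≠ 0 → A.filteredCycles wt r (w + a) (k + 1) ≤
        A.filteredBoundaries wt r (w + a) (k + 1) := by
    intro y hy0 h0 x hx
    have hdy : A.dTot y ∈ A.filteredCycles wt r (w + a) (k + 1) := by
      rw [hZ]
      intro i hi
      rw [h.dTot] at hi
      split_ifs at hi with h1
      · refine ⟨h1.1, ?_⟩
        by_contra h2
        exact hi (((hy y).1 hy0).2 i h1.1 h1.2.1 h1.2.2 (by omega))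
      · exact (hi rfl).elim
    have := hsub _ hdy h0 x hx
    rw [← sub_add_cancel x ((ξ x (2 * a) / ξ (A.dTot y) (2 * a)) • A.dTot y)]
    exact add_mem this (Submodule.smul_mem _ _ (Submodule.mem_sup_right ⟨y, hy0, rfl⟩))
  split_ifs with hc
  · obtain ⟨rfl, hc⟩ := hc
    obtain ⟨z, hz⟩ := h.exists_eq (Pi.single (2 * a) 1) fun i hi => by
      have := eq_of_single_ne_zero hi
      omega
    have hz1 : z ∈ A.filteredCycles wt r (w + a) (k + 1) := by
      rw [hZ, hz]
      intro i hi
      have := eq_of_single_ne_zero hi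
      omega
    have hz0 : ξ z (2 * a) = 1 := by rw [hz, Pi.single_eq_same]
    refine subquotient_eq_one (B := A.filteredBoundaries wt r (w + a) (k + 1)) hz1 (fun hB => ?_)
      fun x hx => ⟨_, hsub z hz1 (by rw [hz0]; exact one_ne_zero) x hx⟩
    obtain ⟨x, hx, _, ⟨y, hy0, rfl⟩, hxy⟩ := Submodule.mem_sup.1 hB
    have h1 : ξ x (2 * a) = 0 := by
      by_contra h1
      rw [add_assoc, hZ] at hx
      have := hx _ h1
      omega
    have h2 := congrFun (congrArg ξ hxy) (2 * a)
    rw [map_add, Pi.add_apply, h1, zero_add, hz0, h.dTot, if_pos (by omega)] at h2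
    have h3 : ξ y (2 * a + 1) = 0 := by
      by_contra h3
      have := h.le_and_le _ _ h3
      omega
    have hy1 := (hy y).1 hy0
    -- The value of `y` at `2 * a - 1` is reached by alternation from a place where `y` vanishes:
    -- from `m - 1`, outside the path, if `m` is even, and from `2 * (a - r) + 1`, just below the
    -- filtration step, if `m` is odd.
    have hlow : ∀ i, i % 2 = 1 → (i < m ∨ i / 2 ≤ a - r) → i ≤ 2 * a - 1 →
        (∀ j, j % 2 = 0 → i < j → j < 2 * a - 1 → m ≤ j) → ξ y (2 * a - 1) = 0 := by
      intro i hi hi2 hi3 hi4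
      refine (alternating_eq_zero_iff hi (by omega) hi3
        fun j h4 h5 h6 => hy1.2 j h4 (hi4 j h4 h5 h6) (by omega) (by omega)).1 ?_
      by_contra h4
      have := h.le_and_le _ _ h4
      have := hy1.1 _ h4
      omega
    have h4 : ξ y (2 * a - 1) = 0 := by
      by_cases hm : m % 2 = 0
      · exact hlow (m - 1) (by omega) (by omega) (by omega) (by omega)
      · exact hlow (2 * (a - r) + 1) (by omega) (by omega) (by omega) (by omega)
    rw [h3, h4, add_zero] at h2
    exact zero_ne_one h2
  · refine subquotient_eq_zero (B := A.filteredBoundaries wt r (w + a) (k + 1)) ?_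
    by_cases h1 : m ≤ 2 * a ∧ 2 * a ≤ n
    swap
    · exact fun x hx => hzero x hx (by
        by_contra h2
        exact h1 (h.le_and_le _ _ h2))
    by_cases h2 : n = 2 * a
    · obtain ⟨y, hy1⟩ := h.exists_eq (alternating K m n) fun i hi => by
        have := alternating_ne_zero.1 hi
        omega
      refine hkill y ((hy y).2 ⟨fun i hi => ?_, fun i h3 h4 h5 h6 => ?_⟩) ?_
      · rw [hy1, alternating_ne_zero] at hi
        omega
      · rw [hy1]
        exact alternating_add (by omega) (by omega)
      · have h3 : alternating K m n (2 * a + 1) = 0 := by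
          by_contra h3
          have := alternating_ne_zero.1 h3
          omega
        rw [h.dTot, if_pos (by omega), hy1, h3, add_zero, alternating_ne_zero]
        omega
    · obtain ⟨y, hy1⟩ := h.exists_eq (Pi.single (2 * a + 1) 1) fun i hi => by
        have := eq_of_single_ne_zero hi
        omega
      refine hkill y ((hy y).2 ⟨fun i hi => ?_, fun i h3 h4 h5 h6 => ?_⟩) ?_
      · rw [hy1] at hi
        have := eq_of_single_ne_zero hi
        omega
      · rw [hy1, Pi.single_eq_of_ne (by omega), Pi.single_eq_of_ne (by omega), add_zero]
      · rw [h.dTot, if_pos (by omega), hy1, Pi.single_eq_of_ne (by omega), Pi.single_eq_same,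
          zero_add]
        exact one_ne_zero

theorem filteredPage_other {wt : ℤ × ℤ → ℤ} {w : ℤ} (hwt : ∀ i, wt (β i) = w + i / 2)
    (r a : ℤ) {j : ℤ} (hj : j ≠ k) (hj' : j ≠ k + 1) :
    FiniteDimensional K (A.filteredPage wt r (w + a) j) ∧
      Module.finrank K (A.filteredPage wt r (w + a) j) = 0 := by
  refine subquotient_eq_zero (B := A.filteredBoundaries wt r (w + a) j) fun x hx => ?_
  rw [h.mem_filteredCycles hwt] at hx
  have : x = 0 := h.injective (funext fun i => by
    rw [map_zero]
    by_contra hi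
    have := hx.1 i hi
    omega)
  rw [this]
  exact zero_mem _

theorem filteredPage {wt : ℤ × ℤ → ℤ} {w : ℤ} (hwt : ∀ i, wt (β i) = w + i / 2) {r : ℤ}
    (hr : 1 ≤ r) (l j : ℤ) (hmn : m ≤ n) :
    FiniteDimensional K (A.filteredPage wt r l j) ∧
      Module.finrank K (A.filteredPage wt r l j) =
        if (j = k ∧ m = 2 * (l - w) + 1 ∧ (n % 2 = 1 ∨ 2 * (l - w + r) ≤ n)) ∨
          (j = k + 1 ∧ n = 2 * (l - w) ∧ (m % 2 = 0 ∨ m ≤ 2 * (l - w - r) + 1)) then 1 else 0 := by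
  obtain ⟨a, rfl⟩ : ∃ a, l = w + a := ⟨l - w, by ring⟩
  rw [add_sub_cancel_left]
  by_cases h1 : j = k
  · subst h1
    simpa using h.filteredPage_first hwt hr a hmn
  by_cases h2 : j = k + 1
  · subst h2
    simpa using h.filteredPage_second hwt hr a hmn
  · simpa [h1, h2] using h.filteredPage_other hwt r a h1 h2

end IsPathChart
end DoubleComplex
end

/-! ### Cohomology of a truncated path -/

noncomputable section

section Window

variable {K : Type v} [Field K] {M : Type u} [AddCommGroup M] [Module K M] {Z B : Submodule K M}

/-- Cocycles alternate along the window. At an even end the equation involves a vertex outside,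
where the value is zero, and forces the cocycle to vanish; two odd ends leave one free scalar. -/
theorem subquotient_window_first (ξ : M →ₗ[K] (ℤ → K)) (hξ : Function.Injective ξ) {a b : ℤ}
    (hex : ∀ c : ℤ → K, (∀ i, c i ≠ 0 → a ≤ i ∧ i ≤ b) → ∃ x, ξ x = c)
    (hZ : ∀ x, x ∈ Z ↔ (∀ i, ξ x i ≠ 0 → i % 2 = 1 ∧ a ≤ i ∧ i ≤ b) ∧
      ∀ i, i % 2 = 0 → a ≤ i → i ≤ b → ξ x (i - 1) + ξ x (i + 1) = 0)
    (hB : ∀ x ∈ B, x = 0) :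
    FiniteDimensional K (Z ⧸ B.submoduleOf Z) ∧ Module.finrank K (Z ⧸ B.submoduleOf Z) =
      if a ≤ b ∧ a % 2 = 1 ∧ b % 2 = 1 then 1 else 0 := by
  have hzero : ∀ x ∈ Z, ∀ i, (i < a ∨ b < i) → ξ x i = 0 := fun x hx i hi => by
    by_contra h0
    have := ((hZ x).1 hx).1 i h0
    omega
  have hprop : ∀ x ∈ Z, ∀ i j, i % 2 = 1 → j % 2 = 1 → a - 1 ≤ i → i ≤ j → j ≤ b + 1 →
      (ξ x i = 0 ↔ ξ x j = 0) := fun x hx i j h1 h2 h3 h4 h5 =>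
    alternating_eq_zero_iff h1 h2 h4 fun t h6 h7 h8 =>
      ((hZ x).1 hx).2 t h6 (by omega) (by omega)
  have hx0 : ∀ x ∈ Z, (a % 2 = 1 → b % 2 = 1 → ξ x a = 0) → x = 0 := by
    intro x hx hab
    refine hξ (funext fun i => ?_)
    rw [map_zero, Pi.zero_apply]
    by_contra h0
    have h1 := ((hZ x).1 hx).1 i h0
    by_cases ha : a % 2 = 1
    · by_cases hb : b % 2 = 1
      · exact h0 ((hprop x hx a i ha h1.1 (by omega) (by omega) (by omega)).1 (hab ha hb))
      · exact h0 ((hprop x hx i (b + 1) h1.1 (by omega) (by omega) (by omega) le_rfl).2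
          (hzero x hx _ (by omega)))
    · exact h0 ((hprop x hx (a - 1) i (by omega) h1.1 le_rfl (by omega) (by omega)).1
          (hzero x hx _ (by omega)))
  split_ifs with hc
  · obtain ⟨hab, ha, hb⟩ := hc
    obtain ⟨z, hz⟩ := hex (alternating K a b) fun i hi => by
      have := alternating_ne_zero.1 hi
      omega
    have hz1 : z ∈ Z := by
      rw [hZ, hz]
      refine ⟨fun i hi => ?_, fun i h1 h2 h3 => alternating_add (by omega) (by omega)⟩
      have := alternating_ne_zero.1 hi
      omega
    have hz0 : ξ z a ≠ 0 := by
      rw [hz, alternating_ne_zero]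
      omega
    refine subquotient_eq_one hz1 (fun h => hz0 ?_) fun x hx => ⟨ξ x a / ξ z a, ?_⟩
    · rw [hB z h, map_zero, Pi.zero_apply]
    · rw [hx0 _ (sub_mem hx (Submodule.smul_mem _ _ hz1)) fun _ _ => ?_]
      · exact zero_mem _
      · rw [map_sub, map_smul, Pi.sub_apply, Pi.smul_apply, smul_eq_mul, div_mul_cancel₀ _ hz0,
          sub_self]
  · refine subquotient_eq_zero fun x hx => ?_
    rw [hx0 x hx fun ha hb => hzero x hx a (by omega)]
    exact zero_mem _

/-- Modulo boundaries every element can be moved to the right end `b`. What is left there is a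
boundary exactly when an alternating sequence can absorb it at an odd left end. -/
theorem subquotient_window_second (ξ : M →ₗ[K] (ℤ → K)) {a b : ℤ}
    (hex : ∀ c : ℤ → K, (∀ i, c i ≠ 0 → a ≤ i ∧ i ≤ b) → ∃ x, ξ x = c)
    (hZ : ∀ x, x ∈ Z ↔ ∀ i, ξ x i ≠ 0 → i % 2 = 0 ∧ a ≤ i ∧ i ≤ b)
    (hB : ∀ x, x ∈ B ↔ ∃ y, (∀ i, ξ y i ≠ 0 → i % 2 = 1 ∧ a ≤ i ∧ i ≤ b) ∧
      ∀ i, ξ x i = if i % 2 = 0 ∧ a ≤ i ∧ i ≤ b then ξ y (i - 1) + ξ y (i + 1) else 0) :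
    FiniteDimensional K (Z ⧸ B.submoduleOf Z) ∧ Module.finrank K (Z ⧸ B.submoduleOf Z) =
      if a ≤ b ∧ a % 2 = 0 ∧ b % 2 = 0 then 1 else 0 := by
  have hBZ : B ≤ Z := by
    intro x hx
    obtain ⟨y, -, hy⟩ := (hB x).1 hx
    rw [hZ]
    intro i hi
    rw [hy] at hi
    by_contra h
    exact hi (if_neg h)
  have hBmem : ∀ c : ℤ → K, (∀ i, c i ≠ 0 → i % 2 = 1 ∧ a ≤ i ∧ i ≤ b) → ∃ x ∈ B,
      ∀ i, ξ x i = if i % 2 = 0 ∧ a ≤ i ∧ i ≤ b then c (i - 1) + c (i + 1) else 0 := by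
    intro c hc
    obtain ⟨y, hy⟩ := hex c fun i hi => (hc i hi).2
    obtain ⟨x, hx⟩ := hex (fun i => if i % 2 = 0 ∧ a ≤ i ∧ i ≤ b then c (i - 1) + c (i + 1) else 0)
      fun i hi => by
        by_contra h
        exact hi (if_neg (by omega))
    exact ⟨x, (hB x).2 ⟨y, by rwa [hy], by simp [hx, hy]⟩, by simp [hx]⟩
  have hB0 : ∀ x, (∀ i, ξ x i = 0) → x ∈ B := fun x hx =>
    (hB x).2 ⟨0, fun i hi => (hi (by simp)).elim, fun i => by simp [hx]⟩
  -- Induction on the distance from `b` of the leftmost possible place `j` of the support: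
  -- subtracting the boundary of a multiple of the unit vector at `j + 1` clears the value at `j`
  -- and changes only the one at `j + 2`.
  have key : ∀ (t : ℕ) (x : M), x ∈ Z → (∀ i, ξ x i ≠ 0 → b - t ≤ i) →
      ∃ y ∈ Z, x - y ∈ B ∧ ∀ i, ξ y i ≠ 0 → i = b := by
    intro t
    induction t with
    | zero =>
      intro x hx hs
      refine ⟨x, hx, by rw [sub_self]; exact zero_mem _, fun i hi => ?_⟩
      have := hs i hi
      have := (hZ x).1 hx i hi
      push_cast at *
      omega
    | succ t ih =>
      intro x hx hs
      have hstep : ∀ x' ∈ Z, (∀ i, i < b - (t + 1 : ℕ) → ξ x' i = 0) →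
          ξ x' (b - (t + 1 : ℕ)) = 0 → ∀ i, ξ x' i ≠ 0 → b - t ≤ i := by
        intro x' hx' h1 h2 i hi
        by_contra h3
        obtain h4 | h4 : i < b - (t + 1 : ℕ) ∨ i = b - (t + 1 : ℕ) := by push_cast at *; omega
        · exact hi (h1 i h4)
        · exact hi (h4 ▸ h2)
      have hs' : ∀ i, i < b - (t + 1 : ℕ) → ξ x i = 0 := fun i hi => by
        by_contra h
        have := hs i h
        omega
      set j := b - (t + 1 : ℕ)
      have hjb : j + 1 ≤ b := by simp only [j]; push_cast; omega
      by_cases h0 : ξ x j = 0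
      · exact ih x hx (hstep x hx hs' h0)
      · have hr := (hZ x).1 hx _ h0
        obtain ⟨y, hy, hyi⟩ := hBmem (Pi.single (j + 1) (ξ x j)) fun i hi => by
          have := eq_of_single_ne_zero hi
          omega
        have hxy : x - y ∈ Z := sub_mem hx (hBZ hy)
        obtain ⟨y', hy', h1, h2⟩ := ih (x - y) hxy (hstep _ hxy (fun i hi => by
            rw [map_sub, Pi.sub_apply, hs' i hi, hyi, Pi.single_eq_of_ne (by omega),
              Pi.single_eq_of_ne (by omega)]
            simp) (by
            rw [map_sub, Pi.sub_apply, hyi, if_pos (by omega), Pi.single_eq_of_ne (by omega),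
              Pi.single_eq_same, zero_add, sub_self]))
        refine ⟨y', hy', ?_, h2⟩
        rw [show x - y' = x - y - y' + y by abel]
        exact add_mem h1 hy
  have key' : ∀ x ∈ Z, ∃ y ∈ Z, x - y ∈ B ∧ ∀ i, ξ y i ≠ 0 → i = b := fun x hx =>
    key (b - a).toNat x hx fun i hi => by
      have := (hZ x).1 hx i hi
      omega
  split_ifs with hc
  · obtain ⟨hab, ha, hb⟩ := hc
    obtain ⟨z, hz⟩ := hex (Pi.single b 1) fun i hi => by
      have := eq_of_single_ne_zero hi
      omega
    refine subquotient_eq_one (z := z) ?_ (fun hzB => ?_) fun x hx => ?_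
    · rw [hZ, hz]
      intro i hi
      have := eq_of_single_ne_zero hi
      omega
    · obtain ⟨y, hy, hyi⟩ := (hB z).1 hzB
      have h0 : ∀ i, (i < a ∨ b < i) → ξ y i = 0 := fun i hi => by
        by_contra h
        have := hy i h
        omega
      have h1 : ξ y (b - 1) = 0 := by
        refine (alternating_eq_zero_iff (u := a - 1) (by omega) (by omega) (by omega)
          fun i h1 h2 h3 => ?_).1 (h0 _ (by omega))
        have := hyi i
        rwa [hz, if_pos (by omega), Pi.single_eq_of_ne (by omega), eq_comm] at this
      have h2 := hyi b
      rw [hz, Pi.single_eq_same, if_pos (by omega), h1, h0 _ (by omega), add_zero] at h2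
      exact one_ne_zero h2
    · obtain ⟨y, hy, hxy, hyb⟩ := key' x hx
      refine ⟨ξ y b, ?_⟩
      rw [← sub_add_sub_cancel x y]
      refine add_mem hxy (hB0 _ fun i => ?_)
      rw [map_sub, map_smul, Pi.sub_apply, Pi.smul_apply, hz, smul_eq_mul]
      by_cases hi : i = b
      · rw [hi, Pi.single_eq_same, mul_one, sub_self]
      · rw [Pi.single_eq_of_ne hi, mul_zero, sub_zero]
        by_contra h
        exact hi (hyb i h)
  · refine subquotient_eq_zero fun x hx => ?_
    obtain ⟨y, hy, hxy, hyb⟩ := key' x hx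
    rw [← sub_add_cancel x y]
    refine add_mem hxy ?_
    by_cases hyb0 : ξ y b = 0
    · refine hB0 _ fun i => ?_
      by_contra h
      exact h (hyb i h ▸ hyb0)
    have hb := (hZ y).1 hy b hyb0
    -- Now `b` is even and `a` is odd, so the boundary of the alternating sequence cancels
    -- everywhere except at `b`.
    obtain ⟨z, hz, hzi⟩ := hBmem (alternating K a b) fun i hi => by
      have := alternating_ne_zero.1 hi
      omega
    have h1 : ξ z b ≠ 0 := by
      have h2 : alternating K a b (b + 1) = 0 := by
        by_contra h2
        have := alternating_ne_zero.1 h2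
        omega
      rw [hzi, if_pos hb, h2, add_zero, alternating_ne_zero]
      omega
    rw [← sub_add_cancel y ((ξ y b / ξ z b) • z)]
    refine add_mem (hB0 _ fun i => ?_) (Submodule.smul_mem _ _ hz)
    rw [map_sub, map_smul, Pi.sub_apply, Pi.smul_apply, smul_eq_mul]
    by_cases hi : i = b
    · rw [hi, div_mul_cancel₀ _ h1, sub_self]
    · have h2 : ξ y i = 0 := by
        by_contra h
        exact hi (hyb i h)
      have h3 : ξ z i = 0 := by
        rw [hzi]
        split_ifs with h4
        · exact alternating_add (by omega) (by omega)
        · rfl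
      rw [h2, h3, mul_zero, sub_zero]

end Window
end

/-! ### Bigolin cohomology of a path -/

noncomputable section

namespace DoubleComplex

variable {K : Type v} [Field K] {A : DoubleComplex.{u} K}

/-- The bidegree of the vertex `i` of the infinite zigzag in degrees `k` and `k + 1`. -/
def pathDegree (k i : ℤ) : ℤ × ℤ := (i / 2, k - (i - 1) / 2)

namespace IsPathChart

variable {ξ : A.Total →ₗ[K] (ℤ → K)} {k m n : ℤ}

open scoped Classical in
theorem projOn_apply {β : ℤ → ℤ × ℤ} (h : IsPathChart A ξ k m n β) (T : Set (ℤ × ℤ)) (x : A.Total)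
    (i : ℤ) : ξ (A.projOn T x) i = if β i ∈ T then ξ x i else 0 := by
  have h1 : A.projOn T x ∈ A.supportedOn T := fun i hi => by
    rw [DoubleComplex.projOn_apply, if_neg hi]
  have h2 : x - A.projOn T x ∈ A.supportedOn Tᶜ := fun i hi => by
    change x i - A.projOn T x i = 0
    rw [DoubleComplex.projOn_apply, if_pos (not_not.1 hi), sub_self]
  rw [h.mem_supportedOn] at h1 h2
  split_ifs with hT
  · by_contra h0
    refine h2 i ?_ hT
    rw [map_sub, Pi.sub_apply, sub_ne_zero]
    exact Ne.symm h0
  · by_contra h0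
    exact hT (h1 i h0)

variable {p q κ L R : ℤ}

/-- The bidegrees ≤ (p, q), or those > (p, q), cut the window `[L, R]` out of the infinite zigzag.
The Bigolin degree of its odd vertices is `κ`; in the second case it is one less than the total
degree. -/
theorem mem_bigolinTerm (h : IsPathChart A ξ k m n (pathDegree k))
    (hw : (k ≤ p + q ∧ κ = k ∧ L = 2 * (k - q) + 1 ∧ R = 2 * p + 1) ∨
      (p + q < k ∧ κ = k - 1 ∧ L = 2 * p + 2 ∧ R = 2 * (k - q)))
    {j : ℤ} {x : A.Total} : x ∈ A.bigolinTerm p q j ↔ ∀ i, ξ x i ≠ 0 →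
      ((i % 2 = 1 ∧ j = κ) ∨ (i % 2 = 0 ∧ j = κ + 1)) ∧ max m L ≤ i ∧ i ≤ min n R := by
  rw [bigolinTerm, h.mem_supportedOn]
  refine forall_congr' fun i => imp_congr_right fun hi => ?_
  have h1 := h.le_and_le x i hi
  rw [bigolinSupport, pathDegree]
  split_ifs with h2
  · simp only [Set.mem_ofPred_eq]
    omega
  · simp only [Set.mem_ofPred_eq]
    omega

/-- On a zigzag ∂∂̄ = 0, so all three forms of the differential reduce to the path differential cut
off to the window. -/
theorem bigolinD_apply (h : IsPathChart A ξ k m n (pathDegree k))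
    (hdd : ∀ x, A.delTot (A.delbarTot x) = 0)
    (hw : (k ≤ p + q ∧ κ = k ∧ L = 2 * (k - q) + 1 ∧ R = 2 * p + 1) ∨
      (p + q < k ∧ κ = k - 1 ∧ L = 2 * p + 2 ∧ R = 2 * (k - q)))
    {j : ℤ} {x : A.Total} (hx : x ∈ A.bigolinTerm p q j) (i : ℤ) :
    ξ (A.bigolinD p q j x) i =
      if j = κ ∧ i % 2 = 0 ∧ max m L ≤ i ∧ i ≤ min n R then ξ x (i - 1) + ξ x (i + 1) else 0 := by
  classical
  rw [h.mem_bigolinTerm hw] at hx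
  have h0 : ∀ i, ¬(((i % 2 = 1 ∧ j = κ) ∨ (i % 2 = 0 ∧ j = κ + 1)) ∧ max m L ≤ i ∧ i ≤ min n R) →
      ξ x i = 0 := fun i hi => by
    by_contra h1
    exact hi (hx i h1)
  unfold bigolinD
  split_ifs with h1 h2 h2 h3 h3
  · rw [LinearMap.comp_apply, h.projOn_apply, h.dTot, if_pos, if_pos (by omega)]
    simp only [pathDegree, Set.mem_ofPred_eq]
    omega
  · rw [LinearMap.comp_apply, h.projOn_apply, h.dTot]
    split_ifs with h4 h5
    · simp only [pathDegree, Set.mem_ofPred_eq] at h4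
      rw [h0 _ (by omega), h0 _ (by omega), add_zero]
    · rfl
    · rfl
  · rw [LinearMap.comp_apply, hdd, map_zero, Pi.zero_apply, h0 _ (by omega), h0 _ (by omega),
      add_zero]
  · rw [LinearMap.comp_apply, hdd, map_zero, Pi.zero_apply]
  · rw [h.dTot, if_pos (by omega)]
  · rw [h.dTot]
    split_ifs with h4
    · rw [h0 _ (by omega), h0 _ (by omega), add_zero]
    · rfl

theorem bigolinCohomology (h : IsPathChart A ξ k m n (pathDegree k))
    (hdd : ∀ x, A.delTot (A.delbarTot x) = 0)
    (hw : (k ≤ p + q ∧ κ = k ∧ L = 2 * (k - q) + 1 ∧ R = 2 * p + 1) ∨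
      (p + q < k ∧ κ = k - 1 ∧ L = 2 * p + 2 ∧ R = 2 * (k - q))) (j : ℤ) :
    FiniteDimensional K (A.BigolinCohomology p q j) ∧
      Module.finrank K (A.BigolinCohomology p q j) =
        if max m L ≤ min n R ∧ ((max m L % 2 = 1 ∧ min n R % 2 = 1 ∧ j = κ) ∨
          (max m L % 2 = 0 ∧ min n R % 2 = 0 ∧ j = κ + 1)) then 1 else 0 := by
  have hex : ∀ c : ℤ → K, (∀ i, c i ≠ 0 → max m L ≤ i ∧ i ≤ min n R) → ∃ x, ξ x = c :=
    fun c hc => h.exists_eq c fun i hi => by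
      have := hc i hi
      omega
  have hD := fun {j x} => h.bigolinD_apply hdd hw (j := j) (x := x)
  have hT := fun {j x} => h.mem_bigolinTerm hw (j := j) (x := x)
  have hZ : ∀ {j x}, x ∈ A.bigolinCocycles p q j ↔ x ∈ A.bigolinTerm p q j ∧
      ∀ i, j = κ → i % 2 = 0 → max m L ≤ i → i ≤ min n R → ξ x (i - 1) + ξ x (i + 1) = 0 := by
    intro j x
    rw [bigolinCocycles, Submodule.mem_inf, LinearMap.mem_ker]
    refine and_congr_right fun hx => ⟨fun h1 i h2 h3 h4 h5 => ?_, fun h1 => h.injective ?_⟩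
    · have := hD hx i
      rwa [h1, map_zero, Pi.zero_apply, if_pos ⟨h2, h3, h4, h5⟩, eq_comm] at this
    · refine funext fun i => ?_
      rw [hD hx, map_zero, Pi.zero_apply]
      split_ifs with h2
      · exact h1 i h2.1 h2.2.1 h2.2.2.1 h2.2.2.2
      · rfl
  by_cases h1 : j = κ
  · subst h1
    have := subquotient_window_first (Z := A.bigolinCocycles p q j)
      (B := A.bigolinCoboundaries p q j) ξ h.injective hex (fun x => by
        rw [hZ, hT]
        refine and_congr (forall_congr' fun i => imp_congr_right fun _ => by omega) ?_
        simp) (by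
        rintro _ ⟨y, hy, rfl⟩
        refine h.injective (funext fun i => ?_)
        rw [hD hy, if_neg (by omega), map_zero, Pi.zero_apply])
    simpa using this
  by_cases h2 : j = κ + 1
  · subst h2
    have := subquotient_window_second (Z := A.bigolinCocycles p q (κ + 1))
      (B := A.bigolinCoboundaries p q (κ + 1)) ξ hex (fun x => by
        rw [hZ, hT]
        simp) (fun x => by
        rw [bigolinCoboundaries, Submodule.mem_map]
        refine exists_congr fun y => ?_
        rw [hT]
        constructor
        · rintro ⟨h3, rfl⟩
          refine ⟨fun i hi => ?_, fun i => ?_⟩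
          · have := h3 i hi
            omega
          · rw [hD (hT.2 h3)]
            simp
        · rintro ⟨h3, h4⟩
          have h5 : ∀ i, ξ y i ≠ 0 → ((i % 2 = 1 ∧ κ + 1 - 1 = κ) ∨
              (i % 2 = 0 ∧ κ + 1 - 1 = κ + 1)) ∧ max m L ≤ i ∧ i ≤ min n R := fun i hi => by
            have := h3 i hi
            omega
          refine ⟨h5, h.injective (funext fun i => ?_)⟩
          rw [hD (hT.2 h5), h4]
          simp)
    simpa using this
  · have := subquotient_eq_zero (Z := A.bigolinCocycles p q j) (B := A.bigolinCoboundaries p q j)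
      fun x hx => by
        have h3 := hT.1 (hZ.1 hx).1
        have : x = 0 := h.injective (funext fun i => by
          rw [map_zero]
          by_contra hi
          have := h3 i hi
          omega)
        rw [this]
        exact zero_mem _
    simpa [h1, h2] using this

end IsPathChart
end DoubleComplex
end

/-! ### Path coordinates on the zigzag models -/

noncomputable section

namespace DoubleComplex

variable {K : Type v} [Field K]

/-- Reading a path backwards exchanges the roles of the two degrees, so the computation of the pages
also covers the conjugate spectral sequence, with weight offset `k + 1`. -/
theorem IsPathChart.reverse {A : DoubleComplex.{u} K} {ξ : A.Total →ₗ[K] (ℤ → K)} {k m n : ℤ}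
    {β : ℤ → ℤ × ℤ} (h : IsPathChart A ξ k m n β) :
    IsPathChart A (LinearMap.funLeft K K (fun i : ℤ => -i) ∘ₗ ξ) k (-n) (-m) fun i => β (-i) where
  le_and_le x i hi := by
    have := h.le_and_le x (-i) hi
    omega
  exists_eq c hc := by
    obtain ⟨x, hx⟩ := h.exists_eq (fun i => c (-i)) fun i hi => by
      have := hc (-i) hi
      omega
    refine ⟨x, funext fun i => ?_⟩
    change ξ x (-i) = c i
    rw [hx]
    exact congrArg c (neg_neg i)
  dTot x i := by
    change ξ (A.dTot x) (-i) = if _ then ξ x (-(i - 1)) + ξ x (-(i + 1)) else 0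
    rw [h.dTot, show -(i - 1) = -i + 1 by ring, show -(i + 1) = -i - 1 by ring, add_comm]
    exact if_congr (by omega) rfl rfl
  mem_supportedOn T x := by
    rw [h.mem_supportedOn]
    constructor
    · exact fun h1 i hi => h1 (-i) hi
    · intro h1 i hi
      have := h1 (-i) (by change ξ x (- -i) ≠ 0; rwa [neg_neg])
      rwa [neg_neg] at this
  degree i := by
    rw [h.degree]
    exact if_congr (by omega) rfl rfl

end DoubleComplex

namespace Shape

open DoubleComplex

variable {K : Type v} [Field K] {S : Shape}

/-- The coordinates along a zigzag in degrees `k` and `k + 1`. -/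
def pathVal (S : Shape) (k : ℤ) : (S.model K).Total →ₗ[K] (ℤ → K) where
  toFun x i := val x (pathDegree k i).1 (pathDegree k i).2
  map_add' _ _ := rfl
  map_smul' _ _ := rfl

theorem pathVal_apply (k : ℤ) (x : (S.model K).Total) (i : ℤ) :
    pathVal S k x i = val x (i / 2) (k - (i - 1) / 2) := rfl

theorem finite_pathSupport (k m n : ℤ) : (pathSupport k m n).Finite := by
  refine (Set.Finite.prod (Set.finite_Icc (m / 2 - 1) (n / 2 + 1))
    (Set.finite_Icc (k - n / 2 - 1) (k + 1 - m / 2 + 1))).subset ?_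
  rintro ⟨r, s⟩ h
  simp only [pathSupport, Set.mem_ofPred_eq] at h
  simp only [Set.mem_prod, Set.mem_Icc]
  omega

theorem isPathChart_pathVal (hS : S.IsZigzag) {k m n : ℤ} (hsupp : S.support = pathSupport k m n) :
    IsPathChart (S.model K) (pathVal S k) k m n (pathDegree k) := by
  have hmem : ∀ r s, (r, s) ∈ S.support ↔ (r + s = k ∧ m ≤ 2 * r + 1 ∧ 2 * r + 1 ≤ n) ∨
      (r + s = k + 1 ∧ m ≤ 2 * r ∧ 2 * r ≤ n) := fun r s => by rw [hsupp]; rfl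
  have hval : ∀ (x : (S.model K).Total) r s, val x r s ≠ 0 →
      (r + s = k ∧ m ≤ 2 * r + 1 ∧ 2 * r + 1 ≤ n) ∨ (r + s = k + 1 ∧ m ≤ 2 * r ∧ 2 * r ≤ n) :=
    fun x r s h0 => by
      rw [← hmem]
      by_contra h
      exact h0 (val_eq_zero x h)
  refine ⟨fun x i hi => ?_, fun c hc => ?_, fun x i => ?_, fun T x => ?_, fun i => ?_⟩
  · have := hval x _ _ hi
    simp only [pathDegree] at this
    omega
  · obtain ⟨x, hx⟩ := exists_val_eq (K := K) (S := S) (hsupp ▸ finite_pathSupport k m n)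
      (fun r s => if r + s = k then c (2 * r + 1) else if r + s = k + 1 then c (2 * r) else 0)
      fun r s h => by
        rw [hmem] at h
        split_ifs with h1 h2
        · by_contra h0
          have := hc _ h0
          omega
        · by_contra h0
          have := hc _ h0
          omega
        · rfl
    refine ⟨x, funext fun i => ?_⟩
    rw [pathVal_apply, hx]
    dsimp only
    split_ifs
    · congr 1
      omega
    · congr 1
      omega
    · omega
  · classical
    simp only [pathVal_apply]
    rw [val_dTot, sign_eq_one K hS, one_mul]
    by_cases hi : i % 2 = 0
    · rw [show (i - 1 - 1) / 2 = (i - 1) / 2 by omega, show (i - 1) / 2 = i / 2 - 1 by omega,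
        show (i + 1) / 2 = i / 2 by omega, show (i + 1 - 1) / 2 = i / 2 - 1 + 1 by omega,
        show k - (i / 2 - 1) - 1 = k - (i / 2 - 1 + 1) by ring]
      refine if_congr ?_ rfl rfl
      rw [hmem]
      omega
    · rw [if_neg (c := i % 2 = 0 ∧ _) (by omega)]
      split_ifs with h
      · have h1 : ∀ r s, r + s = k - 1 → val x r s = 0 := fun r s h1 => by
          by_contra h0
          have := hval x r s h0
          omega
        rw [h1 _ _ (by omega), h1 _ _ (by omega), add_zero]
      · rfl
  · rw [mem_supportedOn_iff]
    constructor
    · exact fun h i hi => h _ _ hi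
    · intro h r s h0
      rcases hval x r s h0 with h1 | h1
      · have := h (2 * r + 1)
        rw [pathVal_apply, pathDegree, show (2 * r + 1) / 2 = r by omega,
          show k - (2 * r + 1 - 1) / 2 = s by omega] at this
        exact this h0
      · have := h (2 * r)
        rw [pathVal_apply, pathDegree, show (2 * r) / 2 = r by omega,
          show k - (2 * r - 1) / 2 = s by omega] at this
        exact this h0
  · simp only [pathDegree]
    split_ifs <;> omega

theorem delTot_delbarTot_eq_zero (hS : S.IsZigzag) (x : (S.model K).Total) :
    (S.model K).delTot ((S.model K).delbarTot x) = 0 := by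
  refine val_ext fun r s => ?_
  rw [val_delTot, val_delbarTot, map_zero, Pi.zero_apply, Pi.zero_apply]
  split_ifs with h1 h2
  · rw [val_eq_zero x, mul_zero]
    intro h3
    have := degree_lt hS h3 h1
    omega
  · rfl
  · rfl

theorem ofPath_eq_odd_iff {k m n : ℤ} {p q j : ℤ} : ofPath k m n = odd p q j ↔
    (m % 2 = 1 ∧ n % 2 = 1 ∧ j = k ∧ m = 2 * p + 1 ∧ n = 2 * (k - q) + 1) ∨
    (m % 2 = 0 ∧ n % 2 = 0 ∧ j = k + 1 ∧ n = 2 * p ∧ m = 2 * (k + 1 - q)) := by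
  unfold ofPath
  split_ifs
  · rw [odd.injEq]
    omega
  · exact iff_of_false nofun (by omega)
  · exact iff_of_false nofun (by omega)
  · rw [odd.injEq]
    omega

theorem ofPath_eq_evenH_iff {k m n : ℤ} (h : m ≤ n) {p q : ℤ} {l : ℕ+} :
    ofPath k m n = evenH p q l ↔ m = 2 * p + 1 ∧ n = 2 * (p + l) ∧ k = p + q := by
  have := l.pos
  unfold ofPath
  split_ifs
  · exact iff_of_false nofun (by omega)
  · rw [evenH.injEq, ← PNat.coe_inj, Nat.succPNat_coe]
    omega
  · exact iff_of_false nofun (by omega)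
  · exact iff_of_false nofun (by omega)

theorem ofPath_eq_evenV_iff {k m n : ℤ} (h : m ≤ n) {p q : ℤ} {l : ℕ+} :
    ofPath k m n = evenV p q l ↔ m = 2 * (p - l + 1) ∧ n = 2 * p + 1 ∧ k = p + q := by
  have := l.pos
  unfold ofPath
  split_ifs
  · exact iff_of_false nofun (by omega)
  · exact iff_of_false nofun (by omega)
  · rw [evenV.injEq, ← PNat.coe_inj, Nat.succPNat_coe]
    omega
  · exact iff_of_false nofun (by omega)

theorem exists_ofPath (hS : S.IsZigzag) : ∃ k m n, m ≤ n ∧ S = ofPath k m n := by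
  cases S with
  | square p q => exact hS.elim
  | odd p q k =>
    by_cases h : p + q ≤ k
    · exact ⟨k, 2 * p + 1, 2 * (k - q) + 1, by omega, (ofPath_eq_odd_iff.2 (by omega)).symm⟩
    · exact ⟨k - 1, 2 * (k - q), 2 * p, by omega, (ofPath_eq_odd_iff.2 (by omega)).symm⟩
  | evenH p q l =>
    have := l.pos
    exact ⟨p + q, 2 * p + 1, 2 * (p + l), by omega, ((ofPath_eq_evenH_iff (by omega)).2
      (by omega)).symm⟩
  | evenV p q l =>
    have := l.pos
    exact ⟨p + q, 2 * (p - l + 1), 2 * p + 1, by omega, ((ofPath_eq_evenV_iff (by omega)).2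
      (by omega)).symm⟩

section ofPath

variable (K) {k m n : ℤ} (hmn : m ≤ n)
include hmn

theorem bigolinCohomology_ofPath_low {p q : ℤ} (hpq : k ≤ p + q) (j : ℤ) :
    FiniteDimensional K (((ofPath k m n).model K).BigolinCohomology p q j) ∧
    ((ofPath k m n).model K).bigolinNumber p q j =
      if max m (2 * (k - q) + 1) ≤ min n (2 * p + 1) ∧
        ((max m (2 * (k - q) + 1) % 2 = 1 ∧ min n (2 * p + 1) % 2 = 1 ∧ j = k) ∨
          (max m (2 * (k - q) + 1) % 2 = 0 ∧ min n (2 * p + 1) % 2 = 0 ∧ j = k + 1))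
      then 1 else 0 :=
  (isPathChart_pathVal (isZigzag_ofPath k m n) (support_ofPath hmn)).bigolinCohomology
    (delTot_delbarTot_eq_zero (isZigzag_ofPath k m n)) (Or.inl ⟨hpq, rfl, rfl, rfl⟩) j

theorem bigolinCohomology_ofPath_high {p q : ℤ} (hpq : p + q < k) (j : ℤ) :
    FiniteDimensional K (((ofPath k m n).model K).BigolinCohomology p q j) ∧
    ((ofPath k m n).model K).bigolinNumber p q j =
      if max m (2 * p + 2) ≤ min n (2 * (k - q)) ∧
        ((max m (2 * p + 2) % 2 = 1 ∧ min n (2 * (k - q)) % 2 = 1 ∧ j = k - 1) ∨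
          (max m (2 * p + 2) % 2 = 0 ∧ min n (2 * (k - q)) % 2 = 0 ∧ j = k - 1 + 1))
      then 1 else 0 :=
  (isPathChart_pathVal (isZigzag_ofPath k m n) (support_ofPath hmn)).bigolinCohomology
    (delTot_delbarTot_eq_zero (isZigzag_ofPath k m n)) (Or.inr ⟨hpq, rfl, rfl, rfl⟩) j

theorem frolicherPage_ofPath {r : ℕ} (hr : 1 ≤ r) (p q : ℤ) :
    FiniteDimensional K (((ofPath k m n).model K).FrolicherPage r p q) ∧
    Module.finrank K (((ofPath k m n).model K).FrolicherPage r p q) =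
      if (p + q = k ∧ m = 2 * (p - 0) + 1 ∧ (n % 2 = 1 ∨ 2 * (p - 0 + r) ≤ n)) ∨
        (p + q = k + 1 ∧ n = 2 * (p - 0) ∧ (m % 2 = 0 ∨ m ≤ 2 * (p - 0 - r) + 1)) then 1 else 0 :=
  (isPathChart_pathVal (isZigzag_ofPath k m n) (support_ofPath hmn)).filteredPage
    (fun i => (zero_add _).symm) (by omega) p (p + q) hmn

theorem conjFrolicherPage_ofPath {r : ℕ} (hr : 1 ≤ r) (p q : ℤ) :
    FiniteDimensional K (((ofPath k m n).model K).ConjFrolicherPage r p q) ∧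
    Module.finrank K (((ofPath k m n).model K).ConjFrolicherPage r p q) =
      if (p + q = k ∧ -n = 2 * (q - (k + 1)) + 1 ∧ (-m % 2 = 1 ∨ 2 * (q - (k + 1) + r) ≤ -m)) ∨
        (p + q = k + 1 ∧ -m = 2 * (q - (k + 1)) ∧ (-n % 2 = 0 ∨ -n ≤ 2 * (q - (k + 1) - r) + 1))
      then 1 else 0 :=
  (isPathChart_pathVal (isZigzag_ofPath k m n) (support_ofPath hmn)).reverse.filteredPage
    (fun i => by simp only [pathDegree]; omega) (by omega) q (p + q) (by omega)

end ofPath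

variable (K) (hS : S.IsZigzag)
include hS

theorem finiteDimensional_bigolinCohomology (p q j : ℤ) :
    FiniteDimensional K ((S.model K).BigolinCohomology p q j) := by
  obtain ⟨k, m, n, hmn, rfl⟩ := exists_ofPath hS
  obtain h | h := le_or_gt k (p + q)
  · exact (bigolinCohomology_ofPath_low K hmn h j).1
  · exact (bigolinCohomology_ofPath_high K hmn h j).1

theorem finiteDimensional_frolicherPage {r : ℕ} (hr : 1 ≤ r) (p q : ℤ) :
    FiniteDimensional K ((S.model K).FrolicherPage r p q) := by
  obtain ⟨k, m, n, hmn, rfl⟩ := exists_ofPath hS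
  exact (frolicherPage_ofPath K hmn hr p q).1

theorem finiteDimensional_conjFrolicherPage {r : ℕ} (hr : 1 ≤ r) (p q : ℤ) :
    FiniteDimensional K ((S.model K).ConjFrolicherPage r p q) := by
  obtain ⟨k, m, n, hmn, rfl⟩ := exists_ofPath hS
  exact (conjFrolicherPage_ofPath K hmn hr p q).1

open scoped Classical in
-- On zigzags the differential of E_r is nonzero only between the two ends of horizontal zigzags
-- with `l = r`. The two shapes are those with first, respectively last, component `(p, q)`.
theorem finrank_frolicherPage (r : ℕ+) (p q : ℤ) :
    Module.finrank K ((S.model K).FrolicherPage r p q) =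
      Module.finrank K ((S.model K).FrolicherPage (r + 1) p q) +
        (if S = evenH p q r then 1 else 0) +
        (if S = evenH (p - r) (q + r - 1) r then 1 else 0) := by
  obtain ⟨k, m, n, hmn, rfl⟩ := exists_ofPath hS
  have := r.pos
  rw [(frolicherPage_ofPath K hmn r.pos p q).2,
    (frolicherPage_ofPath K hmn (r := r + 1) (by omega) p q).2]
  simp only [ofPath_eq_evenH_iff hmn]
  push_cast
  split_ifs <;> omega

open scoped Classical in
theorem finrank_conjFrolicherPage (r : ℕ+) (p q : ℤ) :
    -- The second shape is the vertical zigzag whose topmost component is `(p, q)`.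
    Module.finrank K ((S.model K).ConjFrolicherPage r p q) =
      Module.finrank K ((S.model K).ConjFrolicherPage (r + 1) p q) +
        (if S = evenV p q r then 1 else 0) +
        (if S = evenV (p + r - 1) (q - r) r then 1 else 0) := by
  obtain ⟨k, m, n, hmn, rfl⟩ := exists_ofPath hS
  have := r.pos
  rw [(conjFrolicherPage_ofPath K hmn r.pos p q).2,
    (conjFrolicherPage_ofPath K hmn (r := r + 1) (by omega) p q).2]
  simp only [ofPath_eq_evenV_iff hmn]
  push_cast
  split_ifs <;> omega

end Shape
end

/-! ### Second differences of Bigolin numbers -/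

noncomputable section

namespace Shape

open DoubleComplex

variable (K : Type v) [Field K] {S : Shape} {k m n : ℤ}

theorem bigolinNumber_ofPath_odd_odd (hmn : m ≤ n) (hm : m % 2 = 1) (hn : n % 2 = 1) (p q j : ℤ) :
    ((ofPath k m n).model K).bigolinNumber p q j =
      if (j = k ∧ m ≤ 2 * p + 1 ∧ 2 * (k - q) + 1 ≤ n) ∨
        (j = k - 1 ∧ 2 * p + 3 ≤ m ∧ n ≤ 2 * (k - q) - 1) then 1 else 0 := by
  obtain h | h := le_or_gt k (p + q)
  · rw [(bigolinCohomology_ofPath_low K hmn h j).2]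
    exact if_congr (by omega) rfl rfl
  · rw [(bigolinCohomology_ofPath_high K hmn h j).2]
    exact if_congr (by omega) rfl rfl

theorem bigolinNumber_ofPath_even_even (hmn : m ≤ n) (hm : m % 2 = 0) (hn : n % 2 = 0)
    (p q j : ℤ) : ((ofPath k m n).model K).bigolinNumber p q j =
      if (j = k + 1 ∧ 2 * (k - q) + 2 ≤ m ∧ n ≤ 2 * p) ∨
        (j = k ∧ m ≤ 2 * (k - q) ∧ 2 * p + 2 ≤ n) then 1 else 0 := by
  obtain h | h := le_or_gt k (p + q)
  · rw [(bigolinCohomology_ofPath_low K hmn h j).2]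
    exact if_congr (by omega) rfl rfl
  · rw [(bigolinCohomology_ofPath_high K hmn h j).2]
    exact if_congr (by omega) rfl rfl

theorem bigolinNumber_ofPath_odd_even (hmn : m ≤ n) (hm : m % 2 = 1) (hn : n % 2 = 0)
    (p q j : ℤ) : ((ofPath k m n).model K).bigolinNumber p q j =
      if j = k ∧ m ≤ 2 * p + 1 ∧ 2 * p + 2 ≤ n then 1 else 0 := by
  obtain h | h := le_or_gt k (p + q)
  · rw [(bigolinCohomology_ofPath_low K hmn h j).2]
    exact if_congr (by omega) rfl rfl
  · rw [(bigolinCohomology_ofPath_high K hmn h j).2]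
    exact if_congr (by omega) rfl rfl

theorem bigolinNumber_ofPath_even_odd (hmn : m ≤ n) (hm : m % 2 = 0) (hn : n % 2 = 1)
    (p q j : ℤ) : ((ofPath k m n).model K).bigolinNumber p q j =
      if j = k ∧ m ≤ 2 * (k - q) ∧ 2 * (k - q) + 1 ≤ n then 1 else 0 := by
  obtain h | h := le_or_gt k (p + q)
  · rw [(bigolinCohomology_ofPath_low K hmn h j).2]
    exact if_congr (by omega) rfl rfl
  · rw [(bigolinCohomology_ofPath_high K hmn h j).2]
    exact if_congr (by omega) rfl rfl

open scoped Classical in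
-- For an even zigzag the Bigolin number depends on `p` alone or on `q` alone and its mixed
-- difference vanishes. For an odd zigzag with parameters (p₀, q₀, k) it is the indicator of p ≥ p₀,
-- q ≥ q₀ in degree k and of p < p₀, q < q₀ in degree k − 1. Both have mixed difference 1 at (p₀,
-- q₀) and 0 elsewhere.
theorem bigolinTilde_model (hS : S.IsZigzag) (p q j : ℤ) : (S.model K).bigolinTilde p q j =
    (if S = odd p q (j + 1) then 1 else 0) + (if S = odd p q j then 1 else 0) := by
  obtain ⟨k, m, n, hmn, rfl⟩ := exists_ofPath hS
  unfold bigolinTilde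
  simp only [ofPath_eq_odd_iff]
  rcases Int.emod_two_eq_zero_or_one m with hm | hm <;>
    rcases Int.emod_two_eq_zero_or_one n with hn | hn
  · simp only [bigolinNumber_ofPath_even_even K hmn hm hn]
    by_cases h1 : j = k
    · have h2 : j ≠ k + 1 := by omega
      simp only [h1, hm, hn, left_eq_add, one_ne_zero, zero_ne_one, false_and, true_and, false_or]
      push_cast
      split_ifs <;> omega
    by_cases h2 : j = k + 1
    · simp only [h2, hm, hn, add_eq_left, one_ne_zero, zero_ne_one, false_and, true_and, or_false,
        false_or]
      push_cast
      split_ifs <;> omega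
    · simp [h1, h2, hm]
  · simp [bigolinNumber_ofPath_even_odd K hmn hm hn, hm, hn]
  · simp [bigolinNumber_ofPath_odd_even K hmn hm hn, hm, hn]
  · simp only [bigolinNumber_ofPath_odd_odd K hmn hm hn]
    by_cases h1 : j = k
    · have h2 : k ≠ k - 1 := by omega
      simp only [h1, h2, hm, hn, add_eq_left, one_ne_zero, false_and, true_and, or_false]
      push_cast
      split_ifs <;> omega
    by_cases h2 : j = k - 1
    · have h3 : k - 1 ≠ k := by omega
      simp only [h2, h3, hm, hn, sub_add_cancel, one_ne_zero, false_and, true_and, or_false,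
        false_or]
      push_cast
      split_ifs <;> omega
    · have h3 : j + 1 ≠ k := by omega
      simp [h1, h2, h3, hm]

end Shape
end

/-! ### Multiplicities from numerical invariants -/

noncomputable section

namespace Shape

theorem exists_eq_square {S : Shape} (hS : ¬S.IsZigzag) :
    ∃ i : ℤ × ℤ, S = square i.1 i.2 := by
  cases S with
  | square a b => exact ⟨(a, b), rfl⟩
  | _ => exact (hS trivial).elim

end Shape

theorem Module.finite_and_finrank_eq_sum {K : Type v} [Field K] {ι : Type w} (s : Finset ι)
    {M : Type u} [AddCommGroup M] [Module K M] {N : ι → Type w'} [∀ i, AddCommGroup (N i)]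
    [∀ i, Module K (N i)] (hN : ∀ i ∈ s, FiniteDimensional K (N i))
    (e : Nonempty (M ≃ₗ[K] ∀ i : s, N i)) :
    FiniteDimensional K M ∧ Module.finrank K M = ∑ i ∈ s, Module.finrank K (N i) := by
  obtain ⟨e⟩ := e
  have : ∀ i : s, FiniteDimensional K (N i) := fun i => hN i i.2
  refine ⟨Module.Finite.equiv e.symm, ?_⟩
  rw [e.finrank_eq, Module.finrank_pi_fintype, Finset.sum_coe_sort s fun i => Module.finrank K (N i)]

namespace DoubleComplex

variable {K : Type v} [Field K] {A : DoubleComplex.{u} K}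

namespace Decomposition

variable (D : Decomposition A)

/-- The indices of the zigzags in a decomposition. -/
def zigzags (h : {i | (D.shape i).IsZigzag}.Finite) : Finset D.ι := h.toFinset

variable (h : {i | (D.shape i).IsZigzag}.Finite)

theorem mem_zigzags {i : D.ι} : i ∈ D.zigzags h ↔ (D.shape i).IsZigzag := by
  simp [zigzags]

theorem bigolinNumber_eq_sum (p q k : ℤ) : FiniteDimensional K (A.BigolinCohomology p q k) ∧
    A.bigolinNumber p q k = ∑ i ∈ D.zigzags h, ((D.shape i).model K).bigolinNumber p q k := by
  refine Module.finite_and_finrank_eq_sum (D.zigzags h) (fun i hi =>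
    Shape.finiteDimensional_bigolinCohomology K ((D.mem_zigzags h).1 hi) p q k)
    (D.bigolinCohomology_equiv p q k _ fun i hi => ?_)
  obtain ⟨⟨a, b⟩, hab⟩ := Shape.exists_eq_square (mt (D.mem_zigzags h).2 hi)
  rw [hab]
  exact Shape.bigolinCocycles_le_square a b p q k

theorem finrank_frolicherPage_eq_sum {r : ℕ} (hr : 1 ≤ r) (p q : ℤ) :
    FiniteDimensional K (A.FrolicherPage r p q) ∧ Module.finrank K (A.FrolicherPage r p q) =
      ∑ i ∈ D.zigzags h, Module.finrank K (((D.shape i).model K).FrolicherPage r p q) := by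
  refine Module.finite_and_finrank_eq_sum (D.zigzags h) (fun i hi =>
    Shape.finiteDimensional_frolicherPage K ((D.mem_zigzags h).1 hi) hr p q)
    (D.filteredPage_equiv Prod.fst r p (p + q) _ fun i hi => ?_)
  obtain ⟨⟨a, b⟩, hab⟩ := Shape.exists_eq_square (mt (D.mem_zigzags h).2 hi)
  rw [hab]
  exact Shape.filteredCycles_fst_le_square a b (by omega) p (p + q)

theorem finrank_conjFrolicherPage_eq_sum {r : ℕ} (hr : 1 ≤ r) (p q : ℤ) :
    FiniteDimensional K (A.ConjFrolicherPage r p q) ∧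
    Module.finrank K (A.ConjFrolicherPage r p q) =
      ∑ i ∈ D.zigzags h, Module.finrank K (((D.shape i).model K).ConjFrolicherPage r p q) := by
  refine Module.finite_and_finrank_eq_sum (D.zigzags h) (fun i hi =>
    Shape.finiteDimensional_conjFrolicherPage K ((D.mem_zigzags h).1 hi) hr p q)
    (D.filteredPage_equiv Prod.snd r q (p + q) _ fun i hi => ?_)
  obtain ⟨⟨a, b⟩, hab⟩ := Shape.exists_eq_square (mt (D.mem_zigzags h).2 hi)
  rw [hab]
  exact Shape.filteredCycles_snd_le_square a b (by omega) q (p + q)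

open scoped Classical in
theorem sum_ite_eq_mult {S : Shape} (hS : S.IsZigzag) :
    ∑ i ∈ D.zigzags h, (if D.shape i = S then 1 else 0) = D.mult S := by
  rw [Finset.sum_boole, Nat.cast_id, mult, ← Set.ncard_coe_finset]
  congr 1
  ext i
  simp only [Finset.coe_filter, mem_zigzags, Set.mem_ofPred_eq, and_iff_right_iff_imp]
  rintro rfl
  exact hS

include h

theorem finite_mult_ne_zero (φ : Shape → ℤ) :
    {t | ∃ S : Shape, S.IsZigzag ∧ φ S = t ∧ D.mult S ≠ 0}.Finite := by
  refine ((D.zigzags h).image fun i => φ (D.shape i)).finite_toSet.subset ?_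
  rintro _ ⟨S, hS, rfl, hm⟩
  obtain ⟨i, hi⟩ := Set.nonempty_of_ncard_ne_zero hm
  rw [Set.mem_ofPred_eq] at hi
  rw [Finset.coe_image]
  exact ⟨i, (D.mem_zigzags h).2 (hi ▸ hS), congrArg φ hi⟩

/-- Gives the starting point of the telescoping sum, with `φ` the total degree, and of the
inductions on even zigzags, with `φ` a coordinate of the initial component. -/
theorem exists_mult_eq_zero (φ : Shape → ℤ) :
    ∃ N : ℤ, ∀ S : Shape, S.IsZigzag → φ S < N → D.mult S = 0 := by
  obtain ⟨N, hN⟩ := (D.finite_mult_ne_zero h φ).bddBelow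
  refine ⟨N, fun S hS hlt => ?_⟩
  by_contra h0
  exact (hN ⟨S, hS, rfl, h0⟩).not_gt hlt

theorem bigolinTilde_eq (p q k : ℤ) : A.bigolinTilde p q k =
    D.mult (.odd p q (k + 1)) + D.mult (.odd p q k) := by
  classical
  have : A.bigolinTilde p q k =
      ∑ i ∈ D.zigzags h, ((D.shape i).model K).bigolinTilde p q k := by
    simp only [bigolinTilde, (D.bigolinNumber_eq_sum h _ _ _).2, Finset.sum_add_distrib,
      Finset.sum_sub_distrib, Nat.cast_sum]
  rw [this, ← D.sum_ite_eq_mult h (S := .odd p q (k + 1)) trivial,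
    ← D.sum_ite_eq_mult h (S := .odd p q k) trivial]
  push_cast
  rw [← Finset.sum_add_distrib]
  exact Finset.sum_congr rfl fun i hi =>
    Shape.bigolinTilde_model K ((D.mem_zigzags h).1 hi) p q k

theorem finrank_frolicherPage_eq (r : ℕ+) (p q : ℤ) :
    Module.finrank K (A.FrolicherPage r p q) = Module.finrank K (A.FrolicherPage (r + 1) p q) +
      D.mult (.evenH p q r) + D.mult (.evenH (p - r) (q + r - 1) r) := by
  classical
  rw [(D.finrank_frolicherPage_eq_sum h r.pos p q).2,
    (D.finrank_frolicherPage_eq_sum h (r := r + 1) (by omega) p q).2,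
    ← D.sum_ite_eq_mult h (S := .evenH p q r) trivial,
    ← D.sum_ite_eq_mult h (S := .evenH (p - r) (q + r - 1) r) trivial,
    ← Finset.sum_add_distrib, ← Finset.sum_add_distrib]
  exact Finset.sum_congr rfl fun i hi =>
    Shape.finrank_frolicherPage K ((D.mem_zigzags h).1 hi) r p q

theorem finrank_conjFrolicherPage_eq (r : ℕ+) (p q : ℤ) :
    Module.finrank K (A.ConjFrolicherPage r p q) =
      Module.finrank K (A.ConjFrolicherPage (r + 1) p q) +
      D.mult (.evenV p q r) + D.mult (.evenV (p + r - 1) (q - r) r) := by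
  classical
  rw [(D.finrank_conjFrolicherPage_eq_sum h r.pos p q).2,
    (D.finrank_conjFrolicherPage_eq_sum h (r := r + 1) (by omega) p q).2,
    ← D.sum_ite_eq_mult h (S := .evenV p q r) trivial,
    ← D.sum_ite_eq_mult h (S := .evenV (p + r - 1) (q - r) r) trivial,
    ← Finset.sum_add_distrib, ← Finset.sum_add_distrib]
  exact Finset.sum_congr rfl fun i hi =>
    Shape.finrank_conjFrolicherPage K ((D.mem_zigzags h).1 hi) r p q

theorem finite_bigolinTilde_ne_zero (p q k : ℤ) :
    {j : ℕ | A.bigolinTilde p q (k - j) ≠ 0}.Finite ∧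
      ∑ᶠ j : ℕ, (-1) ^ j * A.bigolinTilde p q (k - j) = (D.mult (.odd p q (k + 1)) : ℤ) := by
  obtain ⟨N, hN⟩ := D.exists_mult_eq_zero h fun S => match S with
    | .odd _ _ k => k
    | _ => 0
  have h0 : ∀ t, t < N → D.mult (.odd p q t) = 0 := fun t ht => hN (.odd p q t) trivial ht
  obtain ⟨n, hn⟩ : ∃ n : ℕ, k + 1 - n < N := ⟨(k + 2 - N).toNat, by omega⟩
  have hz : ∀ j : ℕ, n ≤ j → A.bigolinTilde p q (k - j) = 0 := fun j hj => by
    rw [D.bigolinTilde_eq h, h0 _ (by omega), h0 _ (by omega)]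
    simp
  have hlt : ∀ j : ℕ, A.bigolinTilde p q (k - j) ≠ 0 → j < n := fun j hj => by
    by_contra hnj
    exact hj (hz j (by omega))
  refine ⟨(Set.finite_Iio n).subset hlt, ?_⟩
  rw [finsum_eq_sum_of_support_subset (s := Finset.range n)]
  swap
  · intro j hj
    rw [Finset.coe_range]
    exact hlt j (right_ne_zero_of_mul hj)
  -- Since h̃^k = b^{k+1} + b^k, the partial sums telescope; the remainder vanishes once the degree
  -- is below all odd zigzags.
  have hsum : ∀ t : ℕ, ∑ j ∈ Finset.range t, (-1) ^ j * A.bigolinTilde p q (k - j) =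
      (D.mult (.odd p q (k + 1)) : ℤ) - (-1) ^ t * D.mult (.odd p q (k + 1 - t)) := by
    intro t
    induction t with
    | zero => simp
    | succ t ih =>
      rw [Finset.sum_range_succ, ih, D.bigolinTilde_eq h,
        show k - (t : ℤ) + 1 = k + 1 - t by ring,
        show k + 1 - ((t + 1 : ℕ) : ℤ) = k - t by push_cast; ring]
      ring
  rw [hsum, h0 _ hn]
  simp

end Decomposition

section Compare

variable {B : DoubleComplex.{u} K} (D : Decomposition A) (E : Decomposition B)
  (h : {i | (D.shape i).IsZigzag}.Finite) (h' : {i | (E.shape i).IsZigzag}.Finite)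
include h h'

theorem mult_odd_eq (hAB : A.SameBigolinNumbers B) (p q k : ℤ) :
    D.mult (.odd p q k) = E.mult (.odd p q k) := by
  have h1 := (D.finite_bigolinTilde_ne_zero h p q (k - 1)).2
  have h2 := (E.finite_bigolinTilde_ne_zero h' p q (k - 1)).2
  have : A.bigolinTilde = B.bigolinTilde := by
    funext p q k
    simp only [bigolinTilde, hAB p _ k, hAB (p - 1) _ k]
  rw [this, h2, sub_add_cancel] at h1
  exact_mod_cast h1.symm

/-- The dimensions of E_l and E_{l+1} at `(p, q)` determine the sum of the multiplicities of the
zigzags that begin and of those that end there. The latter begin `l` columns further left, so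
induction on `p` from the region without zigzags separates the two. -/
theorem mult_evenH_eq (hAB : A.SameFrolicher B) (p q : ℤ) (l : ℕ+) :
    D.mult (.evenH p q l) = E.mult (.evenH p q l) := by
  obtain ⟨N, hN⟩ := D.exists_mult_eq_zero h fun S => match S with
    | .evenH p _ _ => p
    | _ => 0
  obtain ⟨N', hN'⟩ := E.exists_mult_eq_zero h' fun S => match S with
    | .evenH p _ _ => p
    | _ => 0
  have key : ∀ (t : ℕ) (p q : ℤ), p < min N N' + t →
      D.mult (.evenH p q l) = E.mult (.evenH p q l) := by
    intro t
    induction t with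
    | zero =>
      intro p q hp
      rw [hN (.evenH p q l) trivial (by dsimp only; omega),
        hN' (.evenH p q l) trivial (by dsimp only; omega)]
    | succ t ih =>
      intro p q hp
      have := l.pos
      have h1 := D.finrank_frolicherPage_eq h l p q
      have h2 := E.finrank_frolicherPage_eq h' l p q
      obtain ⟨e⟩ := hAB l p q l.pos
      obtain ⟨e'⟩ := hAB (l + 1) p q (by omega)
      rw [← e.finrank_eq, ← e'.finrank_eq] at h2
      have h3 := ih (p - l) (q + l - 1) (by push_cast at hp; omega)
      omega
  exact key (p - min N N' + 1).toNat p q (by omega)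

/-- The same argument, by induction on the row `q`. -/
theorem mult_evenV_eq (hAB : A.SameConjFrolicher B) (p q : ℤ) (l : ℕ+) :
    D.mult (.evenV p q l) = E.mult (.evenV p q l) := by
  obtain ⟨N, hN⟩ := D.exists_mult_eq_zero h fun S => match S with
    | .evenV _ q _ => q
    | _ => 0
  obtain ⟨N', hN'⟩ := E.exists_mult_eq_zero h' fun S => match S with
    | .evenV _ q _ => q
    | _ => 0
  have key : ∀ (t : ℕ) (p q : ℤ), q < min N N' + t →
      D.mult (.evenV p q l) = E.mult (.evenV p q l) := by
    intro t
    induction t with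
    | zero =>
      intro p q hq
      rw [hN (.evenV p q l) trivial (by dsimp only; omega),
        hN' (.evenV p q l) trivial (by dsimp only; omega)]
    | succ t ih =>
      intro p q hq
      have := l.pos
      have h1 := D.finrank_conjFrolicherPage_eq h l p q
      have h2 := E.finrank_conjFrolicherPage_eq h' l p q
      obtain ⟨e⟩ := hAB l p q l.pos
      obtain ⟨e'⟩ := hAB (l + 1) p q (by omega)
      rw [← e.finrank_eq, ← e'.finrank_eq] at h2
      have h3 := ih (p + l - 1) (q - l) (by push_cast at hq; omega)
      omega
  exact key (q - min N N' + 1).toNat p q (by omega)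

end Compare

end DoubleComplex
end

/-! ### Isomorphism up to squares -/

noncomputable section

namespace DirectSum

/-- A direct sum indexed by a disjoint union. -/
theorem exists_linearEquiv_sum (K : Type v) [Field K] {ι κ : Type u} (M : ι ⊕ κ → Type w)
    [∀ i, AddCommGroup (M i)] [∀ i, Module K (M i)] :
    ∃ e : (⨁ i, M i) ≃ₗ[K] (⨁ i, M (.inl i)) × (⨁ j, M (.inr j)),
      (∀ x i, (e x).1 i = x (.inl i)) ∧ ∀ x j, (e x).2 j = x (.inr j) := by
  classical
  let f : (⨁ i, M i) →ₗ[K] (⨁ i, M (.inl i)) × (⨁ j, M (.inr j)) :=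
    { toFun x := (DFinsupp.comapDomain Sum.inl Sum.inl_injective x,
        DFinsupp.comapDomain Sum.inr Sum.inr_injective x)
      map_add' _ _ := Prod.ext (DFinsupp.ext fun _ => rfl) (DFinsupp.ext fun _ => rfl)
      map_smul' _ _ := Prod.ext (DFinsupp.ext fun _ => rfl) (DFinsupp.ext fun _ => rfl) }
  have hf : Function.Bijective f := by
    constructor
    · intro x y hxy
      refine DFinsupp.ext fun i => ?_
      cases i with
      | inl i => exact DFunLike.congr_fun (congrArg Prod.fst hxy) i
      | inr j => exact DFunLike.congr_fun (congrArg Prod.snd hxy) j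
    · rintro ⟨x, y⟩
      refine ⟨⟨fun i => match i with
        | .inl i => x i
        | .inr j => y j, Trunc.mk ⟨x.support'.out.1.map .inl + y.support'.out.1.map .inr, ?_⟩⟩, ?_⟩
      · rintro (i | j)
        · refine (x.support'.out.2 i).imp (fun h => ?_) id
          exact Multiset.mem_add.2 (.inl (Multiset.mem_map_of_mem _ h))
        · refine (y.support'.out.2 j).imp (fun h => ?_) id
          exact Multiset.mem_add.2 (.inr (Multiset.mem_map_of_mem _ h))
      · exact Prod.ext (DFinsupp.ext fun i => rfl) (DFinsupp.ext fun j => rfl)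
  exact ⟨LinearEquiv.ofBijective f hf, fun _ _ => rfl, fun _ _ => rfl⟩

end DirectSum

namespace DoubleComplex

variable {K : Type v} [Field K]

theorem nonempty_iso_directSum_sum {ι κ : Type u} (C : ι ⊕ κ → DoubleComplex.{w} K) :
    Nonempty (Iso (directSum C)
      ((directSum fun i => C (.inl i)).prod (directSum fun j => C (.inr j)))) := by
  choose e he₁ he₂ using fun p q => DirectSum.exists_linearEquiv_sum K fun i => (C i).X p q
  refine ⟨⟨e, fun p q x => Prod.ext ?_ ?_, fun p q x => Prod.ext ?_ ?_⟩⟩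
  · refine DFinsupp.ext fun i => (he₁ _ _ _ i).trans ?_
    exact (congrArg ((C (.inl i)).del p q) (he₁ p q x i)).symm
  · refine DFinsupp.ext fun i => (he₂ _ _ _ i).trans ?_
    exact (congrArg ((C (.inr i)).del p q) (he₂ p q x i)).symm
  · refine DFinsupp.ext fun i => (he₁ _ _ _ i).trans ?_
    exact (congrArg ((C (.inl i)).delbar p q) (he₁ p q x i)).symm
  · refine DFinsupp.ext fun i => (he₂ _ _ _ i).trans ?_
    exact (congrArg ((C (.inr i)).delbar p q) (he₂ p q x i)).symm

theorem nonempty_iso_directSum_model {ι κ : Type u} (e : ι ≃ κ) {S : ι → Shape} {T : κ → Shape}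
    (h : ∀ i, T (e i) = S i) : Nonempty (Iso (directSum fun i => (S i).model K)
      (directSum fun j => (T j).model K)) := by
  obtain rfl : S = fun i => T (e i) := funext fun i => (h i).symm
  let φ : Iso (directSum fun j => (T j).model K) (directSum fun i => (T (e i)).model K) :=
    { equiv p q := DirectSum.lequivCongrLeft K (M := fun j => ((T j).model K).X p q) e.symm
      comm_del _ _ _ := DFinsupp.ext fun _ => rfl
      comm_delbar _ _ _ := DFinsupp.ext fun _ => rfl }
  exact ⟨φ.symm⟩

/-- The direct sum of an isomorphism with an identity map. -/
def Iso.prodRight {A : DoubleComplex.{u} K} {B : DoubleComplex.{w} K} (φ : Iso A B)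
    (C : DoubleComplex.{w'} K) : Iso (A.prod C) (B.prod C) where
  equiv p q := (φ.equiv p q).prodCongr (LinearEquiv.refl K (C.X p q))
  comm_del p q x := Prod.ext (φ.comm_del p q x.1) rfl
  comm_delbar p q x := Prod.ext (φ.comm_delbar p q x.1) rfl

end DoubleComplex

namespace DoubleComplex

variable {K : Type} [Field K] {A B : DoubleComplex.{u} K}

/-- The direct sum of squares with given lower left corners. -/
abbrev squares (K : Type) [Field K] {I : Type u} (f : I → ℤ × ℤ) : DoubleComplex.{u} K :=
  directSum fun i => (Shape.square (f i).1 (f i).2).model K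

theorem Decomposition.exists_prod_squares (D : Decomposition A) {I : Type u} (f : I → ℤ × ℤ) :
    ∃ D' : Decomposition (A.prod (squares K f)), ∃ e : D'.ι ≃ D.ι ⊕ I,
      ∀ i, D'.shape i = Sum.elim D.shape (fun i => .square (f i).1 (f i).2) (e i) := by
  obtain ⟨φ⟩ := nonempty_iso_directSum_sum fun i =>
    (Sum.elim D.shape (fun i : I => .square (f i).1 (f i).2) i).model K
  exact ⟨⟨D.ι ⊕ I, Sum.elim D.shape fun i => .square (f i).1 (f i).2,
    (D.iso.prodRight (squares K f)).trans φ.symm⟩, Equiv.refl _, fun i => rfl⟩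

/-- Transport of a decomposition along an isomorphism. -/
def Decomposition.ofIso (D : Decomposition A) (φ : Iso B A) : Decomposition B :=
  ⟨D.ι, D.shape, φ.trans D.iso⟩

theorem Decomposition.nonempty_iso (D : Decomposition A) (E : Decomposition B) (e : D.ι ≃ E.ι)
    (he : ∀ i, E.shape (e i) = D.shape i) : Nonempty (Iso A B) := by
  obtain ⟨φ⟩ := nonempty_iso_directSum_model (K := K) e he
  exact ⟨D.iso.trans (φ.trans E.iso.symm)⟩

theorem Decomposition.exists_sum_zigzags_prod_squares (D : Decomposition A)
    (h : {i | (D.shape i).IsZigzag}.Finite) {I : Type u} (f : I → ℤ × ℤ) :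
    ∃ (D' : Decomposition (A.prod (squares K f))) (h' : {i | (D'.shape i).IsZigzag}.Finite),
      ∀ F : Shape → ℕ, ∑ i ∈ D'.zigzags h', F (D'.shape i) = ∑ i ∈ D.zigzags h, F (D.shape i) := by
  obtain ⟨D', e, he⟩ := D.exists_prod_squares f
  have hz : {i | (D'.shape i).IsZigzag} =
      (Function.Embedding.inl.trans e.symm.toEmbedding) '' {i | (D.shape i).IsZigzag} := by
    ext i
    obtain ⟨i, rfl⟩ := e.symm.surjective i
    rw [Set.mem_ofPred_eq, he, e.apply_symm_apply]
    cases i with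
    | inl i => simp
    | inr i => simp [Shape.IsZigzag]
  have h' : {i | (D'.shape i).IsZigzag}.Finite := hz ▸ h.image _
  refine ⟨D', h', fun F => ?_⟩
  have : D'.zigzags h' = (D.zigzags h).map (Function.Embedding.inl.trans e.symm.toEmbedding) := by
    refine Finset.coe_injective ?_
    rw [Finset.coe_map]
    simpa only [Decomposition.zigzags, Set.Finite.coe_toFinset] using hz
  rw [this, Finset.sum_map]
  exact Finset.sum_congr rfl fun i _ => by simp [he]

/-- The numerical invariants of a double complex are not affected by squares. -/
theorem IsoUpToSquares.sum_zigzags_eq (hAB : IsoUpToSquares A B) (D : Decomposition A)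
    (E : Decomposition B) (h : {i | (D.shape i).IsZigzag}.Finite)
    (h' : {i | (E.shape i).IsZigzag}.Finite) (F : Shape → ℕ) (hF : ∀ C : DoubleComplex.{u} K,
      ∃ n, ∀ (D : Decomposition C) (h : {i | (D.shape i).IsZigzag}.Finite),
        n = ∑ i ∈ D.zigzags h, F (D.shape i)) :
    ∑ i ∈ D.zigzags h, F (D.shape i) = ∑ i ∈ E.zigzags h', F (E.shape i) := by
  obtain ⟨I, J, f, g, ⟨φ⟩⟩ := hAB
  obtain ⟨D', hD', hD⟩ := D.exists_sum_zigzags_prod_squares h f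
  obtain ⟨E', hE', hE⟩ := E.exists_sum_zigzags_prod_squares h' g
  -- By `hF` the sum does not depend on the decomposition; compare `D'` with the transport of `E'`
  -- along `φ`.
  obtain ⟨n, hn⟩ := hF (A.prod (squares K f))
  rw [← hD F, ← hE F, ← hn D' hD']
  exact hn (E'.ofIso φ) hE'

section

variable (hAB : IsoUpToSquares A B) (D : Decomposition A) (E : Decomposition B)
  (h : {i | (D.shape i).IsZigzag}.Finite) (h' : {i | (E.shape i).IsZigzag}.Finite)
include hAB D E h h'

theorem IsoUpToSquares.sameBigolinNumbers : SameBigolinNumbers A B := fun p q k => by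
  rw [(D.bigolinNumber_eq_sum h p q k).2, (E.bigolinNumber_eq_sum h' p q k).2]
  exact hAB.sum_zigzags_eq D E h h' (fun S => (S.model K).bigolinNumber p q k)
    fun C => ⟨C.bigolinNumber p q k, fun D h => (D.bigolinNumber_eq_sum h p q k).2⟩

theorem IsoUpToSquares.sameFrolicher : SameFrolicher A B := fun r p q hr => by
  have h1 := D.finrank_frolicherPage_eq_sum h hr p q
  have h2 := E.finrank_frolicherPage_eq_sum h' hr p q
  have := h1.1
  have := h2.1
  refine FiniteDimensional.nonempty_linearEquiv_of_finrank_eq ?_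
  rw [h1.2, h2.2]
  exact hAB.sum_zigzags_eq D E h h' (fun S => Module.finrank K ((S.model K).FrolicherPage r p q))
    fun C => ⟨_, fun D h => (D.finrank_frolicherPage_eq_sum h hr p q).2⟩

theorem IsoUpToSquares.sameConjFrolicher : SameConjFrolicher A B := fun r p q hr => by
  have h1 := D.finrank_conjFrolicherPage_eq_sum h hr p q
  have h2 := E.finrank_conjFrolicherPage_eq_sum h' hr p q
  have := h1.1
  have := h2.1
  refine FiniteDimensional.nonempty_linearEquiv_of_finrank_eq ?_
  rw [h1.2, h2.2]
  exact hAB.sum_zigzags_eq D E h h'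
    (fun S => Module.finrank K ((S.model K).ConjFrolicherPage r p q))
    fun C => ⟨_, fun D h => (D.finrank_conjFrolicherPage_eq_sum h hr p q).2⟩

end

/-- Add the squares of `B` to `A` and those of `A` to `B`. Both sides then consist of the same
squares and of zigzags with equal multiplicities, so the possibly infinite numbers of squares need
not be compared. -/
theorem isoUpToSquares_of_mult_eq (D : Decomposition A) (E : Decomposition B)
    (h : {i | (D.shape i).IsZigzag}.Finite) (h' : {i | (E.shape i).IsZigzag}.Finite)
    (hm : ∀ S : Shape, S.IsZigzag → D.mult S = E.mult S) : IsoUpToSquares A B := by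
  classical
  choose f hf using fun i : {i // ¬(D.shape i).IsZigzag} => Shape.exists_eq_square i.2
  choose g hg using fun i : {i // ¬(E.shape i).IsZigzag} => Shape.exists_eq_square i.2
  obtain ⟨D', d, hd⟩ := D.exists_prod_squares g
  obtain ⟨E', e, he⟩ := E.exists_prod_squares f
  have hz : ∀ S : Shape, Nonempty ({i : {i // (D.shape i).IsZigzag} // D.shape i = S} ≃
      {i : {i // (E.shape i).IsZigzag} // E.shape i = S}) := by
    intro S
    by_cases hS : S.IsZigzag
    -- Equality of `ncard` yields a bijection only because both fibres are finite.
    · have : Finite {i | D.shape i = S} := h.subset fun i hi => by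
        rw [Set.mem_ofPred_eq] at hi ⊢
        rwa [hi]
      have : Finite {i | E.shape i = S} := h'.subset fun i hi => by
        rw [Set.mem_ofPred_eq] at hi ⊢
        rwa [hi]
      obtain ⟨e⟩ := Finite.card_eq.1 (hm S hS)
      exact ⟨(Equiv.subtypeSubtypeEquivSubtype (p := fun i => (D.shape i).IsZigzag)
        (q := fun i => D.shape i = S) fun hi => hi ▸ hS).trans
          (e.trans (Equiv.subtypeSubtypeEquivSubtype (p := fun i => (E.shape i).IsZigzag)
            (q := fun i => E.shape i = S) fun hi => hi ▸ hS).symm)⟩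
    · have h1 : IsEmpty {i : {i // (D.shape i).IsZigzag} // D.shape i = S} :=
        ⟨fun i => hS (i.2 ▸ i.1.2)⟩
      have h2 : IsEmpty {i : {i // (E.shape i).IsZigzag} // E.shape i = S} :=
        ⟨fun i => hS (i.2 ▸ i.1.2)⟩
      exact ⟨Equiv.equivOfIsEmpty _ _⟩
  let z := Equiv.ofFiberEquiv fun S => (hz S).some
  have hzs : ∀ i, E.shape (z i) = D.shape i := fun i => Equiv.ofFiberEquiv_map (fun S => (hz S).some) i
  -- Rearranges (zigzags of `D` + squares of `D`) + squares of `E` into (zigzags of `E` + squares of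
  -- `E`) + squares of `D`, using `z` on the zigzags.
  let s := (Equiv.sumCongr (Equiv.sumCompl fun i => (D.shape i).IsZigzag)
    (Equiv.refl {i // ¬(E.shape i).IsZigzag})).symm.trans ((Equiv.sumAssoc _ _ _).trans
      ((Equiv.sumCongr z (Equiv.sumComm _ _)).trans ((Equiv.sumAssoc _ _ _).symm.trans
        (Equiv.sumCongr (Equiv.sumCompl fun i => (E.shape i).IsZigzag)
          (Equiv.refl {i // ¬(D.shape i).IsZigzag})))))
  have hs : ∀ i, Sum.elim E.shape (fun i => .square (f i).1 (f i).2) (s i) =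
      Sum.elim D.shape (fun i => .square (g i).1 (g i).2) i := by
    intro i
    obtain ⟨i, rfl⟩ := (Equiv.sumCongr (Equiv.sumCompl fun i => (D.shape i).IsZigzag)
      (Equiv.refl {i // ¬(E.shape i).IsZigzag})).surjective i
    simp only [s, Equiv.trans_apply, Equiv.symm_apply_apply]
    rcases i with (i | i) | i
    · exact hzs i
    · exact (hf i).symm
    · exact hg i
  refine ⟨_, _, g, f, D'.nonempty_iso E' (d.trans (s.trans e.symm)) fun i => ?_⟩
  rw [he, hd, Equiv.trans_apply, Equiv.trans_apply, e.apply_symm_apply, hs]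

end DoubleComplex
end

/-! ### The theorem and its corollary -/

theorem mainTheorem1 :
    -- every bounded double complex is a direct sum of squares and zigzags
    (∀ A : DoubleComplex.{u} ℂ, A.IsBounded → Nonempty A.Decomposition) ∧
    -- the alternating sum of the numbers `h̃` is the multiplicity of an odd zigzag
    (∀ A : DoubleComplex.{u} ℂ, A.IsBounded → A.HasFinitelyManyZigzags →
      (∀ p q k : ℤ, FiniteDimensional ℂ (A.BigolinCohomology p q k)) ∧
      ∀ (D : A.Decomposition) (p q k : ℤ),
        {j : ℕ | A.bigolinTilde p q (k - j) ≠ 0}.Finite ∧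
        ∑ᶠ j : ℕ, (-1) ^ j * A.bigolinTilde p q (k - j) = (D.mult (.odd p q (k + 1)) : ℤ)) ∧
    (∀ A₁ A₂ : DoubleComplex.{u} ℂ, A₁.IsBounded → A₁.HasFinitelyManyZigzags →
      A₂.IsBounded → A₂.HasFinitelyManyZigzags →
      -- the Bigolin numbers determine the multiplicities of all odd zigzags
      (A₁.SameBigolinNumbers A₂ → ∀ (D₁ : A₁.Decomposition) (D₂ : A₂.Decomposition) (p q k : ℤ),
        D₁.mult (.odd p q k) = D₂.mult (.odd p q k)) ∧
      -- the Frölicher spectral sequences determine the multiplicities of all even zigzags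
      (A₁.SameFrolicher A₂ → ∀ (D₁ : A₁.Decomposition) (D₂ : A₂.Decomposition) (p q : ℤ) (l : ℕ+),
        D₁.mult (.evenH p q l) = D₂.mult (.evenH p q l)) ∧
      (A₁.SameConjFrolicher A₂ →
        ∀ (D₁ : A₁.Decomposition) (D₂ : A₂.Decomposition) (p q : ℤ) (l : ℕ+),
        D₁.mult (.evenV p q l) = D₂.mult (.evenV p q l)) ∧
      -- together they determine the double complex up to squares
      (A₁.IsoUpToSquares A₂ ↔
        A₁.SameFrolicher A₂ ∧ A₁.SameConjFrolicher A₂ ∧ A₁.SameBigolinNumbers A₂)) := by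
  have hodd : ∀ A₁ A₂ : DoubleComplex.{u} ℂ, A₁.HasFinitelyManyZigzags →
      A₂.HasFinitelyManyZigzags → A₁.SameBigolinNumbers A₂ →
      ∀ (D₁ : A₁.Decomposition) (D₂ : A₂.Decomposition) (p q k : ℤ),
        D₁.mult (.odd p q k) = D₂.mult (.odd p q k) :=
    fun A₁ A₂ h₁ h₂ h D₁ D₂ => DoubleComplex.mult_odd_eq D₁ D₂ (h₁ D₁) (h₂ D₂) h
  have hH : ∀ A₁ A₂ : DoubleComplex.{u} ℂ, A₁.HasFinitelyManyZigzags →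
      A₂.HasFinitelyManyZigzags → A₁.SameFrolicher A₂ →
      ∀ (D₁ : A₁.Decomposition) (D₂ : A₂.Decomposition) (p q : ℤ) (l : ℕ+),
        D₁.mult (.evenH p q l) = D₂.mult (.evenH p q l) :=
    fun A₁ A₂ h₁ h₂ h D₁ D₂ => DoubleComplex.mult_evenH_eq D₁ D₂ (h₁ D₁) (h₂ D₂) h
  have hV : ∀ A₁ A₂ : DoubleComplex.{u} ℂ, A₁.HasFinitelyManyZigzags →
      A₂.HasFinitelyManyZigzags → A₁.SameConjFrolicher A₂ →
      ∀ (D₁ : A₁.Decomposition) (D₂ : A₂.Decomposition) (p q : ℤ) (l : ℕ+),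
        D₁.mult (.evenV p q l) = D₂.mult (.evenV p q l) :=
    fun A₁ A₂ h₁ h₂ h D₁ D₂ => DoubleComplex.mult_evenV_eq D₁ D₂ (h₁ D₁) (h₂ D₂) h
  refine ⟨fun A hA => hA.nonempty_decomposition, fun A hA hz => ⟨fun p q k => ?_, fun D p q k =>
    D.finite_bigolinTilde_ne_zero (hz D) p q k⟩, fun A₁ A₂ hA₁ hz₁ hA₂ hz₂ =>
    ⟨hodd A₁ A₂ hz₁ hz₂, hH A₁ A₂ hz₁ hz₂, hV A₁ A₂ hz₁ hz₂, fun h => ?_, fun h => ?_⟩⟩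
  · obtain ⟨D⟩ := hA.nonempty_decomposition
    exact (D.bigolinNumber_eq_sum (hz D) p q k).1
  · obtain ⟨D₁⟩ := hA₁.nonempty_decomposition
    obtain ⟨D₂⟩ := hA₂.nonempty_decomposition
    exact ⟨h.sameFrolicher D₁ D₂ (hz₁ D₁) (hz₂ D₂), h.sameConjFrolicher D₁ D₂ (hz₁ D₁) (hz₂ D₂),
      h.sameBigolinNumbers D₁ D₂ (hz₁ D₁) (hz₂ D₂)⟩
  · obtain ⟨D₁⟩ := hA₁.nonempty_decomposition
    obtain ⟨D₂⟩ := hA₂.nonempty_decomposition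
    refine DoubleComplex.isoUpToSquares_of_mult_eq D₁ D₂ (hz₁ D₁) (hz₂ D₂) fun S hS => ?_
    cases S with
    | square p q => exact hS.elim
    | odd p q k => exact hodd A₁ A₂ hz₁ hz₂ h.2.2 D₁ D₂ p q k
    | evenH p q l => exact hH A₁ A₂ hz₁ hz₂ h.1 D₁ D₂ p q l
    | evenV p q l => exact hV A₁ A₂ hz₁ hz₂ h.2.1 D₁ D₂ p q l
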